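/- Conventions. For a two-qubit density matrix $\rho$ on $\mathbb{C}^2\otimes\mathbb{C}^2$ and $2\times2$ matrices $A,B$, the local operation given by $A,B$ is $$\Theta_{A,B}(\rho)=\frac{(A\otimes B)\,\rho\,(A\otimes B)^\dagger}{\operatorname{Tr}\big((A\otimes B)\,\rho\,(A\otimes B)^\dagger\big)},$$ defined whenever the trace is nonzero. $E_F$ is the entanglement of formation (with logarithms to base $2$), and $M_\rho=\sup_\Theta E_F(\Theta(\rho))$ over all local operations $\Theta$ defined on $\rho$. A state is Bell-diagonal if it is diagonal in an orthonormal basis of maximally entangled vectors (equivalently, in the Bell basis up to a local unitary). A best distillation product of $\rho$ is a limit $\sigma=\lim_n\Xi_n(\rho)$, with $\Xi_n$ local operations, such that $E_F(\sigma)=M_\rho$. The state $\rho$ is incompletely quasi-distillable if $M_\rho<1$, no local operation $\Xi$ satisfies $E_F(\Xi(\rho))=M_\rho$, and $\rho$ has a best distillation product that is Bell-diagonal. Put $\tilde\rho=(\sigma_2\otimes\sigma_2)\,\bar\rho\,(\sigma_2\otimes\sigma_2)$, where $\sigma_2$ is the Pauli matrix and $\bar\rho$ the entrywise complex conjugate.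 Theorem. Let $\rho$ be an entangled density matrix on $\mathbb{C}^2\otimes\mathbb{C}^2$. Then $\rho$ is incompletely quasi-distillable if and only if the kernel of $\rho$ is spanned by a nonzero product vector $\phi_1\otimes\phi_2$. In that case, under every local operation $\Theta_{A,B}$ with $A,B$ invertible, the eigenvalues of $\tilde\rho\rho$ (with multiplicity) are all multiplied by one positive factor; the eigenvalues of $\tilde\rho\rho$ are $\lambda_1,\lambda_2,0,0$ with $\lambda_1>\lambda_2>0$; and every best distillation product $\sigma$ of $\rho$ is a Bell-diagonal state of rank two. More precisely, there are unitary $2\times 2$ matrices $U,V$ and $f\in\mathbb{C}$ with $|f|<\tfrac12$ such that $$\sigma=(U\otimes V)\begin{pmatrix}0&0&0&0\\0&\tfrac12&f&0\\0&\bar f&\tfrac12&0\\0&0&0&0\end{pmatrix}(U\otimes V)^\dagger$$ in the basis $|00\rangle,|01\rangle,|10\rangle,|11\rangle$, and $$\frac{\tfrac12+|f|}{\tfrac12-|f|}=\frac{\sqrt{\lambda_1}}{\sqrt{\lambda_2}},\qquad\text{that is,}\qquad |f|=\frac{\sqrt{\lambda_1}-\sqrt{\lambda_2}}{2\big(\sqrt{\lambda_1}+\sqrt{\lambda_2}\big)}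 .$$ -/

import Mathlib

open scoped Kronecker ComplexOrder

namespace TwoQubit

/-- Vectors of `ℂ² ⊗ ℂ²`, in coordinates with respect to the basis `|ij⟩`. -/
abbrev Vec : Type := Fin 2 × Fin 2 → ℂ

/-- Operators on one qubit. -/
abbrev Op₁ : Type := Matrix (Fin 2) (Fin 2) ℂ

/-- Operators on `ℂ² ⊗ ℂ²`. -/
abbrev Op : Type := Matrix (Fin 2 × Fin 2) (Fin 2 × Fin 2) ℂ

/-- The product (factorising) vector `φ₁ ⊗ φ₂`. -/
def tensorVec (φ₁ φ₂ : Fin 2 → ℂ) : Vec := fun i => φ₁ i.1 * φ₂ i.2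

/-- The rank-one operator `|ψ⟩⟨ψ|`. -/
def ketbra {ι : Type} (ψ : ι → ℂ) : Matrix ι ι ℂ := Matrix.vecMulVec ψ (star ψ)

/-- Density matrices: positive semidefinite with trace one. -/
def IsDensity {ι : Type} [Fintype ι] (ρ : Matrix ι ι ℂ) : Prop :=
  ρ.PosSemidef ∧ ρ.trace = 1

/-- Partial trace over the second qubit. -/
def partialTraceB (ρ : Op) : Op₁ := Matrix.of fun i j => ∑ k, ρ (i, k) (j, k)

/-- Separable states: convex combinations of product states. -/
def IsSeparable (ρ : Op) : Prop :=
  ρ ∈ convexHull ℝ {τ : Op | ∃ α β : Op₁, IsDensity α ∧ IsDensity β ∧ τ = α ⊗ₖ β}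

/-- Entangled states: states that are not separable. -/
def IsEntangled (ρ : Op) : Prop := IsDensity ρ ∧ ¬ IsSeparable ρ

/-- The von Neumann entropy `-Tr (ρ log₂ ρ)` of a density matrix, as the Shannon entropy (to base
two) of its eigenvalues, counted with multiplicity. -/
noncomputable def entropy (ρ : Op₁) : ℝ :=
  (ρ.charpoly.roots.map fun z => Real.negMulLog z.re).sum / Real.log 2

/-- The entanglement of a pure state: the entropy of its reduced state. -/
noncomputable def pureEntanglement (ψ : Vec) : ℝ := entropy (partialTraceB (ketbra ψ))

/-- The entanglement of formation `E_F`: the infimum of the average entanglement over all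
finite ensembles of (unit) pure states that realise `ρ`. -/
noncomputable def entanglementOfFormation (ρ : Op) : ℝ :=
  sInf {e : ℝ | ∃ (n : ℕ) (p : Fin n → ℝ) (ψ : Fin n → Vec),
    (∀ i, 0 ≤ p i) ∧ ∑ i, p i = 1 ∧ (∀ i, star (ψ i) ⬝ᵥ ψ i = 1) ∧
    ρ = ∑ i, (p i : ℂ) • ketbra (ψ i) ∧ e = ∑ i, p i * pureEntanglement (ψ i)}

/-- The unnormalised outcome `(A ⊗ B) ρ (A ⊗ B)†` of the local filtration `A ⊗ B`. -/
noncomputable def filtered (A B : Op₁) (ρ : Op) : Op := (A ⊗ₖ B) * ρ * (A ⊗ₖ B).conjTranspose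

/-- The local operation `ρ ↦ (A ⊗ B) ρ (A ⊗ B)† / Tr ((A ⊗ B) ρ (A ⊗ B)†)`; it is defined when the
trace does not vanish. -/
noncomputable def localOp (A B : Op₁) (ρ : Op) : Op :=
  (filtered A B ρ).trace⁻¹ • filtered A B ρ

/-- The states `Θ(ρ)` that are obtained from `ρ` by a local operation `Θ`. -/
def localProducts (ρ : Op) : Set Op :=
  {τ | ∃ A B : Op₁, (filtered A B ρ).trace ≠ 0 ∧ τ = localOp A B ρ}

/-- `M_ρ`, the supremum of `E_F(Θ(ρ))` over the local operations `Θ`. -/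
noncomputable def maxEntanglement (ρ : Op) : ℝ :=
  sSup (entanglementOfFormation '' localProducts ρ)

/-- Maximally entangled unit vectors: the reduced state is maximally mixed. -/
def IsMaximallyEntangled (ψ : Vec) : Prop := partialTraceB (ketbra ψ) = (1 / 2 : ℂ) • (1 : Op₁)

/-- Bell-diagonal operators: diagonal in an orthonormal basis of maximally entangled vectors, i.e.
in the image of the standard Bell basis under a local unitary. -/
def IsBellDiagonal (σ : Op) : Prop :=
  ∃ (ψ : Fin 4 → Vec) (p : Fin 4 → ℝ),
    (∀ i j, star (ψ i) ⬝ᵥ ψ j = if i = j then 1 else 0) ∧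
    (∀ i, IsMaximallyEntangled (ψ i)) ∧ σ = ∑ i, (p i : ℂ) • ketbra (ψ i)

/-- `σ` is a best distillation product of `ρ`: a limit of states `Ξₙ(ρ)` with local operations
`Ξₙ`, such that `E_F(σ) = M_ρ`. -/
def IsBestDistillationProduct (ρ σ : Op) : Prop :=
  (∃ τ : ℕ → Op, (∀ n, τ n ∈ localProducts ρ) ∧ Filter.Tendsto τ Filter.atTop (nhds σ)) ∧
    entanglementOfFormation σ = maxEntanglement ρ

/-- Incomplete quasi-distillability: `M_ρ < 1`, no local operation reaches `M_ρ`, but `M_ρ` is the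
entanglement of a Bell-diagonal limit of states `Ξₙ(ρ)` with local operations `Ξₙ`. -/
def IsIncompletelyQuasiDistillable (ρ : Op) : Prop :=
  maxEntanglement ρ < 1 ∧
  (¬ ∃ τ ∈ localProducts ρ, entanglementOfFormation τ = maxEntanglement ρ) ∧
  ∃ σ, IsBestDistillationProduct ρ σ ∧ IsBellDiagonal σ

/-- The kernel of `ρ` is the line spanned by a (nonzero) product vector. -/
def KernelSpannedByProductVector (ρ : Op) : Prop :=
  ∃ φ₁ φ₂ : Fin 2 → ℂ, φ₁ ≠ 0 ∧ φ₂ ≠ 0 ∧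
    LinearMap.ker (Matrix.toLin' ρ) = Submodule.span ℂ {tensorVec φ₁ φ₂}

/-- The Pauli matrix `σ₂`. -/
def pauliY : Op₁ := !![0, -Complex.I; Complex.I, 0]

/-- The spin-flipped matrix `ρ̃ = (σ₂ ⊗ σ₂) ρ̄ (σ₂ ⊗ σ₂)`. -/
noncomputable def spinFlip (ρ : Op) : Op :=
  (pauliY ⊗ₖ pauliY) * ρ.map (starRingEnd ℂ) * (pauliY ⊗ₖ pauliY)

/-- The eigenvalues of `ρ̃ρ`, counted with algebraic multiplicity. -/
noncomputable def flipEigenvalues (ρ : Op) : Multiset ℂ := (spinFlip ρ * ρ).charpoly.roots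

/-- The matrix with the block `(1/2, f; f̄, 1/2)` in the rows and columns of `|01⟩`, `|10⟩` and
zeros elsewhere. -/
noncomputable def bellBlock (f : ℂ) : Op :=
  Matrix.single (0, 1) (0, 1) (1 / 2) + Matrix.single (0, 1) (1, 0) f +
    Matrix.single (1, 0) (0, 1) (starRingEnd ℂ f) + Matrix.single (1, 0) (1, 0) (1 / 2)

end TwoQubit

/-!
The proof rests on Wootters' formula `E_F(ρ) = entFn (concurrence ρ)`
(`entanglementOfFormation_eq`). The symmetric form `flipForm x y = xᵀ (σ₂ ⊗ σ₂) y` has a Takagi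
factorisation on the range of `ρ`, that is, `ρ = ∑ |xᵢ⟩⟨xᵢ|` with vectors that are orthogonal for
`flipForm` (`exists_isFlipOrthogonal`), and the moduli `|flipForm xᵢ xᵢ|` are the square roots
`√λᵢ` of the eigenvalues of `ρ̃ρ`. The lower bound on `E_F` uses that `entFn` is convex; the upper
bound comes from rotating the decomposition until all of its members have the same concurrence;
and entangled states have positive concurrence (`IsEntangled.concurrence_pos`).

Since `flipForm ((A ⊗ B) x) ((A ⊗ B) y) = det A * det B * flipForm x y`, a local operation
multiplies all `√λᵢ`, hence also the concurrence, by one factor, the `filterRate`. Their sum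
`rootSum` is at most one on states, so no local product of `ρ` has a concurrence above
`maxConcurrence ρ = concurrence ρ / rootSum ρ`.

*Kernel of an incompletely quasi-distillable state.* If no nonzero product vector lies in the kernel
of `ρ`, no pair of nonzero filters annihilates `ρ`, and by compactness the `filterRate` attains its
maximum. So some product vector lies in the kernel, and a local unitary moves it to `|00⟩`
(`HasCornerKernel`). The eigenvalues are then `(√(ab) ± |f|)², 0, 0`, where `a, b` are the middle
diagonal entries of `ρ` and `f` is the entry between them. If `√(ab) = |f|`, the supremum is one.
If the kernel holds a further vector, some triangular filter also moves a product vector of the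
kernel to `|11⟩`, and a diagonal filter reaches the supremum. Otherwise the kernel is a line.

*States whose kernel is spanned by a product vector.* Diagonal filters drive the normal form to the
Bell-diagonal state `bellBlock (f / (2√(ab)))`, whose concurrence is `maxConcurrence ρ`, and
`maxConcurrence ρ < 1` because the kernel is only one-dimensional. Every best distillation product
`σ` inherits a product vector in its kernel and the ratio `λ₁ : λ₂`, as these are closed conditions
(`isClosed_hasProductKernel`, `isClosed_flipProportional`). Its concurrence is the maximal one, so
`rootSum σ = 1`, and equality in the inequality of the means forces `σ` to be a `bellBlock` up to a
local unitary. Its rank is two, whereas invertible filters preserve the rank, three, of `ρ`, and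
singular filters give concurrence zero: the supremum is not attained.
-/

namespace TwoQubit

/-! ### The entanglement of a pure state as a function of its concurrence -/

/-- The entropy, in bits, of a qubit whose density matrix has eigenvalues `(1 ± √(1 - c²)) / 2`:
the entanglement of a pure state of two qubits of concurrence `c`. -/
noncomputable def entFn (c : ℝ) : ℝ := Real.binEntropy ((1 - √(1 - c ^ 2)) / 2) / Real.log 2

lemma entFn_continuous : Continuous entFn := by
  unfold entFn
  fun_prop

@[simp] lemma entFn_one : entFn 1 = 1 := by
  have : Real.log 2 ≠ 0 := (Real.log_pos (by norm_num)).ne'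
  simp [entFn, this]

lemma entFn_strictMonoOn : StrictMonoOn entFn (Set.Icc 0 1) := by
  intro x hx y hy hxy
  have hs : √(1 - y ^ 2) < √(1 - x ^ 2) :=
    Real.sqrt_lt_sqrt (by nlinarith [hy.1, hy.2]) (by nlinarith [hx.1])
  have h1 : √(1 - x ^ 2) ≤ 1 := Real.sqrt_le_one.2 (by nlinarith [hx.1])
  have h0 : 0 ≤ √(1 - y ^ 2) := Real.sqrt_nonneg _
  refine div_lt_div_of_pos_right ?_ (Real.log_pos (by norm_num))
  apply Real.binEntropy_strictMonoOn
  · constructor <;> linarith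
  · constructor <;> linarith
  · linarith

lemma two_mul_le_log_sub_log {s : ℝ} (h0 : 0 ≤ s) (h1 : s < 1) :
    2 * s ≤ Real.log (1 + s) - Real.log (1 - s) := by
  have h := Real.hasSum_log_sub_log_of_abs_lt_one (x := s)
    (by rw [abs_lt]; constructor <;> linarith)
  have := h.summable.sum_le_tsum {0} (fun i _ => by positivity)
  rw [h.tsum_eq] at this
  simpa using this

/-- The function `√(1 - s²) / s · log ((1 + s) / (1 - s))`, which at `s = √(1 - c²)` is, up to a
positive factor, the derivative of `entFn` at `c`. -/
noncomputable def slopeFn (s : ℝ) : ℝ := √(1 - s ^ 2) / s * (Real.log (1 + s) - Real.log (1 - s))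

lemma slopeFn_antitoneOn : AntitoneOn slopeFn (Set.Ioo 0 1) := by
  have hd : ∀ s ∈ Set.Ioo (0 : ℝ) 1, HasDerivAt slopeFn
      ((2 * s - (Real.log (1 + s) - Real.log (1 - s))) / (√(1 - s ^ 2) * s ^ 2)) s := by
    rintro s ⟨h0, h1⟩
    have hp : 0 < 1 - s ^ 2 := by nlinarith
    have hw : 0 < √(1 - s ^ 2) := Real.sqrt_pos.2 hp
    have hw2 : √(1 - s ^ 2) ^ 2 = 1 - s ^ 2 := Real.sq_sqrt hp.le
    have d1 : HasDerivAt (fun s : ℝ => √(1 - s ^ 2)) (-(2 * s) / (2 * √(1 - s ^ 2))) s := by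
      have := (((hasDerivAt_id s).pow 2).const_sub 1).sqrt (by simpa using hp.ne')
      simpa using this
    have d2 : HasDerivAt (fun s : ℝ => Real.log (1 + s) - Real.log (1 - s))
        (1 / (1 + s) - -1 / (1 - s)) s := by
      refine HasDerivAt.sub ?_ ?_
      · simpa using ((hasDerivAt_id s).const_add 1).log (by simp; linarith)
      · simpa using ((hasDerivAt_id s).const_sub 1).log (by simp; linarith)
    have := (d1.div (hasDerivAt_id s) h0.ne').mul d2
    refine this.congr_deriv ?_
    have e1 : (1 + s) ≠ 0 := by linarith
    have e2 : (1 - s) ≠ 0 := by linarith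
    simp only [Pi.div_apply, id]
    generalize Real.log (1 + s) - Real.log (1 - s) = L
    generalize √(1 - s ^ 2) = w at *
    field_simp
    ring_nf
    rw [hw2]
    ring
  apply antitoneOn_of_deriv_nonpos (convex_Ioo 0 1)
  · exact fun s hs => (hd s hs).continuousAt.continuousWithinAt
  · intro s hs
    rw [interior_Ioo] at hs
    exact (hd s hs).differentiableAt.differentiableWithinAt
  · intro s hs
    rw [interior_Ioo] at hs
    rw [(hd s hs).deriv]
    apply div_nonpos_of_nonpos_of_nonneg
    · linarith [two_mul_le_log_sub_log hs.1.le hs.2]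
    · positivity

/-- The derivative of `entFn` is an increasing function of `c`, as `slopeFn` is decreasing and so is
`c ↦ √(1 - c²)`. -/
lemma entFn_convexOn : ConvexOn ℝ (Set.Icc 0 1) entFn := by
  have hd : ∀ c ∈ Set.Ioo (0 : ℝ) 1, HasDerivAt entFn
      (slopeFn (√(1 - c ^ 2)) / (2 * Real.log 2)) c := by
    rintro c ⟨h0, h1⟩
    have hp : 0 < 1 - c ^ 2 := by nlinarith
    have hw : 0 < √(1 - c ^ 2) := Real.sqrt_pos.2 hp
    have hw2 : √(1 - c ^ 2) ^ 2 = 1 - c ^ 2 := Real.sq_sqrt hp.le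
    have hw1 : √(1 - c ^ 2) < 1 := by nlinarith
    have d1 : HasDerivAt (fun s : ℝ => √(1 - s ^ 2)) (-(2 * c) / (2 * √(1 - c ^ 2))) c := by
      have := (((hasDerivAt_id c).pow 2).const_sub 1).sqrt (by simpa using hp.ne')
      simpa using this
    have d2 := (d1.const_sub 1).div_const 2
    have d3 := Real.hasDerivAt_binEntropy (p := (1 - √(1 - c ^ 2)) / 2) (by linarith) (by linarith)
    have d4 := (d3.comp c d2).div_const (Real.log 2)
    refine d4.congr_deriv ?_
    have e : √(1 - √(1 - c ^ 2) ^ 2) = c := by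
      rw [hw2]; simpa using Real.sqrt_sq h0.le
    rw [slopeFn, e]
    generalize √(1 - c ^ 2) = w at *
    rw [show 1 - (1 - w) / 2 = (1 + w) / 2 by ring, Real.log_div (by linarith) (by norm_num),
      Real.log_div (by linarith) (by norm_num)]
    field_simp
    ring
  apply MonotoneOn.convexOn_of_deriv (convex_Icc 0 1) entFn_continuous.continuousOn
  · intro s hs
    rw [interior_Icc] at hs
    exact (hd s hs).differentiableAt.differentiableWithinAt
  · intro x hx y hy hxy
    rw [interior_Icc] at hx hy
    rw [(hd x hx).deriv, (hd y hy).deriv]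
    have hl : 0 < 2 * Real.log 2 := mul_pos two_pos (Real.log_pos (by norm_num))
    refine div_le_div_of_nonneg_right ?_ hl.le
    have key : ∀ z ∈ Set.Ioo (0 : ℝ) 1, √(1 - z ^ 2) ∈ Set.Ioo (0 : ℝ) 1 := by
      rintro z ⟨z0, z1⟩
      refine ⟨Real.sqrt_pos.2 (by nlinarith), ?_⟩
      rw [Real.sqrt_lt' one_pos]; nlinarith
    exact slopeFn_antitoneOn (key y hy) (key x hx)
      (Real.sqrt_le_sqrt (by nlinarith [hx.1, hy.1]))

/-! ### The flip form -/

/-- The symmetric bilinear form `(x, y) ↦ xᵀ (σ₂ ⊗ σ₂) y`. On a unit vector `x` the modulus of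
`flipForm x x` is the concurrence. -/
def flipForm (x y : Vec) : ℂ :=
  x (0, 1) * y (1, 0) + x (1, 0) * y (0, 1) - x (0, 0) * y (1, 1) - x (1, 1) * y (0, 0)

lemma flipForm_comm (x y : Vec) : flipForm x y = flipForm y x := by
  simp only [flipForm]; ring

lemma flipForm_eq_dotProduct (x y : Vec) :
    flipForm x y = x ⬝ᵥ (pauliY ⊗ₖ pauliY).mulVec y := by
  simp [flipForm, dotProduct, Matrix.mulVec, Fintype.sum_prod_type, Fin.sum_univ_two, pauliY,
    Matrix.kroneckerMap_apply]
  ring_nf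

/-- The squared norm of a vector of `ℂ² ⊗ ℂ²`. -/
noncomputable def nsq (x : Vec) : ℝ := ∑ i, ‖x i‖ ^ 2

lemma nsq_nonneg (x : Vec) : 0 ≤ nsq x := Finset.sum_nonneg fun _ _ => by positivity

lemma nsq_eq_zero {x : Vec} : nsq x = 0 ↔ x = 0 := by
  simp [nsq, Finset.sum_eq_zero_iff_of_nonneg, funext_iff]

lemma star_dotProduct_self (x : Vec) : star x ⬝ᵥ x = (nsq x : ℂ) := by
  simp [dotProduct, nsq, ← Complex.normSq_eq_norm_sq, Complex.normSq_eq_conj_mul_self]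

lemma trace_ketbra (x : Vec) : (ketbra x).trace = (nsq x : ℂ) := by
  rw [ketbra, Matrix.trace_vecMulVec, dotProduct_comm, star_dotProduct_self]

lemma nsq_smul (c : ℂ) (x : Vec) : nsq (c • x) = ‖c‖ ^ 2 * nsq x := by
  simp [nsq, Finset.mul_sum, mul_pow]

lemma ketbra_smul (c : ℂ) (x : Vec) : ketbra (c • x) = ((‖c‖ ^ 2 : ℝ) : ℂ) • ketbra x := by
  ext i j
  simp [ketbra, Matrix.vecMulVec_apply, ← Complex.normSq_eq_norm_sq,
    Complex.normSq_eq_conj_mul_self]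
  ring

lemma flipForm_smul_smul (c d : ℂ) (x y : Vec) :
    flipForm (c • x) (d • y) = c * d * flipForm x y := by
  simp [flipForm]; ring

lemma norm_flipForm_self_le (x : Vec) : ‖flipForm x x‖ ≤ nsq x := by
  have h : flipForm x x = 2 * (x (0, 1) * x (1, 0)) + -(2 * (x (0, 0) * x (1, 1))) := by
    simp [flipForm]; ring
  rw [h]
  refine (norm_add_le _ _).trans ?_
  simp [nsq, Fintype.sum_prod_type, Fin.sum_univ_two]
  nlinarith [sq_nonneg (‖x (0, 1)‖ - ‖x (1, 0)‖), sq_nonneg (‖x (0, 0)‖ - ‖x (1, 1)‖)]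

/-- The reduced state of a unit vector `x` has trace one and determinant `|flipForm x x|² / 4`,
which determines its eigenvalues. -/
lemma pureEntanglement_eq {x : Vec} (hx : nsq x = 1) :
    pureEntanglement x = entFn ‖flipForm x x‖ := by
  set c := ‖flipForm x x‖ with hc
  have hc1 : c ≤ 1 := hx ▸ norm_flipForm_self_le x
  have hc0 : 0 ≤ c := norm_nonneg _
  set R := partialTraceB (ketbra x) with hR
  have htr : R.trace = 1 := by
    have : R.trace = (nsq x : ℂ) := by
      rw [← trace_ketbra]
      simp [hR, partialTraceB, Matrix.trace, Fintype.sum_prod_type]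
    rw [this, hx]; simp
  have hdet : R.det = ((c ^ 2 / 4 : ℝ) : ℂ) := by
    have : c ^ 2 = Complex.normSq (flipForm x x) := (Complex.normSq_eq_norm_sq _).symm
    rw [this]; push_cast
    rw [Complex.normSq_eq_conj_mul_self, Matrix.det_fin_two]
    simp [hR, partialTraceB, ketbra, Matrix.vecMulVec_apply, flipForm]
    ring
  have hs : √(1 - c ^ 2) ^ 2 = 1 - c ^ 2 := Real.sq_sqrt (by nlinarith)
  have hroots : R.charpoly.roots =
      {(((1 - √(1 - c ^ 2)) / 2 : ℝ) : ℂ), (((1 - (1 - √(1 - c ^ 2)) / 2 : ℝ)) : ℂ)} := by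
    have : R.charpoly = (Polynomial.X - Polynomial.C (((1 - √(1 - c ^ 2)) / 2 : ℝ) : ℂ)) *
        (Polynomial.X - Polynomial.C (((1 - (1 - √(1 - c ^ 2)) / 2 : ℝ)) : ℂ)) := by
      rw [Matrix.charpoly_fin_two, htr, hdet]
      have e : c ^ 2 / 4 = (1 - √(1 - c ^ 2)) / 2 * (1 - (1 - √(1 - c ^ 2)) / 2) := by nlinarith
      rw [e]
      generalize (1 - √(1 - c ^ 2)) / 2 = r
      push_cast
      simp only [map_sub, map_mul, map_one]
      ring
    rw [this, Polynomial.roots_mul (mul_ne_zero (Polynomial.X_sub_C_ne_zero _)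
      (Polynomial.X_sub_C_ne_zero _)), Polynomial.roots_X_sub_C, Polynomial.roots_X_sub_C]
    rfl
  rw [pureEntanglement, entropy, hroots, entFn, Real.binEntropy_eq_negMulLog_add_negMulLog_one_sub]
  simp only [Multiset.insert_eq_cons, Multiset.map_cons, Multiset.map_singleton, Multiset.sum_cons,
    Multiset.sum_singleton, Complex.ofReal_re]

/-! ### Takagi factorisation -/

section Takagi

variable {E : Type*} [NormedAddCommGroup E] [InnerProductSpace ℂ E]

lemma eq_zero_of_forall_two_mul_le {β K : ℝ} (h : ∀ t : ℝ, 2 * t * β ≤ K * t ^ 2) : β = 0 := by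
  by_contra hβ
  have hK : 0 < |K| + 1 := by positivity
  have h1 := h (β / (|K| + 1))
  have h2 : 0 < β ^ 2 := by positivity
  have h3 : K * (β / (|K| + 1)) ^ 2 ≤ (|K| + 1) * (β / (|K| + 1)) ^ 2 := by
    gcongr
    linarith [le_abs_self K]
  have h4 : (|K| + 1) * (β / (|K| + 1)) ^ 2 = β ^ 2 / (|K| + 1) := by field_simp
  have h5 : 2 * (β / (|K| + 1)) * β = 2 * (β ^ 2 / (|K| + 1)) := by ring
  have h6 : 0 < β ^ 2 / (|K| + 1) := by positivity
  linarith

/-- First-order condition for a maximiser `x₀` of `‖B x x‖` on the unit sphere of a subspace, for a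
symmetric form `B` that takes a real value `μ` at `x₀`. -/
lemma bilin_eq_zero_of_isMax (B : E →ₗ[ℂ] E →ₗ[ℂ] ℂ) (hB : ∀ x y, B x y = B y x)
    {W : Submodule ℂ E} {x₀ : E} {μ : ℝ} (hμ : B x₀ x₀ = μ) (hx₀ : ‖x₀‖ = 1) (hxW : x₀ ∈ W)
    (hmax : ∀ y ∈ W, ‖B y y‖ ≤ μ * ‖y‖ ^ 2) {y : E} (hy : y ∈ W) (hxy : inner ℂ x₀ y = 0) :
    B x₀ y = 0 := by
  have key : ∀ y ∈ W, inner ℂ x₀ y = 0 → (B x₀ y).re = 0 := by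
    intro y hy hxy
    apply eq_zero_of_forall_two_mul_le (K := μ * ‖y‖ ^ 2 - (B y y).re)
    intro t
    have h := hmax (x₀ + (t : ℂ) • y) (W.add_mem hxW (W.smul_mem _ hy))
    have hn : ‖x₀ + (t : ℂ) • y‖ ^ 2 = 1 + t ^ 2 * ‖y‖ ^ 2 := by
      have := norm_add_sq_eq_norm_sq_add_norm_sq_of_inner_eq_zero (𝕜 := ℂ) x₀ ((t : ℂ) • y)
        (by rw [inner_smul_right, hxy, mul_zero])
      rw [sq, this, hx₀, norm_smul]
      simp
      rw [mul_mul_mul_comm, abs_mul_abs_self]; ring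
    have he : B (x₀ + (t : ℂ) • y) (x₀ + (t : ℂ) • y) = μ + 2 * t * B x₀ y + t ^ 2 * B y y := by
      simp only [map_add, map_smul, LinearMap.add_apply, LinearMap.smul_apply, smul_eq_mul, hμ,
        hB y x₀]
      ring
    have hre := (Complex.re_le_norm _).trans h
    rw [he, hn] at hre
    have : ((μ : ℂ) + 2 * t * B x₀ y + t ^ 2 * B y y).re
        = μ + 2 * t * (B x₀ y).re + t ^ 2 * (B y y).re := by
      simp [← Complex.ofReal_pow]
    rw [this] at hre
    linarith
  have h1 := key y hy hxy
  have h2 := key (Complex.I • y) (W.smul_mem _ hy) (by rw [inner_smul_right, hxy, mul_zero])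
  apply Complex.ext
  · simpa using h1
  · simpa using h2

/-- Takagi factorisation: an orthonormal family of vectors `v i` such that a given symmetric
bilinear form `B` satisfies `B (v i) = μ i ⟪v i, ·⟫` with `μ i ≥ 0`. The family is extended one
vector at a time, by a maximiser of `‖B x x‖` on the unit sphere of the orthogonal complement. -/
lemma exists_orthonormal_takagi [FiniteDimensional ℂ E] (B : E →ₗ[ℂ] E →ₗ[ℂ] ℂ)
    (hB : ∀ x y, B x y = B y x) (k : ℕ) (hk : k ≤ Module.finrank ℂ E) :
    ∃ (v : Fin k → E) (μ : Fin k → ℝ), Orthonormal ℂ v ∧ (∀ i, 0 ≤ μ i) ∧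
      ∀ i y, B (v i) y = μ i * inner ℂ (v i) y := by
  induction k with
  | zero => exact ⟨Fin.elim0, Fin.elim0, ⟨fun i => i.elim0, fun i => i.elim0⟩,
      fun i => i.elim0, fun i => i.elim0⟩
  | succ k ih =>
    obtain ⟨v, μ, hv, hμ, hvB⟩ := ih (by omega)
    set W : Submodule ℂ E := (Submodule.span ℂ (Set.range v))ᗮ with hW
    have hWv : ∀ y ∈ W, ∀ i, inner ℂ (v i) y = 0 := fun y hy i =>
      (Submodule.mem_orthogonal _ _).1 hy _ (Submodule.subset_span ⟨i, rfl⟩)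
    have hWne : ∃ w ∈ W, w ≠ 0 := by
      apply Submodule.exists_mem_ne_zero_of_ne_bot
      intro hbot
      have h1 := Submodule.finrank_add_finrank_orthogonal (Submodule.span ℂ (Set.range v))
      rw [← hW, hbot, finrank_bot] at h1
      have h2 := finrank_range_le_card (R := ℂ) v
      rw [Set.finrank, Fintype.card_fin] at h2
      omega
    obtain ⟨w, hwW, hw0⟩ := hWne
    have : FiniteDimensional ℝ E := FiniteDimensional.complexToReal E
    have : ProperSpace E := FiniteDimensional.proper ℂ E
    have hcont : Continuous fun x : E => ‖B x x‖ := by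
      have : (fun x : E => ‖B x x‖) = fun x => ‖(LinearMap.toContinuousLinearMap
          ((LinearMap.toContinuousLinearMap : (E →ₗ[ℂ] ℂ) ≃ₗ[ℂ] _).toLinearMap ∘ₗ B)) x x‖ := by
        ext x; simp
      rw [this]
      fun_prop
    have hcpt : IsCompact (Metric.sphere (0 : E) 1 ∩ W) :=
      (isCompact_sphere 0 1).inter_right (Submodule.closed_of_finiteDimensional W)
    have hne : (Metric.sphere (0 : E) 1 ∩ W).Nonempty :=
      ⟨((‖w‖⁻¹ : ℝ) : ℂ) • w, by simp [norm_smul, hw0], W.smul_mem _ hwW⟩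
    obtain ⟨z, ⟨hz1, hzW⟩, hz⟩ := hcpt.exists_isMaxOn hne hcont.continuousOn
    have hz1 : ‖z‖ = 1 := by simpa using hz1
    -- a phase makes the maximal value real
    obtain ⟨u, hu, huz⟩ : ∃ u : ℂ, ‖u‖ = 1 ∧ u ^ 2 * B z z = ‖B z z‖ := by
      refine ⟨Complex.exp (-(Complex.arg (B z z) / 2 : ℝ) * Complex.I), ?_, ?_⟩
      · rw [← Complex.ofReal_neg, Complex.norm_exp_ofReal_mul_I]
      · nth_rw 2 [← Complex.norm_mul_exp_arg_mul_I (B z z)]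
        rw [← Complex.exp_nat_mul, mul_left_comm, ← Complex.exp_add]
        push_cast
        ring_nf
        simp
    have hx1 : ‖u • z‖ = 1 := by rw [norm_smul, hu, hz1, one_mul]
    have hxW : u • z ∈ W := W.smul_mem _ hzW
    have hxB : B (u • z) (u • z) = (‖B z z‖ : ℝ) := by
      rw [← huz]
      simp only [map_smul, LinearMap.smul_apply, smul_eq_mul]
      ring
    generalize u • z = x₀ at hx1 hxW hxB
    have hmax : ∀ y ∈ W, ‖B y y‖ ≤ ‖B z z‖ * ‖y‖ ^ 2 := by
      intro y hy
      rcases eq_or_ne y 0 with rfl | hy0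
      · simp
      have hyn : 0 < ‖y‖ := norm_pos_iff.2 hy0
      have := hz (show ((‖y‖⁻¹ : ℝ) : ℂ) • y ∈ _ from
        ⟨by simp [norm_smul, hy0], W.smul_mem _ hy⟩)
      simp only [Set.mem_ofPred_eq, map_smul, LinearMap.smul_apply, smul_eq_mul, norm_mul,
        Complex.norm_real, norm_inv, norm_norm] at this
      field_simp at this
      linarith
    have hx0 : ∀ y, B x₀ y = ‖B z z‖ * inner ℂ x₀ y := by
      have hxv : ∀ i, B x₀ (v i) = 0 := fun i => by
        rw [hB, hvB, hWv _ hxW, mul_zero]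
      have hxs : ∀ s ∈ Submodule.span ℂ (Set.range v), B x₀ s = 0 := by
        intro s hs
        have : Submodule.span ℂ (Set.range v) ≤ LinearMap.ker (B x₀) := by
          rw [Submodule.span_le]
          rintro _ ⟨i, rfl⟩
          exact hxv i
        exact this hs
      intro y
      obtain ⟨s, hs, t, ht, rfl⟩ :=
        (Submodule.span ℂ (Set.range v)).exists_add_mem_mem_orthogonal y
      have h1 : inner ℂ x₀ s = 0 := Submodule.inner_left_of_mem_orthogonal hs hxW
      have hxx : inner ℂ x₀ x₀ = (1 : ℂ) := by rw [inner_self_eq_norm_sq_to_K, hx1]; simp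
      have h2 : B x₀ (t - inner ℂ x₀ t • x₀) = 0 := by
        apply bilin_eq_zero_of_isMax B hB hxB hx1 hxW hmax (W.sub_mem ht (W.smul_mem _ hxW))
        rw [inner_sub_right, inner_smul_right, hxx, mul_one, sub_self]
      rw [map_sub, map_smul, hxB, sub_eq_zero] at h2
      rw [map_add, hxs s hs, h2, inner_add_right, h1, zero_add, zero_add, smul_eq_mul, mul_comm]
    refine ⟨Fin.cons x₀ v, Fin.cons ‖B z z‖ μ, ?_, ?_, ?_⟩
    · constructor
      · intro i
        refine Fin.cases ?_ (fun i => ?_) i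
        · simpa using hx1
        · simpa using hv.1 i
      · intro i j
        refine Fin.cases ?_ (fun i => ?_) i <;> refine Fin.cases ?_ (fun j => ?_) j
        · simp
        · intro _
          simpa using inner_eq_zero_symm.1 (hWv _ hxW j)
        · intro _
          simpa using hWv _ hxW i
        · intro hij
          simpa using hv.2 (fun h => hij (by rw [h]))
    · intro i
      refine Fin.cases ?_ (fun i => ?_) i
      · simp
      · simpa using hμ i
    · intro i
      refine Fin.cases ?_ (fun i => ?_) i
      · simpa using hx0
      · simpa using hvB i

end Takagi

/-! ### Decompositions of a state that are orthogonal for the flip form -/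

/-- The flip form as a bilinear map. -/
noncomputable def flipBilin : Vec →ₗ[ℂ] Vec →ₗ[ℂ] ℂ :=
  LinearMap.mk₂ ℂ flipForm (by intros; simp [flipForm]; ring) (by intros; simp [flipForm]; ring)
    (by intros; simp [flipForm]; ring) (by intros; simp [flipForm]; ring)

@[simp] lemma flipBilin_apply (x y : Vec) : flipBilin x y = flipForm x y := rfl

/-- `ρ` is the sum of the `|xᵢ⟩⟨xᵢ|` for subnormalised vectors `xᵢ` that are orthogonal to each
other for the flip form, with `flipForm xᵢ xᵢ = zᵢ`. -/
def IsFlipOrthogonal (ρ : Op) (x : Fin 2 × Fin 2 → Vec) (z : Fin 2 × Fin 2 → ℂ) : Prop :=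
  ρ = ∑ i, ketbra (x i) ∧ ∀ i j, flipForm (x i) (x j) = if i = j then z i else 0

lemma ketbra_mulVec {m n : Type} [Fintype n] (M : Matrix m n ℂ) (v : n → ℂ) :
    ketbra (M.mulVec v) = M * ketbra v * M.conjTranspose := by
  rw [ketbra, Matrix.star_mulVec, ketbra, Matrix.mul_vecMulVec, Matrix.vecMulVec_mul]

lemma sum_ketbra_eq {ι κ : Type} [Fintype κ] (x : κ → ι → ℂ) :
    ∑ k, ketbra (x k) =
      (Matrix.of fun i k => x k i) * (Matrix.of fun i k => x k i).conjTranspose := by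
  ext i j
  simp [Matrix.sum_apply, ketbra, Matrix.vecMulVec_apply, Matrix.mul_apply]

open scoped MatrixOrder in
lemma exists_eq_mul_conjTranspose {n : Type} [Fintype n] [DecidableEq n] {ρ : Matrix n n ℂ}
    (hρ : ρ.PosSemidef) : ∃ M : Matrix n n ℂ, ρ = M * M.conjTranspose :=
  CStarAlgebra.nonneg_iff_eq_mul_star_self.mp hρ.nonneg

/-- If `ρ = M Mᴴ`, the vectors `xᵢ = M vᵢ` are obtained from a Takagi basis `vᵢ` of the form
`(v, w) ↦ flipForm (M v) (M w)`. -/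
lemma exists_isFlipOrthogonal {ρ : Op} (hρ : ρ.PosSemidef) :
    ∃ (x : Fin 2 × Fin 2 → Vec) (μ : Fin 2 × Fin 2 → ℝ), (∀ i, 0 ≤ μ i) ∧
      IsFlipOrthogonal ρ x (fun i => μ i) := by
  obtain ⟨M, rfl⟩ := exists_eq_mul_conjTranspose hρ
  let T : EuclideanSpace ℂ (Fin 2 × Fin 2) →ₗ[ℂ] Vec :=
    M.mulVecLin ∘ₗ (WithLp.linearEquiv 2 ℂ Vec).toLinearMap
  obtain ⟨v, μ, hv, hμ, hvB⟩ := exists_orthonormal_takagi (flipBilin.compl₁₂ T T)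
    (fun x y => flipForm_comm _ _) 4 (by simp)
  let e : Fin 2 × Fin 2 ≃ Fin 4 := finProdFinEquiv
  refine ⟨fun i => M.mulVec (v (e i)).ofLp, fun i => μ (e i), fun i => hμ _, ?_, ?_⟩
  · have h1 : ∑ i, ketbra (v (e i)).ofLp = 1 := by
      rw [sum_ketbra_eq]
      refine mul_eq_one_comm.1 ?_
      ext i j
      have h := orthonormal_iff_ite.1 hv (e i) (e j)
      rw [EuclideanSpace.inner_eq_star_dotProduct] at h
      simp only [EmbeddingLike.apply_eq_iff_eq] at h
      rw [Matrix.one_apply, ← h, dotProduct_comm]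
      simp [Matrix.mul_apply, dotProduct]
    simp only [ketbra_mulVec]
    rw [← Finset.sum_mul, ← Finset.mul_sum, h1, mul_one]
  · intro i j
    have h := hvB (e i) (v (e j))
    rw [orthonormal_iff_ite.1 hv] at h
    simp only [EmbeddingLike.apply_eq_iff_eq] at h
    have h2 : flipForm (M.mulVec (v (e i)).ofLp) (M.mulVec (v (e j)).ofLp)
      = μ (e i) * if i = j then 1 else 0 := h
    rw [h2]; simp

lemma pauliY_kronecker_map_conj :
    (pauliY ⊗ₖ pauliY).map (starRingEnd ℂ) = pauliY ⊗ₖ pauliY := by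
  ext ⟨i, j⟩ ⟨k, l⟩
  fin_cases i <;> fin_cases j <;> fin_cases k <;> fin_cases l <;>
    simp [pauliY, Matrix.kroneckerMap_apply]

section FlipOrthogonal

variable {ρ : Op} {x : Fin 2 × Fin 2 → Vec} {z : Fin 2 × Fin 2 → ℂ}

/-- After a cyclic permutation of factors, `ρ̃ρ` becomes the diagonal matrix with entries
`‖zᵢ‖²`. -/
lemma IsFlipOrthogonal.exists_mul (h : IsFlipOrthogonal ρ x z) :
    ∃ P Q : Op, spinFlip ρ * ρ = P * Q ∧
      Q * P = Matrix.diagonal fun i => ((‖z i‖ ^ 2 : ℝ) : ℂ) := by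
  obtain ⟨hρ, hz⟩ := h
  rw [sum_ketbra_eq] at hρ
  set X : Op := Matrix.of fun i k => x k i with hX
  set Y := pauliY ⊗ₖ pauliY with hY
  have hd : X.transpose * Y * X = Matrix.diagonal z := by
    ext i j
    rw [Matrix.diagonal_apply, ← hz i j, flipForm_eq_dotProduct, mul_assoc, Matrix.mul_apply,
      dotProduct]
    rfl
  have hd' : X.conjTranspose * Y * X.map (starRingEnd ℂ) = Matrix.diagonal (star z) := by
    have := congrArg (fun M : Op => M.map (starRingEnd ℂ)) hd
    simp only [Matrix.map_mul, hY, pauliY_kronecker_map_conj] at this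
    rw [Matrix.diagonal_map (map_zero _)] at this
    exact this
  refine ⟨Y * X.map (starRingEnd ℂ) * (X.transpose * Y * X), X.conjTranspose, ?_, ?_⟩
  · rw [spinFlip, hρ, Matrix.map_mul]
    have : X.conjTranspose.map (starRingEnd ℂ) = X.transpose := by
      ext i j; simp
    rw [this]
    simp only [mul_assoc]
    rfl
  · rw [← mul_assoc, hd, ← mul_assoc, hd', Matrix.diagonal_mul_diagonal]
    congr 1
    ext i
    simp [← Complex.normSq_eq_norm_sq, Complex.normSq_eq_conj_mul_self]

lemma IsFlipOrthogonal.flipEigenvalues_eq (h : IsFlipOrthogonal ρ x z) :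
    flipEigenvalues ρ = Finset.univ.val.map fun i => ((‖z i‖ ^ 2 : ℝ) : ℂ) := by
  obtain ⟨P, Q, h1, h2⟩ := h.exists_mul
  rw [flipEigenvalues, h1, Matrix.charpoly_mul_comm, h2, Matrix.charpoly_diagonal]
  have : ((Finset.univ.val.map fun i => ((‖z i‖ ^ 2 : ℝ) : ℂ)).map
      (fun a => Polynomial.X - Polynomial.C a)).prod =
      ∏ i, (Polynomial.X - Polynomial.C ((‖z i‖ ^ 2 : ℝ) : ℂ)) := by
    rw [Multiset.map_map]; rfl
  rw [← this, Polynomial.roots_multiset_prod_X_sub_C]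

end FlipOrthogonal

/-- The square roots of the eigenvalues of `ρ̃ρ`, with multiplicity. -/
noncomputable def flipRoots (ρ : Op) : Multiset ℝ := (flipEigenvalues ρ).map fun z => √z.re

/-- The sum `√λ₁ + √λ₂ + √λ₃ + √λ₄` over the eigenvalues of `ρ̃ρ`. -/
noncomputable def rootSum (ρ : Op) : ℝ := (flipRoots ρ).sum

/-- `√λ₁ - √λ₂ - √λ₃ - √λ₄`, where `λ₁` is the largest eigenvalue of `ρ̃ρ`. For entangled `ρ` this
is the concurrence. -/
noncomputable def concurrence (ρ : Op) : ℝ := 2 * (flipRoots ρ).fold max 0 - rootSum ρ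

section

variable {ρ : Op} {x : Fin 2 × Fin 2 → Vec} {z : Fin 2 × Fin 2 → ℂ}

lemma IsFlipOrthogonal.flipRoots_eq (h : IsFlipOrthogonal ρ x z) :
    flipRoots ρ = Finset.univ.val.map fun i => ‖z i‖ := by
  rw [flipRoots, h.flipEigenvalues_eq, Multiset.map_map]
  congr 1
  ext i
  simp only [Function.comp_apply, Complex.ofReal_re]
  exact Real.sqrt_sq (norm_nonneg _)

lemma IsFlipOrthogonal.rootSum_eq (h : IsFlipOrthogonal ρ x z) : rootSum ρ = ∑ i, ‖z i‖ := by
  rw [rootSum, h.flipRoots_eq]; rfl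

lemma IsFlipOrthogonal.exists_concurrence_eq (h : IsFlipOrthogonal ρ x z) :
    ∃ i₀, (∀ i, ‖z i‖ ≤ ‖z i₀‖) ∧ concurrence ρ = 2 * ‖z i₀‖ - ∑ i, ‖z i‖ := by
  obtain ⟨i₀, -, hi₀⟩ := Finset.exists_max_image Finset.univ (fun i => ‖z i‖) Finset.univ_nonempty
  refine ⟨i₀, fun i => hi₀ i (Finset.mem_univ _), ?_⟩
  rw [concurrence, h.rootSum_eq, h.flipRoots_eq]
  congr 2
  change Finset.fold max 0 (fun i => ‖z i‖) Finset.univ = _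
  apply le_antisymm
  · exact Finset.fold_max_le _ |>.2 ⟨norm_nonneg _, hi₀⟩
  · exact Finset.le_fold_max _ |>.2 (Or.inr ⟨i₀, Finset.mem_univ _, le_rfl⟩)

end

lemma sum_nsq_eq_one {ρ : Op} (hρ : ρ.trace = 1) {ι : Type*} [Fintype ι] {y : ι → Vec}
    (hy : ρ = ∑ i, ketbra (y i)) : ∑ i, nsq (y i) = 1 := by
  rw [hy, Matrix.trace_sum] at hρ
  simp only [trace_ketbra] at hρ
  exact_mod_cast hρ

lemma rootSum_le_one {ρ : Op} (hρ : IsDensity ρ) : rootSum ρ ≤ 1 := by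
  obtain ⟨x, μ, -, h⟩ := exists_isFlipOrthogonal hρ.1
  rw [h.rootSum_eq, ← sum_nsq_eq_one hρ.2 h.1]
  refine Finset.sum_le_sum fun i _ => ?_
  have := norm_flipForm_self_le (x i)
  rwa [h.2 i i, if_pos rfl] at this

lemma rootSum_nonneg (ρ : Op) : 0 ≤ rootSum ρ := by
  apply Multiset.sum_nonneg
  simp only [flipRoots, Multiset.mem_map]
  rintro _ ⟨z, -, rfl⟩
  exact Real.sqrt_nonneg _

lemma concurrence_le_rootSum {ρ : Op} (hρ : ρ.PosSemidef) : concurrence ρ ≤ rootSum ρ := by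
  obtain ⟨x, μ, -, h⟩ := exists_isFlipOrthogonal hρ
  obtain ⟨i₀, -, hc⟩ := h.exists_concurrence_eq
  rw [hc, h.rootSum_eq]
  linarith [Finset.single_le_sum (f := fun i => ‖(μ i : ℂ)‖) (fun i _ => norm_nonneg _)
    (Finset.mem_univ i₀)]

/-! ### Wootters' formula: the lower bound -/

lemma sum_norm_sq_eq_quadratic {ι : Type*} [Fintype ι] (x : ι → Vec) (f : Vec →ₗ[ℂ] ℂ) :
    ((∑ i, ‖f (x i)‖ ^ 2 : ℝ) : ℂ) = ∑ k, ∑ l, f (Pi.single k 1) *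
      starRingEnd ℂ (f (Pi.single l 1)) * (∑ i, ketbra (x i)) k l := by
  have hf : ∀ v : Vec, f v = ∑ k, f (Pi.single k 1) * v k := by
    intro v
    conv_lhs => rw [pi_eq_sum_univ' v]
    simp only [map_sum, map_smul, smul_eq_mul, mul_comm]
  push_cast
  simp only [Matrix.sum_apply, Finset.mul_sum]
  rw [Finset.sum_congr rfl fun k _ => Finset.sum_comm, Finset.sum_comm]
  refine Finset.sum_congr rfl fun i _ => ?_
  rw [← Complex.ofReal_pow, ← Complex.normSq_eq_norm_sq, Complex.normSq_eq_conj_mul_self,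
    mul_comm, hf (x i), map_sum, Finset.sum_mul_sum]
  refine Finset.sum_congr rfl fun k _ => Finset.sum_congr rfl fun l _ => ?_
  rw [ketbra, Matrix.vecMulVec_apply, map_mul, Pi.star_apply, starRingEnd_apply, starRingEnd_apply]
  ring

/-- For every functional `f`, the sum `∑ |f(xᵢ)|²` depends only on the operator `∑ |xᵢ⟩⟨xᵢ|`. -/
lemma sum_norm_sq_eq {ι κ : Type*} [Fintype ι] [Fintype κ] {x : ι → Vec} {y : κ → Vec}
    (h : ∑ i, ketbra (x i) = ∑ j, ketbra (y j)) (f : Vec →ₗ[ℂ] ℂ) :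
    ∑ i, ‖f (x i)‖ ^ 2 = ∑ j, ‖f (y j)‖ ^ 2 := by
  have h1 := sum_norm_sq_eq_quadratic x f
  rw [h] at h1
  exact_mod_cast h1.trans (sum_norm_sq_eq_quadratic y f).symm

lemma mem_span_of_sum_ketbra_eq {ι κ : Type*} [Fintype ι] [Fintype κ] {x : ι → Vec} {y : κ → Vec}
    (h : ∑ i, ketbra (x i) = ∑ j, ketbra (y j)) (j : κ) :
    y j ∈ Submodule.span ℂ (Set.range x) := by
  by_contra hj
  obtain ⟨f, hf, hle⟩ := Submodule.exists_le_ker_of_notMem hj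
  have h1 := sum_norm_sq_eq h f
  have h2 : ∑ i, ‖f (x i)‖ ^ 2 = 0 := Finset.sum_eq_zero fun i _ => by
    have : f (x i) = 0 := hle (Submodule.subset_span ⟨i, rfl⟩)
    simp [this]
  rw [h2, eq_comm, Finset.sum_eq_zero_iff_of_nonneg fun _ _ => by positivity] at h1
  simpa [hf] using h1 j (Finset.mem_univ _)

/-- Wootters' lower bound: the average concurrence of every ensemble for `ρ` is at least the
concurrence of `ρ`. -/
lemma concurrence_le_sum {ρ : Op} {κ : Type*} [Fintype κ] {y : κ → Vec}
    (hy : ρ = ∑ j, ketbra (y j)) (hρ : ρ.PosSemidef) :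
    concurrence ρ ≤ ∑ j, ‖flipForm (y j) (y j)‖ := by
  obtain ⟨x, μ, hμ, hx⟩ := exists_isFlipOrthogonal hρ
  obtain ⟨i₀, -, hc⟩ := hx.exists_concurrence_eq
  simp only [Complex.norm_real, Real.norm_of_nonneg (hμ _)] at hc
  have hxy : ∑ i, ketbra (x i) = ∑ j, ketbra (y j) := hx.1.symm.trans hy
  -- the members of the given ensemble are expanded in the flip-orthogonal decomposition
  have hspan := fun j => (Submodule.mem_span_range_iff_exists_fun ℂ).1
    (mem_span_of_sum_ketbra_eq hxy j)
  choose c hcy using hspan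
  have hb1 : ∀ i j, flipForm (x i) (y j) = c j i * μ i := by
    intro i j
    rw [← hcy j, ← flipBilin_apply, map_sum]
    simp [hx.2]
  have hb2 : ∀ j, flipForm (y j) (y j) = ∑ i, c j i ^ 2 * μ i := by
    intro j
    conv_lhs => rw [← flipBilin_apply, ← hcy j]
    rw [map_sum]
    refine Finset.sum_congr rfl fun i _ => ?_
    rw [map_smul, hcy j, flipBilin_apply, flipForm_comm, hb1, smul_eq_mul]
    ring
  have hsum : ∀ i, ∑ j, ‖c j i‖ ^ 2 * μ i = μ i := by
    intro i
    have h := sum_norm_sq_eq hxy (flipBilin (x i))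
    simp only [flipBilin_apply, hb1, hx.2] at h
    have h1 : ∑ k, ‖if i = k then (μ i : ℂ) else 0‖ ^ 2 = μ i ^ 2 := by
      rw [Finset.sum_eq_single i]
      · simp
      · intro b _ hb
        rw [if_neg hb.symm]; simp
      · simp
    rw [h1] at h
    rcases eq_or_ne (μ i) 0 with h0 | h0
    · simp [h0]
    · have h2 : μ i * μ i = μ i * ∑ j, ‖c j i‖ ^ 2 * μ i := by
        rw [← sq, h, Finset.mul_sum]
        refine Finset.sum_congr rfl fun j _ => ?_
        rw [norm_mul, Complex.norm_real, mul_pow, Real.norm_eq_abs, sq_abs]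
        ring
      exact (mul_left_cancel₀ h0 h2).symm
  have hj : ∀ j, 2 * (‖c j i₀‖ ^ 2 * μ i₀) - ∑ i, ‖c j i‖ ^ 2 * μ i
      ≤ ‖flipForm (y j) (y j)‖ := by
    intro j
    rw [hb2, ← Finset.add_sum_erase _ _ (Finset.mem_univ i₀),
      ← Finset.add_sum_erase _ (fun i => c j i ^ 2 * (μ i : ℂ)) (Finset.mem_univ i₀)]
    have h1 := norm_sub_le_norm_add (c j i₀ ^ 2 * (μ i₀ : ℂ))
      (∑ i ∈ Finset.univ.erase i₀, c j i ^ 2 * (μ i : ℂ))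
    have h2 := norm_sum_le (Finset.univ.erase i₀) fun i => c j i ^ 2 * (μ i : ℂ)
    simp only [norm_mul, norm_pow, Complex.norm_real, Real.norm_of_nonneg (hμ _)] at h1 h2
    linarith
  calc concurrence ρ = ∑ j, (2 * (‖c j i₀‖ ^ 2 * μ i₀) - ∑ i, ‖c j i‖ ^ 2 * μ i) := by
        rw [hc, Finset.sum_sub_distrib, ← Finset.mul_sum, hsum, Finset.sum_comm]
        simp only [hsum]
    _ ≤ _ := Finset.sum_le_sum fun j _ => hj j

/-! ### Balancing a decomposition by rotations -/

lemma ketbra_rotate (x y : Vec) {c s : ℝ} (h : c ^ 2 + s ^ 2 = 1) :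
    ketbra (c • x + s • y) + ketbra (-s • x + c • y) = ketbra x + ketbra y := by
  have h' : (c : ℂ) ^ 2 + (s : ℂ) ^ 2 = 1 := by exact_mod_cast h
  ext i j
  simp only [ketbra, Matrix.add_apply, Matrix.vecMulVec_apply, Pi.add_apply, Pi.smul_apply,
    Complex.real_smul, Pi.star_apply, star_add, star_mul', Complex.star_def, Complex.conj_ofReal,
    Complex.ofReal_neg, map_neg]
  linear_combination (x i * starRingEnd ℂ (x j) + y i * starRingEnd ℂ (y j)) * h'

lemma sum_rotate {ι M : Type*} [Fintype ι] [DecidableEq ι] [AddCommMonoid M] (F : Vec → M)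
    (x : ι → Vec) {i j : ι} (hij : i ≠ j) {u v : Vec} (h : F u + F v = F (x i) + F (x j)) :
    ∑ k, F (Function.update (Function.update x i u) j v k) = ∑ k, F (x k) := by
  have hj : j ∈ Finset.univ.erase i := by simp [hij.symm]
  rw [← Finset.add_sum_erase _ _ (Finset.mem_univ i), ← Finset.add_sum_erase _ _ hj,
    ← Finset.add_sum_erase _ (fun k => F (x k)) (Finset.mem_univ i),
    ← Finset.add_sum_erase _ (fun k => F (x k)) hj, ← add_assoc, ← add_assoc]
  congr 1
  · simpa [hij] using h
  · refine Finset.sum_congr rfl fun k hk => ?_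
    simp only [Finset.mem_erase] at hk
    rw [Function.update_of_ne hk.1, Function.update_of_ne hk.2.1]

/-- A decomposition on which a real quadratic form has total zero can be rotated, within a given
real subspace, into one on which the form vanishes term by term: two terms of opposite signs are
rotated into each other until one of them vanishes. -/
lemma exists_balanced {ι : Type*} [Fintype ι] [DecidableEq ι] (q : Vec → ℝ)
    (hq : ∀ x y, ∃ β, ∀ c s : ℝ, q (c • x + s • y) = c ^ 2 * q x + 2 * c * s * β + s ^ 2 * q y)
    (W : Submodule ℝ Vec) (n : ℕ) : ∀ x : ι → Vec, (∀ i, x i ∈ W) → ∑ i, q (x i) = 0 →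
      (Finset.univ.filter fun i => q (x i) ≠ 0).card = n →
      ∃ y : ι → Vec, (∀ i, y i ∈ W) ∧ ∑ i, ketbra (y i) = ∑ i, ketbra (x i) ∧ ∀ i, q (y i) = 0 := by
  induction n using Nat.strong_induction_on with
  | _ n ih =>
    intro x hx h0 hn
    by_cases hall : ∀ i, q (x i) = 0
    · exact ⟨x, hx, rfl, hall⟩
    push Not at hall
    obtain ⟨i₀, hi₀⟩ := hall
    obtain ⟨i, -, hi⟩ := Finset.exists_pos_of_sum_zero_of_exists_nonzero _ h0
      ⟨i₀, Finset.mem_univ _, hi₀⟩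
    obtain ⟨j, -, hj⟩ := Finset.exists_pos_of_sum_zero_of_exists_nonzero (fun i => -q (x i))
      (by rw [Finset.sum_neg_distrib, h0, neg_zero]) ⟨i₀, Finset.mem_univ _, neg_ne_zero.2 hi₀⟩
    have hj : q (x j) < 0 := by linarith
    have hij : i ≠ j := by rintro rfl; linarith
    obtain ⟨β, hβ⟩ := hq (x i) (x j)
    have hcont : Continuous fun θ : ℝ => q (Real.cos θ • x i + Real.sin θ • x j) := by
      simp only [hβ]
      fun_prop
    have hivt := intermediate_value_Icc' (a := 0) (b := Real.pi / 2) (by positivity)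
      hcont.continuousOn
    simp only [Real.cos_zero, Real.sin_zero, Real.cos_pi_div_two, Real.sin_pi_div_two, one_smul,
      zero_smul, add_zero, zero_add] at hivt
    obtain ⟨θ, -, hθ⟩ := hivt ⟨hj.le, hi.le⟩
    set c := Real.cos θ
    set s := Real.sin θ
    have hcs : c ^ 2 + s ^ 2 = 1 := Real.cos_sq_add_sin_sq θ
    set u := c • x i + s • x j
    set v := -s • x i + c • x j
    have hqu : q u = 0 := hθ
    have hquv : q u + q v = q (x i) + q (x j) := by
      simp only [u, v, hβ]
      linear_combination (q (x i) + q (x j)) * hcs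
    set x' := Function.update (Function.update x i u) j v
    have hx'i : x' i = u := by simp [x', hij]
    have hx'k : ∀ k, k ≠ i → k ≠ j → x' k = x k := fun k h1 h2 => by simp [x', h1, h2]
    have hlt : (Finset.univ.filter fun k => q (x' k) ≠ 0).card < n := by
      rw [← hn]
      apply Finset.card_lt_card
      rw [Finset.ssubset_iff_of_subset]
      · exact ⟨i, by simpa using hi.ne', by simp [hx'i, hqu]⟩
      · intro k
        simp only [Finset.mem_filter, Finset.mem_univ, true_and]
        intro hk
        rcases eq_or_ne k i with rfl | h1
        · exact hi.ne'
        rcases eq_or_ne k j with rfl | h2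
        · exact hj.ne
        rwa [hx'k k h1 h2] at hk
    obtain ⟨y, hyW, hy, hy0⟩ := ih _ hlt x' (by
        intro k
        rcases eq_or_ne k j with rfl | h2
        · simpa [x'] using W.add_mem (W.smul_mem _ (hx i)) (W.smul_mem _ (hx k))
        rcases eq_or_ne k i with rfl | h1
        · rw [hx'i]; exact W.add_mem (W.smul_mem _ (hx k)) (W.smul_mem _ (hx j))
        rw [hx'k k h1 h2]; exact hx k)
      (by rw [sum_rotate q x hij hquv, h0]) rfl
    exact ⟨y, hyW, hy.trans (sum_rotate ketbra x hij (ketbra_rotate _ _ hcs)), hy0⟩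

/-! ### Wootters' formula: the upper bound -/

/-- A state has a decomposition all of whose members have concurrence `C = concurrence ρ`: after
multiplying by `i` all but one of the vectors of a flip-orthogonal decomposition, the flip form is
real on their real span, and the form `Re b(v, v) - C ‖v‖²` can be balanced. -/
lemma exists_decomposition_concurrence {ρ : Op} (hρ : IsDensity ρ) (hC : 0 ≤ concurrence ρ) :
    ∃ y : Fin 2 × Fin 2 → Vec, ρ = ∑ i, ketbra (y i) ∧
      ∀ i, ‖flipForm (y i) (y i)‖ = concurrence ρ * nsq (y i) := by
  obtain ⟨x, μ, hμ, hx⟩ := exists_isFlipOrthogonal hρ.1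
  obtain ⟨i₀, -, hc⟩ := hx.exists_concurrence_eq
  simp only [Complex.norm_real, Real.norm_of_nonneg (hμ _)] at hc
  set C := concurrence ρ
  let w : Fin 2 × Fin 2 → ℂ := fun i => if i = i₀ then 1 else Complex.I
  have hw : ∀ i, ‖w i‖ = 1 := fun i => by simp only [w]; split_ifs <;> simp
  let x' : Fin 2 × Fin 2 → Vec := fun i => w i • x i
  have hx' : ρ = ∑ i, ketbra (x' i) := by
    simp only [x', ketbra_smul, hw]
    simpa using hx.1
  have hb : ∀ i j, flipForm (x' i) (x' j) =
      ((if i = j then (if i = i₀ then μ i else -μ i) else 0 : ℝ) : ℂ) := by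
    intro i j
    simp only [x', flipForm_smul_smul, hx.2]
    by_cases hij : i = j
    · subst hij
      by_cases hi : i = i₀ <;> simp [w, hi]
    · simp [hij]
  let W : Submodule ℝ Vec := Submodule.span ℝ (Set.range x')
  -- the flip form is real on the real span of the vectors `x' i`
  have hW : ∀ u ∈ W, ∀ v ∈ W, (flipForm u v).im = 0 := by
    intro u hu v hv
    induction hu, hv using Submodule.span_induction₂ with
    | mem_mem u v hu hv =>
      obtain ⟨i, rfl⟩ := hu
      obtain ⟨j, rfl⟩ := hv
      rw [hb, Complex.ofReal_im]
    | zero_left v hv => simp [flipForm]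
    | zero_right u hu => simp [flipForm]
    | add_left u v w _ _ _ h1 h2 =>
      rw [← flipBilin_apply, map_add, LinearMap.add_apply, Complex.add_im, flipBilin_apply,
        flipBilin_apply, h1, h2, add_zero]
    | add_right u v w _ _ _ h1 h2 =>
      rw [← flipBilin_apply, map_add, Complex.add_im, flipBilin_apply,
        flipBilin_apply, h1, h2, add_zero]
    | smul_left r u v _ _ h =>
      have : flipForm (r • u) v = r * flipForm u v := by simp [flipForm]; ring
      rw [this, Complex.im_ofReal_mul, h, mul_zero]
    | smul_right r u v _ _ h =>
      have : flipForm u (r • v) = r * flipForm u v := by simp [flipForm]; ring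
      rw [this, Complex.im_ofReal_mul, h, mul_zero]
  let q : Vec → ℝ := fun v => (flipForm v v).re - C * nsq v
  have hq : ∀ x y, ∃ β, ∀ c s : ℝ,
      q (c • x + s • y) = c ^ 2 * q x + 2 * c * s * β + s ^ 2 * q y := by
    intro x y
    refine ⟨(flipForm x y).re - C * ∑ i, (x i * starRingEnd ℂ (y i)).re, fun c s => ?_⟩
    have h1 : flipForm (c • x + s • y) (c • x + s • y) =
        ((c ^ 2 : ℝ) : ℂ) * flipForm x x + ((2 * c * s : ℝ) : ℂ) * flipForm x y +
          ((s ^ 2 : ℝ) : ℂ) * flipForm y y := by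
      simp [flipForm]; ring
    have h2 : nsq (c • x + s • y) = c ^ 2 * nsq x +
        2 * c * s * ∑ i, (x i * starRingEnd ℂ (y i)).re + s ^ 2 * nsq y := by
      simp only [nsq, Finset.mul_sum, ← Finset.sum_add_distrib, ← Complex.normSq_eq_norm_sq,
        Complex.normSq_apply]
      refine Finset.sum_congr rfl fun i _ => ?_
      simp
      ring
    simp only [q, h1, h2, Complex.add_re, Complex.re_ofReal_mul]
    ring
  have h0 : ∑ i, q (x' i) = 0 := by
    simp only [q, hb, if_true, Complex.ofReal_re, Finset.sum_sub_distrib, ← Finset.mul_sum]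
    rw [sum_nsq_eq_one hρ.2 hx', mul_one, sub_eq_zero, hc,
      ← Finset.add_sum_erase _ _ (Finset.mem_univ i₀),
      ← Finset.add_sum_erase _ μ (Finset.mem_univ i₀), if_pos rfl,
      Finset.sum_congr rfl fun i hi => if_neg (Finset.ne_of_mem_erase hi), Finset.sum_neg_distrib]
    ring
  obtain ⟨y, hyW, hy, hyq⟩ := exists_balanced q hq W _ x'
    (fun i => Submodule.subset_span ⟨i, rfl⟩) h0 rfl
  refine ⟨y, hx'.trans hy.symm, fun i => ?_⟩
  have h1 : (flipForm (y i) (y i)).re = C * nsq (y i) := sub_eq_zero.1 (hyq i)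
  have h2 : flipForm (y i) (y i) = ((C * nsq (y i) : ℝ) : ℂ) :=
    Complex.ext (by rw [h1, Complex.ofReal_re]) (by rw [hW _ (hyW i) _ (hyW i), Complex.ofReal_im])
  rw [h2, Complex.norm_real, Real.norm_of_nonneg (mul_nonneg hC (nsq_nonneg _))]

/-- Wootters' formula, for states with `√λ₁ ≥ √λ₂ + √λ₃ + √λ₄`. -/
theorem entanglementOfFormation_eq {ρ : Op} (hρ : IsDensity ρ) (hC : 0 ≤ concurrence ρ) :
    entanglementOfFormation ρ = entFn (concurrence ρ) := by
  have hC1 : concurrence ρ ≤ 1 := (concurrence_le_rootSum hρ.1).trans (rootSum_le_one hρ)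
  have hlow : ∀ e ∈ {e : ℝ | ∃ (n : ℕ) (p : Fin n → ℝ) (ψ : Fin n → Vec),
      (∀ i, 0 ≤ p i) ∧ ∑ i, p i = 1 ∧ (∀ i, star (ψ i) ⬝ᵥ ψ i = 1) ∧
      ρ = ∑ i, (p i : ℂ) • ketbra (ψ i) ∧ e = ∑ i, p i * pureEntanglement (ψ i)},
      entFn (concurrence ρ) ≤ e := by
    rintro e ⟨n, p, ψ, hp, hp1, hψ, hψρ, rfl⟩
    have hψ1 : ∀ i, nsq (ψ i) = 1 := fun i => by
      have := hψ i
      rw [star_dotProduct_self] at this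
      exact_mod_cast this
    have hy : ρ = ∑ i, ketbra (((√(p i) : ℝ) : ℂ) • ψ i) := by
      rw [hψρ]
      refine Finset.sum_congr rfl fun i _ => ?_
      rw [ketbra_smul, Complex.norm_real, Real.norm_eq_abs, sq_abs, Real.sq_sqrt (hp i)]
    have h1 := concurrence_le_sum hy hρ.1
    have h2 : ∀ i, ‖flipForm (((√(p i) : ℝ) : ℂ) • ψ i) (((√(p i) : ℝ) : ℂ) • ψ i)‖ =
        p i * ‖flipForm (ψ i) (ψ i)‖ := by
      intro i
      rw [flipForm_smul_smul, norm_mul, norm_mul, Complex.norm_real, Real.norm_eq_abs,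
        abs_mul_abs_self, Real.mul_self_sqrt (hp i)]
    simp only [h2] at h1
    have hmem : ∀ i, ‖flipForm (ψ i) (ψ i)‖ ∈ Set.Icc (0 : ℝ) 1 := fun i =>
      ⟨norm_nonneg _, hψ1 i ▸ norm_flipForm_self_le _⟩
    have h3 := entFn_convexOn.map_sum_le (t := Finset.univ) (w := p)
      (p := fun i => ‖flipForm (ψ i) (ψ i)‖) (fun i _ => hp i) hp1 (fun i _ => hmem i)
    simp only [smul_eq_mul] at h3
    have h4 : ∑ i, p i * ‖flipForm (ψ i) (ψ i)‖ ∈ Set.Icc (0 : ℝ) 1 := by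
      simpa using (convex_Icc (0 : ℝ) 1).sum_mem (fun i _ => hp i) hp1 (fun i _ => hmem i)
    refine (entFn_strictMonoOn.monotoneOn ⟨hC, hC1⟩ h4 h1).trans (h3.trans_eq ?_)
    exact Finset.sum_congr rfl fun i _ => by rw [pureEntanglement_eq (hψ1 i)]
  have hmem : entFn (concurrence ρ) ∈ {e : ℝ | ∃ (n : ℕ) (p : Fin n → ℝ) (ψ : Fin n → Vec),
      (∀ i, 0 ≤ p i) ∧ ∑ i, p i = 1 ∧ (∀ i, star (ψ i) ⬝ᵥ ψ i = 1) ∧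
      ρ = ∑ i, (p i : ℂ) • ketbra (ψ i) ∧ e = ∑ i, p i * pureEntanglement (ψ i)} := by
    obtain ⟨y, hy, hyC⟩ := exists_decomposition_concurrence hρ hC
    let e : Fin 4 ≃ Fin 2 × Fin 2 := (finProdFinEquiv : Fin 2 × Fin 2 ≃ Fin 4).symm
    have hsum := sum_nsq_eq_one hρ.2 hy
    -- members that vanish carry weight zero and are replaced by an arbitrary unit vector
    have hψ : ∀ i, ∃ ψ : Vec, nsq ψ = 1 ∧ ketbra (y i) = (nsq (y i) : ℂ) • ketbra ψ ∧
        (y i ≠ 0 → pureEntanglement ψ = entFn (concurrence ρ)) := by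
      intro i
      by_cases hi : y i = 0
      · refine ⟨Pi.single (0, 0) 1, ?_, ?_, fun h => absurd hi h⟩
        · simp [nsq, Fintype.sum_prod_type, Fin.sum_univ_two, Pi.single_apply]
        · have : ketbra (0 : Vec) = 0 := by ext; simp [ketbra, Matrix.vecMulVec_apply]
          rw [hi, this, nsq_eq_zero.2 rfl]; simp
      · have hn : 0 < nsq (y i) := (nsq_nonneg _).lt_of_ne' (by rwa [Ne, nsq_eq_zero])
        have hk : ‖((√(nsq (y i)))⁻¹ : ℂ)‖ ^ 2 = (nsq (y i))⁻¹ := by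
          rw [norm_inv, inv_pow, Complex.norm_real, Real.norm_eq_abs, sq_abs, Real.sq_sqrt hn.le]
        have h1 : nsq (((√(nsq (y i)))⁻¹ : ℂ) • y i) = 1 := by
          rw [nsq_smul, hk, inv_mul_cancel₀ hn.ne']
        refine ⟨((√(nsq (y i)))⁻¹ : ℂ) • y i, h1, ?_, fun _ => ?_⟩
        · rw [ketbra_smul, hk, smul_smul, ← Complex.ofReal_mul, mul_inv_cancel₀ hn.ne']; simp
        · rw [pureEntanglement_eq h1, flipForm_smul_smul, norm_mul, norm_mul, hyC, ← sq, hk]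
          congr 1
          field_simp
    choose ψ hψ1 hψ2 hψ3 using hψ
    refine ⟨4, fun k => nsq (y (e k)), fun k => ψ (e k), fun _ => nsq_nonneg _, ?_, ?_, ?_, ?_⟩
    · rw [e.sum_comp (fun i => nsq (y i)), hsum]
    · intro k; rw [star_dotProduct_self, hψ1]; simp
    · rw [e.sum_comp (fun i => (nsq (y i) : ℂ) • ketbra (ψ i)), hy]
      exact Finset.sum_congr rfl fun i _ => hψ2 i
    · rw [e.sum_comp (fun i => nsq (y i) * pureEntanglement (ψ i))]
      have : ∀ i, nsq (y i) * pureEntanglement (ψ i) = nsq (y i) * entFn (concurrence ρ) := by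
        intro i
        by_cases hi : y i = 0
        · rw [hi, nsq_eq_zero.2 rfl]; simp
        · rw [hψ3 i hi]
      simp only [this, ← Finset.sum_mul, hsum, one_mul]
  exact le_antisymm (csInf_le ⟨_, hlow⟩ hmem) (le_csInf ⟨_, hmem⟩ hlow)

/-! ### States of nonpositive concurrence are separable -/

/-- The triangle inequalities suffice for segments of lengths `a`, `b`, `e` to form a triangle. -/
lemma exists_phases_triangle {a b e : ℝ} (ha : 0 ≤ a) (hb : 0 ≤ b) (h1 : |a - b| ≤ e)
    (h2 : e ≤ a + b) : ∃ u v : ℂ, ‖u‖ = 1 ∧ ‖v‖ = 1 ∧ u * a + v * b = e := by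
  have hcont : Continuous fun θ : ℝ => ‖(a : ℂ) + Complex.exp (θ * Complex.I) * b‖ := by fun_prop
  have h0 : ‖(a : ℂ) + Complex.exp ((0 : ℝ) * Complex.I) * b‖ = a + b := by
    rw [Complex.ofReal_zero, zero_mul, Complex.exp_zero, one_mul, ← Complex.ofReal_add,
      Complex.norm_real, Real.norm_of_nonneg (by positivity)]
  have hπ : ‖(a : ℂ) + Complex.exp (Real.pi * Complex.I) * b‖ = |a - b| := by
    rw [Complex.exp_pi_mul_I, ← Real.norm_eq_abs, ← Complex.norm_real]
    congr 1
    push_cast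
    ring
  have hivt := intermediate_value_Icc' Real.pi_pos.le hcont.continuousOn
  simp only [h0, hπ] at hivt
  obtain ⟨θ, -, hθ⟩ := hivt ⟨h1, h2⟩
  simp only at hθ
  set w := (a : ℂ) + Complex.exp (θ * Complex.I) * b with hw
  have hr : Complex.exp ((-Complex.arg w : ℝ) * Complex.I) * w = e := by
    nth_rw 2 [← Complex.norm_mul_exp_arg_mul_I w]
    rw [mul_left_comm, ← Complex.exp_add, hθ]
    push_cast
    ring_nf
    simp
  refine ⟨Complex.exp ((-Complex.arg w : ℝ) * Complex.I),
    Complex.exp ((-Complex.arg w : ℝ) * Complex.I) * Complex.exp (θ * Complex.I),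
    Complex.norm_exp_ofReal_mul_I _, ?_, ?_⟩
  · rw [norm_mul, Complex.norm_exp_ofReal_mul_I, Complex.norm_exp_ofReal_mul_I, one_mul]
  · rw [← hr, hw]; ring

/-- Four segments, none longer than the other three together, are the sides of a closed polygon;
the polygon is cut along a diagonal into two triangles. -/
lemma exists_phases_polygon {a b c d : ℝ} (ha : 0 ≤ a) (hb : 0 ≤ b) (hc : 0 ≤ c) (hd : 0 ≤ d)
    (ha' : a ≤ b + c + d) (hb' : b ≤ a + c + d) (hc' : c ≤ a + b + d) (hd' : d ≤ a + b + c) :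
    ∃ u v w z : ℂ, ‖u‖ = 1 ∧ ‖v‖ = 1 ∧ ‖w‖ = 1 ∧ ‖z‖ = 1 ∧
      u * a + v * b + w * c + z * d = 0 := by
  obtain ⟨u, v, hu, hv, huv⟩ := exists_phases_triangle (e := max |a - b| |c - d|) ha hb
    (le_max_left _ _) (max_le (abs_le.2 ⟨by linarith, by linarith⟩)
      (abs_le.2 ⟨by linarith, by linarith⟩))
  obtain ⟨w, z, hw, hz, hwz⟩ := exists_phases_triangle (e := max |a - b| |c - d|) hc hd
    (le_max_right _ _) (max_le (abs_le.2 ⟨by linarith, by linarith⟩)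
      (abs_le.2 ⟨by linarith, by linarith⟩))
  refine ⟨u, v, -w, -z, hu, hv, by rwa [norm_neg], by rwa [norm_neg], ?_⟩
  linear_combination huv - hwz

lemma exists_tensorVec_of_flipForm_eq_zero {y : Vec} (h : flipForm y y = 0) :
    ∃ α β, y = tensorVec α β := by
  have h' : y (0, 1) * y (1, 0) = y (0, 0) * y (1, 1) := by
    have : (2 : ℂ) * (y (0, 1) * y (1, 0) - y (0, 0) * y (1, 1)) = 0 := by
      rw [← h, flipForm]; ring
    simpa [sub_eq_zero] using this
  by_cases h0 : y (0, 0) = 0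
  · by_cases h1 : y (0, 1) = 0
    · refine ⟨![0, 1], ![y (1, 0), y (1, 1)], ?_⟩
      ext ⟨i, j⟩
      fin_cases i <;> fin_cases j <;> simp [tensorVec, h0, h1]
    · refine ⟨![1, y (1, 1) / y (0, 1)], ![y (0, 0), y (0, 1)], ?_⟩
      have h2 : y (1, 0) = 0 := by simpa [h0, h1] using h'
      ext ⟨i, j⟩
      fin_cases i <;> fin_cases j <;> simp [tensorVec, h0, h1, h2]
  · refine ⟨![1, y (1, 0) / y (0, 0)], ![y (0, 0), y (0, 1)], ?_⟩
    ext ⟨i, j⟩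
    fin_cases i <;> fin_cases j <;> simp [tensorVec, h0]
    field_simp
    linear_combination -h'

lemma ketbra_tensorVec (α β : Fin 2 → ℂ) : ketbra (tensorVec α β) = ketbra α ⊗ₖ ketbra β := by
  ext i j
  simp [ketbra, tensorVec, Matrix.vecMulVec_apply, Matrix.kroneckerMap_apply]
  ring

lemma exists_isDensity_ketbra (α : Fin 2 → ℂ) :
    ∃ (t : ℝ) (A : Op₁), 0 ≤ t ∧ IsDensity A ∧ ketbra α = (t : ℂ) • A := by
  by_cases hα : α = 0
  · refine ⟨0, Matrix.diagonal (Pi.single 0 1), le_rfl, ⟨?_, ?_⟩, ?_⟩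
    · apply Matrix.PosSemidef.diagonal
      intro i
      fin_cases i <;> simp
    · simp
    · ext i j
      simp [hα, ketbra, Matrix.vecMulVec_apply]
  · set t : ℝ := ∑ i, ‖α i‖ ^ 2
    have ht : 0 < t := by
      apply lt_of_le_of_ne (Finset.sum_nonneg fun _ _ => by positivity)
      intro h
      apply hα
      ext i
      have := (Finset.sum_eq_zero_iff_of_nonneg (fun _ _ => by positivity)).1 h.symm i
        (Finset.mem_univ i)
      simpa using this
    have htr : (ketbra α).trace = t := by
      simp [ketbra, Matrix.trace_vecMulVec, dotProduct, t,
        ← Complex.normSq_eq_norm_sq, Complex.normSq_eq_conj_mul_self, mul_comm]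
    refine ⟨t, ((t⁻¹ : ℝ) : ℂ) • ketbra α, ht.le, ⟨?_, ?_⟩, ?_⟩
    · exact (Matrix.posSemidef_vecMulVec_self_star α).smul
        (by rw [Complex.zero_le_real]; positivity)
    · rw [Matrix.trace_smul, htr, smul_eq_mul, ← Complex.ofReal_mul, inv_mul_cancel₀ ht.ne']; simp
    · rw [smul_smul, ← Complex.ofReal_mul, mul_inv_cancel₀ ht.ne']; simp

lemma isSeparable_of_sum_ketbra {ρ : Op} (hρ : ρ.trace = 1) {κ : Type*} [Fintype κ] {y : κ → Vec}
    (hy : ρ = ∑ k, ketbra (y k)) (h0 : ∀ k, flipForm (y k) (y k) = 0) : IsSeparable ρ := by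
  have h : ∀ k, ∃ τ ∈ {τ : Op | ∃ α β : Op₁, IsDensity α ∧ IsDensity β ∧ τ = α ⊗ₖ β},
      ketbra (y k) = nsq (y k) • τ := by
    intro k
    obtain ⟨α, β, hαβ⟩ := exists_tensorVec_of_flipForm_eq_zero (h0 k)
    obtain ⟨s, A, -, hA, hαA⟩ := exists_isDensity_ketbra α
    obtain ⟨t, B, -, hB, hβB⟩ := exists_isDensity_ketbra β
    refine ⟨A ⊗ₖ B, ⟨A, B, hA, hB, rfl⟩, ?_⟩
    have h1 : ketbra (y k) = ((s * t : ℝ) : ℂ) • (A ⊗ₖ B) := by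
      rw [hαβ, ketbra_tensorVec, hαA, hβB, Matrix.smul_kronecker, Matrix.kronecker_smul, smul_smul,
        Complex.ofReal_mul]
    have h2 : nsq (y k) = s * t := by
      have := trace_ketbra (y k)
      rw [h1, Matrix.trace_smul, Matrix.trace_kronecker, hA.2, hB.2] at this
      simp only [mul_one, smul_eq_mul] at this
      exact_mod_cast this.symm
    rw [h1, h2]
    rfl
  choose τ hτ hyτ using h
  have h1 := (convex_convexHull ℝ _).sum_mem (t := Finset.univ) (fun k _ => nsq_nonneg (y k))
    (sum_nsq_eq_one hρ hy) (fun k _ => subset_convexHull ℝ _ (hτ k))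
  simp only [← hyτ] at h1
  rwa [← hy] at h1

lemma sum_ketbra_mix {κ : Type} [Fintype κ] [DecidableEq κ] {G : Matrix κ κ ℂ}
    (hG : G.conjTranspose * G = 1) (x : κ → Vec) :
    ∑ k, ketbra (∑ i, G k i • x i) = ∑ i, ketbra (x i) := by
  rw [sum_ketbra_eq, sum_ketbra_eq]
  set X : Matrix (Fin 2 × Fin 2) κ ℂ := Matrix.of fun a k => x k a
  have : (Matrix.of fun a k => (∑ i, G k i • x i) a) = X * G.transpose := by
    ext a k
    simp [X, Matrix.mul_apply, mul_comm]
  rw [this, Matrix.conjTranspose_mul, Matrix.mul_assoc, ← Matrix.mul_assoc G.transpose]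
  have h2 : G.transpose * G.transpose.conjTranspose = 1 := by
    have := congrArg Matrix.transpose hG
    rwa [Matrix.transpose_mul, Matrix.transpose_one] at this
  rw [h2, Matrix.one_mul]

/-- If `√λ₁ ≤ √λ₂ + √λ₃ + √λ₄`, phases make the numbers `√λᵢ` add up to zero, and a Hadamard matrix
mixes the vectors of a flip-orthogonal decomposition into product vectors. -/
theorem isSeparable_of_concurrence_nonpos {ρ : Op} (hρ : IsDensity ρ) (hC : concurrence ρ ≤ 0) :
    IsSeparable ρ := by
  obtain ⟨x, μ, hμ, hx⟩ := exists_isFlipOrthogonal hρ.1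
  obtain ⟨i₀, hi₀, hc⟩ := hx.exists_concurrence_eq
  simp only [Complex.norm_real, Real.norm_of_nonneg (hμ _)] at hc hi₀
  rw [hc] at hC
  have hle : ∀ i, 2 * μ i ≤ ∑ j, μ j := fun i => by linarith [hi₀ i]
  simp only [Fintype.sum_prod_type, Fin.sum_univ_two] at hle
  have h00 := hle (0, 0)
  have h01 := hle (0, 1)
  have h10 := hle (1, 0)
  have h11 := hle (1, 1)
  obtain ⟨u, v, w, z, hu, hv, hw, hz, hsum⟩ := exists_phases_polygon (hμ (0, 0)) (hμ (0, 1))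
    (hμ (1, 0)) (hμ (1, 1)) (by linarith) (by linarith) (by linarith) (by linarith)
  let p : Fin 2 × Fin 2 → ℂ := fun i => !![u, v; w, z] i.1 i.2
  have hp : ∀ i, ‖p i‖ = 1 := by
    rintro ⟨i, j⟩
    fin_cases i <;> fin_cases j <;> simpa [p]
  have hpsum : ∑ i, p i * μ i = 0 := by
    simp only [Fintype.sum_prod_type, Fin.sum_univ_two]
    simpa [p, add_assoc] using hsum
  have hroot : ∀ i, ∃ r : ℂ, r ^ 2 = p i := fun i => IsAlgClosed.exists_pow_nat_eq _ two_pos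
  choose r hr using hroot
  have hr1 : ∀ i, ‖r i‖ ^ 2 = 1 := fun i => by rw [← norm_pow, hr, hp]
  let H : Op₁ := !![1, 1; 1, -1]
  let G : Op := (1 / 2 : ℂ) • (H ⊗ₖ H)
  have hHH : H.conjTranspose * H = (2 : ℂ) • (1 : Op₁) := by
    ext i j
    fin_cases i <;> fin_cases j <;> simp [H, Matrix.mul_apply, Fin.sum_univ_two] <;> norm_num
  have hG : G.conjTranspose * G = 1 := by
    simp only [G, Matrix.conjTranspose_smul, Matrix.conjTranspose_kronecker, Matrix.smul_mul,
      Matrix.mul_smul, ← Matrix.mul_kronecker_mul, hHH, Matrix.smul_kronecker,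
      Matrix.kronecker_smul, Matrix.one_kronecker_one, smul_smul]
    norm_num
  -- equal squares make the flip form of each mixed vector equal to `(∑ pᵢ μᵢ) / 4 = 0`
  have hG2 : ∀ k i, G k i ^ 2 = 1 / 4 := by
    rintro ⟨k, l⟩ ⟨i, j⟩
    have hH : ∀ i j, H i j ^ 2 = 1 := fun i j => by
      fin_cases i <;> fin_cases j <;> simp [H]
    simp only [G, Matrix.smul_apply, Matrix.kroneckerMap_apply, smul_eq_mul, mul_pow, hH]
    norm_num
  apply isSeparable_of_sum_ketbra hρ.2 (y := fun k => ∑ i, G k i • (r i • x i))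
  · rw [sum_ketbra_mix hG, hx.1]
    refine Finset.sum_congr rfl fun i _ => ?_
    rw [ketbra_smul, hr1]; simp
  · intro k
    rw [← flipBilin_apply]
    simp only [map_sum, map_smul, LinearMap.sum_apply, LinearMap.smul_apply, flipBilin_apply, hx.2]
    have : ∀ i, ∑ j, G k j • (r j • (G k i • (r i • if i = j then (μ i : ℂ) else 0))) =
        1 / 4 * (p i * μ i) := by
      intro i
      rw [Finset.sum_eq_single i (fun j _ hj => by simp [hj.symm]) (by simp), if_pos rfl, ← hr,
        ← hG2 k i]
      simp only [smul_eq_mul]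
      ring
    simp only [Finset.smul_sum]
    rw [Finset.sum_comm, Finset.sum_congr rfl fun i _ => this i, ← Finset.mul_sum, hpsum, mul_zero]

lemma IsEntangled.concurrence_pos {ρ : Op} (hρ : IsEntangled ρ) : 0 < concurrence ρ := by
  by_contra h
  exact hρ.2 (isSeparable_of_concurrence_nonpos hρ.1 (not_lt.1 h))

/-! ### Local operations -/

lemma filtered_filtered (A B C D : Op₁) (ρ : Op) :
    filtered A B (filtered C D ρ) = filtered (A * C) (B * D) ρ := by
  simp only [filtered, Matrix.mul_kronecker_mul, Matrix.conjTranspose_mul, mul_assoc]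

lemma filtered_smul (A B : Op₁) (c : ℂ) (ρ : Op) : filtered A B (c • ρ) = c • filtered A B ρ := by
  simp [filtered]

lemma filtered_one (ρ : Op) : filtered 1 1 ρ = ρ := by simp [filtered]

lemma filtered_sum_ketbra {κ : Type*} [Fintype κ] (A B : Op₁) (x : κ → Vec) :
    filtered A B (∑ i, ketbra (x i)) = ∑ i, ketbra ((A ⊗ₖ B).mulVec (x i)) := by
  simp only [filtered, ketbra_mulVec, Finset.mul_sum, Finset.sum_mul]

lemma flipForm_mulVec (A B : Op₁) (x y : Vec) :
    flipForm ((A ⊗ₖ B).mulVec x) ((A ⊗ₖ B).mulVec y) = A.det * B.det * flipForm x y := by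
  simp only [flipForm, Matrix.mulVec, dotProduct, Fintype.sum_prod_type, Fin.sum_univ_two,
    Matrix.kroneckerMap_apply, Matrix.det_fin_two]
  ring

lemma IsFlipOrthogonal.filtered {ρ : Op} {x : Fin 2 × Fin 2 → Vec} {z : Fin 2 × Fin 2 → ℂ}
    (h : IsFlipOrthogonal ρ x z) (A B : Op₁) : IsFlipOrthogonal (filtered A B ρ)
      (fun i => (A ⊗ₖ B).mulVec (x i)) (fun i => A.det * B.det * z i) := by
  refine ⟨by rw [h.1, filtered_sum_ketbra], fun i j => ?_⟩
  rw [flipForm_mulVec, h.2, mul_ite, mul_zero]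

lemma IsFlipOrthogonal.smul {ρ : Op} {x : Fin 2 × Fin 2 → Vec} {z : Fin 2 × Fin 2 → ℂ}
    (h : IsFlipOrthogonal ρ x z) {t : ℝ} (ht : 0 ≤ t) : IsFlipOrthogonal ((t : ℂ) • ρ)
      (fun i => ((√t : ℝ) : ℂ) • x i) (fun i => t * z i) := by
  refine ⟨?_, fun i j => ?_⟩
  · rw [h.1, Finset.smul_sum]
    refine Finset.sum_congr rfl fun i _ => ?_
    rw [ketbra_smul, Complex.norm_real, Real.norm_eq_abs, sq_abs, Real.sq_sqrt ht]
  · rw [flipForm_smul_smul, h.2, ← Complex.ofReal_mul, Real.mul_self_sqrt ht, mul_ite, mul_zero]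

lemma posSemidef_filtered {ρ : Op} (hρ : ρ.PosSemidef) (A B : Op₁) :
    (filtered A B ρ).PosSemidef := hρ.mul_mul_conjTranspose_same _

lemma trace_eq_re {ι : Type} [Fintype ι] {ρ : Matrix ι ι ℂ} (hρ : ρ.PosSemidef) :
    ρ.trace = (ρ.trace.re : ℂ) ∧ 0 ≤ ρ.trace.re := by
  have h := Complex.nonneg_iff.1 hρ.trace_nonneg
  exact ⟨Complex.ext (by simp) (by simp [← h.2]), h.1⟩

lemma trace_filtered_pos {ρ : Op} (hρ : ρ.PosSemidef) {A B : Op₁}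
    (h : (filtered A B ρ).trace ≠ 0) : 0 < (filtered A B ρ).trace.re := by
  have h1 := trace_eq_re (posSemidef_filtered hρ A B)
  refine lt_of_le_of_ne h1.2 fun h0 => h ?_
  rw [h1.1, ← h0, Complex.ofReal_zero]

lemma localOp_eq {ρ : Op} (hρ : ρ.PosSemidef) (A B : Op₁) : localOp A B ρ =
    ((((filtered A B ρ).trace.re)⁻¹ : ℝ) : ℂ) • filtered A B ρ := by
  rw [localOp]
  nth_rw 1 [(trace_eq_re (posSemidef_filtered hρ A B)).1]
  rw [Complex.ofReal_inv]

lemma isDensity_localOp {ρ : Op} (hρ : ρ.PosSemidef) {A B : Op₁}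
    (h : (filtered A B ρ).trace ≠ 0) : IsDensity (localOp A B ρ) := by
  constructor
  · rw [localOp_eq hρ]
    refine (posSemidef_filtered hρ A B).smul ?_
    rw [Complex.zero_le_real]
    exact inv_nonneg.2 (trace_eq_re (posSemidef_filtered hρ A B)).2
  · rw [localOp, Matrix.trace_smul, smul_eq_mul, inv_mul_cancel₀ h]

/-- The factor by which the local operation given by `A` and `B` multiplies the square roots of the
eigenvalues of `ρ̃ρ`. -/
noncomputable def filterRate (A B : Op₁) (ρ : Op) : ℝ :=
  ‖A.det * B.det‖ / (filtered A B ρ).trace.re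

lemma filterRate_nonneg {ρ : Op} (hρ : ρ.PosSemidef) (A B : Op₁) : 0 ≤ filterRate A B ρ :=
  div_nonneg (norm_nonneg _) (trace_eq_re (posSemidef_filtered hρ A B)).2

lemma flipEigenvalues_localOp {ρ : Op} (hρ : ρ.PosSemidef) (A B : Op₁) :
    flipEigenvalues (localOp A B ρ) =
      (flipEigenvalues ρ).map fun z => ((filterRate A B ρ ^ 2 : ℝ) : ℂ) * z := by
  obtain ⟨x, μ, hμ, hx⟩ := exists_isFlipOrthogonal hρ
  have hN := inv_nonneg.2 (trace_eq_re (posSemidef_filtered hρ A B)).2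
  rw [localOp_eq hρ, ((hx.filtered A B).smul hN).flipEigenvalues_eq, hx.flipEigenvalues_eq,
    Multiset.map_map]
  congr 1
  ext i
  simp only [Function.comp_apply, ← Complex.ofReal_mul]
  congr 1
  rw [norm_mul, norm_mul, Complex.norm_real, Complex.norm_real, Real.norm_of_nonneg hN,
    Real.norm_of_nonneg (hμ i), filterRate]
  ring

lemma flipRoots_localOp {ρ : Op} (hρ : ρ.PosSemidef) (A B : Op₁) :
    flipRoots (localOp A B ρ) = (flipRoots ρ).map fun r => filterRate A B ρ * r := by
  have h0 := filterRate_nonneg hρ A B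
  rw [flipRoots, flipEigenvalues_localOp hρ, flipRoots, Multiset.map_map, Multiset.map_map]
  congr 1
  ext z
  simp only [Function.comp_apply, Complex.re_ofReal_mul]
  rw [Real.sqrt_mul (sq_nonneg _), Real.sqrt_sq h0]

lemma rootSum_localOp {ρ : Op} (hρ : ρ.PosSemidef) (A B : Op₁) :
    rootSum (localOp A B ρ) = filterRate A B ρ * rootSum ρ := by
  rw [rootSum, flipRoots_localOp hρ, Multiset.sum_map_mul_left, Multiset.map_id', rootSum]

lemma fold_max_map_mul {k : ℝ} (hk : 0 ≤ k) (s : Multiset ℝ) :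
    (s.map fun r => k * r).fold max 0 = k * s.fold max 0 := by
  induction s using Multiset.induction with
  | empty => simp
  | cons a s ih => rw [Multiset.map_cons, Multiset.fold_cons_left, ih, Multiset.fold_cons_left,
      mul_max_of_nonneg _ _ hk]

lemma concurrence_localOp {ρ : Op} (hρ : ρ.PosSemidef) (A B : Op₁) :
    concurrence (localOp A B ρ) = filterRate A B ρ * concurrence ρ := by
  rw [concurrence, rootSum_localOp hρ, flipRoots_localOp hρ,
    fold_max_map_mul (filterRate_nonneg hρ A B), concurrence]
  ring

lemma entanglementOfFormation_localOp {ρ : Op} (hρ : ρ.PosSemidef) (hC : 0 ≤ concurrence ρ)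
    {A B : Op₁} (h : (filtered A B ρ).trace ≠ 0) :
    entanglementOfFormation (localOp A B ρ) = entFn (filterRate A B ρ * concurrence ρ) := by
  rw [entanglementOfFormation_eq (isDensity_localOp hρ h), concurrence_localOp hρ]
  rw [concurrence_localOp hρ]
  exact mul_nonneg (filterRate_nonneg hρ A B) hC

/-- The concurrence that no local operation on `ρ` can exceed, because `rootSum` is multiplied by
the same factor as the concurrence and is at most `1` on states. -/
noncomputable def maxConcurrence (ρ : Op) : ℝ := concurrence ρ / rootSum ρ

lemma rootSum_pos {ρ : Op} (hρ : ρ.PosSemidef) (hC : 0 < concurrence ρ) : 0 < rootSum ρ :=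
  hC.trans_le (concurrence_le_rootSum hρ)

lemma maxConcurrence_mem {ρ : Op} (hρ : ρ.PosSemidef) (hC : 0 < concurrence ρ) :
    maxConcurrence ρ ∈ Set.Icc (0 : ℝ) 1 :=
  ⟨(div_pos hC (rootSum_pos hρ hC)).le,
    div_le_one_of_le₀ (concurrence_le_rootSum hρ) (rootSum_nonneg ρ)⟩

lemma filterRate_mul_concurrence {ρ : Op} (hρ : ρ.PosSemidef) (hC : 0 < concurrence ρ)
    {A B : Op₁} :
    filterRate A B ρ * concurrence ρ = rootSum (localOp A B ρ) * maxConcurrence ρ := by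
  have := (rootSum_pos hρ hC).ne'
  rw [rootSum_localOp hρ, maxConcurrence]
  field_simp

lemma entanglementOfFormation_le {ρ : Op} (hρ : ρ.PosSemidef) (hC : 0 < concurrence ρ)
    {τ : Op} (hτ : τ ∈ localProducts ρ) :
    entanglementOfFormation τ ≤ entFn (maxConcurrence ρ) := by
  obtain ⟨A, B, h, rfl⟩ := hτ
  have hM := maxConcurrence_mem hρ hC
  have h1 := rootSum_le_one (isDensity_localOp hρ h)
  have h0 := rootSum_nonneg (localOp A B ρ)
  rw [entanglementOfFormation_localOp hρ hC.le h, filterRate_mul_concurrence hρ hC]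
  refine entFn_strictMonoOn.monotoneOn ⟨mul_nonneg h0 hM.1, ?_⟩ hM ?_
  · exact mul_le_one₀ h1 hM.1 hM.2
  · exact mul_le_of_le_one_left hM.1 h1

lemma bddAbove_entanglementOfFormation {ρ : Op} (hρ : ρ.PosSemidef) (hC : 0 < concurrence ρ) :
    BddAbove (entanglementOfFormation '' localProducts ρ) :=
  ⟨entFn (maxConcurrence ρ), by rintro _ ⟨τ, hτ, rfl⟩; exact entanglementOfFormation_le hρ hC hτ⟩

lemma self_mem_localProducts {ρ : Op} (h1 : ρ.trace = 1) : ρ ∈ localProducts ρ :=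
  ⟨1, 1, by rw [filtered_one, h1]; simp, by rw [localOp, filtered_one, h1]; simp⟩

lemma maxEntanglement_le {ρ : Op} (hρ : ρ.PosSemidef) (hC : 0 < concurrence ρ)
    (h1 : ρ.trace = 1) : maxEntanglement ρ ≤ entFn (maxConcurrence ρ) :=
  csSup_le ⟨_, _, self_mem_localProducts h1, rfl⟩
    (by rintro _ ⟨τ, hτ, rfl⟩; exact entanglementOfFormation_le hρ hC hτ)

lemma le_maxEntanglement {ρ : Op} (hρ : ρ.PosSemidef) (hC : 0 < concurrence ρ)
    {τ : Op} (hτ : τ ∈ localProducts ρ) : entanglementOfFormation τ ≤ maxEntanglement ρ :=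
  le_csSup (bddAbove_entanglementOfFormation hρ hC) ⟨_, hτ, rfl⟩

lemma trace_filtered_ne_zero_of_isUnit {ρ : Op} (hρ : IsDensity ρ) {A B : Op₁}
    (hA : IsUnit A.det) (hB : IsUnit B.det) : (filtered A B ρ).trace ≠ 0 := by
  intro h
  rw [(posSemidef_filtered hρ.1 A B).trace_eq_zero_iff] at h
  have h2 := filtered_filtered A⁻¹ B⁻¹ A B ρ
  rw [h, Matrix.nonsing_inv_mul _ hA, Matrix.nonsing_inv_mul _ hB, filtered_one] at h2
  have := hρ.2
  rw [← h2] at this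
  simp [filtered] at this

lemma localOp_localOp {ρ : Op} {A₀ B₀ : Op₁} (h : (filtered A₀ B₀ ρ).trace ≠ 0) (A B : Op₁) :
    localOp A B (localOp A₀ B₀ ρ) = localOp (A * A₀) (B * B₀) ρ ∧
      ((filtered A B (localOp A₀ B₀ ρ)).trace ≠ 0 ↔ (filtered (A * A₀) (B * B₀) ρ).trace ≠ 0) := by
  have h1 : filtered A B (localOp A₀ B₀ ρ) =
      (filtered A₀ B₀ ρ).trace⁻¹ • filtered (A * A₀) (B * B₀) ρ := by
    rw [localOp, filtered_smul, filtered_filtered]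
  constructor
  · rw [localOp, h1, Matrix.trace_smul, smul_eq_mul, mul_inv, inv_inv, smul_smul, localOp,
      mul_right_comm, mul_inv_cancel₀ h, one_mul]
  · rw [h1, Matrix.trace_smul, smul_eq_mul, ne_eq, mul_eq_zero, not_or]
    exact ⟨fun h => h.2, fun h2 => ⟨inv_ne_zero h, h2⟩⟩

lemma localProducts_localOp {ρ : Op} (hρ : IsDensity ρ) {A₀ B₀ : Op₁} (hA : IsUnit A₀.det)
    (hB : IsUnit B₀.det) : localProducts (localOp A₀ B₀ ρ) = localProducts ρ := by
  have h := trace_filtered_ne_zero_of_isUnit hρ hA hB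
  ext τ
  constructor
  · rintro ⟨A, B, hAB, rfl⟩
    have := localOp_localOp h A B
    exact ⟨_, _, this.2.1 hAB, this.1⟩
  · rintro ⟨A, B, hAB, rfl⟩
    have := localOp_localOp h (A * A₀⁻¹) (B * B₀⁻¹)
    rw [Matrix.nonsing_inv_mul_cancel_right _ _ hA, Matrix.nonsing_inv_mul_cancel_right _ _ hB]
      at this
    exact ⟨_, _, this.2.2 hAB, this.1.symm⟩

/-! ### States whose kernel contains `|00⟩` -/

/-- The vector `|00⟩` lies in the kernel of `ρ`. -/
def HasCornerKernel (ρ : Op) : Prop := ∀ i, ρ i (0, 0) = 0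

/-- Principal minors of size two are nonnegative. -/
lemma norm_sq_entry_le {ρ : Op} (hρ : ρ.PosSemidef) (i j : Fin 2 × Fin 2) :
    ‖ρ i j‖ ^ 2 ≤ (ρ i i).re * (ρ j j).re := by
  have h := (hρ.submatrix ![i, j]).det_nonneg
  rw [Matrix.det_fin_two] at h
  have hi := Complex.nonneg_iff.1 (hρ.diag_nonneg (i := i))
  have hj := Complex.nonneg_iff.1 (hρ.diag_nonneg (i := j))
  have hji : ρ j i = starRingEnd ℂ (ρ i j) := (hρ.1.apply j i).symm
  have h2 := (Complex.nonneg_iff.1 h).1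
  simp [hji, ← hi.2, ← hj.2, Complex.mul_conj, Complex.normSq_eq_norm_sq] at h2
  exact_mod_cast h2

lemma diag_eq_re {ρ : Op} (hρ : ρ.PosSemidef) (i : Fin 2 × Fin 2) :
    ρ i i = ((ρ i i).re : ℂ) ∧ 0 ≤ (ρ i i).re := by
  have h := Complex.nonneg_iff.1 (hρ.diag_nonneg (i := i))
  exact ⟨Complex.ext (by simp) (by simp [← h.2]), h.1⟩

lemma HasCornerKernel.row {ρ : Op} (hρ : ρ.PosSemidef) (h : HasCornerKernel ρ)
    (j : Fin 2 × Fin 2) : ρ (0, 0) j = 0 := by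
  rw [← hρ.1.apply, h, star_zero]

/-- The geometric mean `√(ρ₀₁,₀₁ ρ₁₀,₁₀)` of the middle diagonal entries. -/
noncomputable def midMean (ρ : Op) : ℝ := √((ρ (0, 1) (0, 1)).re * (ρ (1, 0) (1, 0)).re)

lemma norm_entry_le_midMean {ρ : Op} (hρ : ρ.PosSemidef) : ‖ρ (0, 1) (1, 0)‖ ≤ midMean ρ :=
  Real.le_sqrt_of_sq_le (norm_sq_entry_le hρ _ _)

lemma midMean_sq {ρ : Op} (hρ : ρ.PosSemidef) :
    midMean ρ ^ 2 = (ρ (0, 1) (0, 1)).re * (ρ (1, 0) (1, 0)).re :=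
  Real.sq_sqrt (mul_nonneg (diag_eq_re hρ _).2 (diag_eq_re hρ _).2)

lemma charpoly_of_zero_column_of_zero_row {M : Op} (hcol : ∀ i, M i (0, 0) = 0)
    (hrow : ∀ j, M (1, 1) j = 0) : M.charpoly = Polynomial.X ^ 2 *
      (Polynomial.X ^ 2 - Polynomial.C (M (0, 1) (0, 1) + M (1, 0) (1, 0)) * Polynomial.X +
        Polynomial.C (M (0, 1) (0, 1) * M (1, 0) (1, 0) - M (0, 1) (1, 0) * M (1, 0) (0, 1))) := by
  let e : Fin 2 × Fin 2 ≃ Fin 4 := finProdFinEquiv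
  have e0 : e.symm 0 = (0, 0) := rfl
  have e1 : e.symm 1 = (0, 1) := rfl
  have e2 : e.symm 2 = (1, 0) := rfl
  have e3 : e.symm 3 = (1, 1) := rfl
  rw [← Matrix.charpoly_reindex e M, Matrix.charpoly, Matrix.det_succ_column_zero]
  have hc : ∀ i j, Matrix.charmatrix (Matrix.reindex e e M) i j =
      (if i = j then Polynomial.X else 0) - Polynomial.C (M (e.symm i) (e.symm j)) := by
    intro i j
    simp [Matrix.charmatrix_apply, Matrix.diagonal_apply]
  simp only [Fin.sum_univ_four, Matrix.det_fin_three, Matrix.submatrix_apply, hc]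
  simp [e0, e1, e2, e3, hcol, hrow, Fin.succAbove, Fin.lt_def, Fin.ext_iff]
  ring

lemma HasCornerKernel.spinFlip_mul {ρ : Op} (hρ : ρ.PosSemidef) (h : HasCornerKernel ρ) :
    (∀ i, (spinFlip ρ * ρ) i (0, 0) = 0) ∧ (∀ j, (spinFlip ρ * ρ) (1, 1) j = 0) ∧
    (spinFlip ρ * ρ) (0, 1) (0, 1) = ((midMean ρ ^ 2 + ‖ρ (0, 1) (1, 0)‖ ^ 2 : ℝ) : ℂ) ∧
    (spinFlip ρ * ρ) (1, 0) (1, 0) = ((midMean ρ ^ 2 + ‖ρ (0, 1) (1, 0)‖ ^ 2 : ℝ) : ℂ) ∧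
    (spinFlip ρ * ρ) (0, 1) (1, 0) * (spinFlip ρ * ρ) (1, 0) (0, 1) =
      ((4 * midMean ρ ^ 2 * ‖ρ (0, 1) (1, 0)‖ ^ 2 : ℝ) : ℂ) := by
  have hr := h.row hρ
  have hji : ρ (1, 0) (0, 1) = starRingEnd ℂ (ρ (0, 1) (1, 0)) := (hρ.1.apply _ _).symm
  have ha := (diag_eq_re hρ (0, 1)).1
  have hb := (diag_eq_re hρ (1, 0)).1
  rw [midMean_sq hρ]
  generalize (ρ (0, 1) (0, 1)).re = a at *
  generalize (ρ (1, 0) (1, 0)).re = b at *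
  have key : ∀ i j, (spinFlip ρ * ρ) i j = ∑ k, spinFlip ρ i k * ρ k j := fun i j =>
    Matrix.mul_apply
  have h1 : ∀ k, spinFlip ρ (1, 1) k = 0 := by
    rintro ⟨k, l⟩
    simp [spinFlip, Matrix.mul_apply, Fintype.sum_prod_type, Fin.sum_univ_two, pauliY,
      Matrix.kroneckerMap_apply, hr]
  have s1 : spinFlip ρ (0, 1) (0, 1) = b := by
    simp [spinFlip, Matrix.mul_apply, Fintype.sum_prod_type, Fin.sum_univ_two, pauliY,
      Matrix.kroneckerMap_apply, hb]
  have s2 : spinFlip ρ (1, 0) (1, 0) = a := by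
    simp [spinFlip, Matrix.mul_apply, Fintype.sum_prod_type, Fin.sum_univ_two, pauliY,
      Matrix.kroneckerMap_apply, ha]
  have s3 : spinFlip ρ (0, 1) (1, 0) = ρ (0, 1) (1, 0) := by
    simp [spinFlip, Matrix.mul_apply, Fintype.sum_prod_type, Fin.sum_univ_two, pauliY,
      Matrix.kroneckerMap_apply, hji]
  have s4 : spinFlip ρ (1, 0) (0, 1) = starRingEnd ℂ (ρ (0, 1) (1, 0)) := by
    simp [spinFlip, Matrix.mul_apply, Fintype.sum_prod_type, Fin.sum_univ_two, pauliY,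
      Matrix.kroneckerMap_apply]
  have s5 : ∀ i, spinFlip ρ i (1, 1) = 0 := by
    rintro ⟨k, l⟩
    simp [spinFlip, Matrix.mul_apply, Fintype.sum_prod_type, Fin.sum_univ_two, pauliY,
      Matrix.kroneckerMap_apply, h _]
  refine ⟨fun i => ?_, fun j => ?_, ?_, ?_, ?_⟩
  · simp [key, h _]
  · simp [key, h1]
  all_goals
    simp only [key, Fintype.sum_prod_type, Fin.sum_univ_two, hr, s1, s2, s3, s4, s5, ha, hb, hji]
    push_cast
    simp only [← Complex.ofReal_pow, ← Complex.normSq_eq_norm_sq, Complex.normSq_eq_conj_mul_self]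
    ring

section CornerKernel

variable {ρ : Op}

lemma HasCornerKernel.flipEigenvalues_eq (hρ : ρ.PosSemidef) (h : HasCornerKernel ρ) :
    flipEigenvalues ρ = {(((midMean ρ + ‖ρ (0, 1) (1, 0)‖) ^ 2 : ℝ) : ℂ),
      (((midMean ρ - ‖ρ (0, 1) (1, 0)‖) ^ 2 : ℝ) : ℂ), 0, 0} := by
  obtain ⟨h1, h2, h3, h4, h5⟩ := h.spinFlip_mul hρ
  have hch : (spinFlip ρ * ρ).charpoly =
      (({(((midMean ρ + ‖ρ (0, 1) (1, 0)‖) ^ 2 : ℝ) : ℂ),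
        (((midMean ρ - ‖ρ (0, 1) (1, 0)‖) ^ 2 : ℝ) : ℂ), 0, 0} : Multiset ℂ).map
          fun a => Polynomial.X - Polynomial.C a).prod := by
    rw [charpoly_of_zero_column_of_zero_row h1 h2, h3, h4, h5]
    simp only [Multiset.insert_eq_cons, Multiset.map_cons, Multiset.map_singleton,
      Multiset.prod_cons, Multiset.prod_singleton]
    push_cast
    simp only [map_sub, map_add, map_mul, map_pow, map_zero, map_ofNat]
    ring
  rw [flipEigenvalues, hch, Polynomial.roots_multiset_prod_X_sub_C]

lemma HasCornerKernel.flipRoots_eq (hρ : ρ.PosSemidef) (h : HasCornerKernel ρ) :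
    flipRoots ρ = {midMean ρ + ‖ρ (0, 1) (1, 0)‖, midMean ρ - ‖ρ (0, 1) (1, 0)‖, 0, 0} := by
  have hle := norm_entry_le_midMean hρ
  have h0 := norm_nonneg (ρ (0, 1) (1, 0))
  rw [flipRoots, h.flipEigenvalues_eq hρ]
  simp only [Multiset.insert_eq_cons, Multiset.map_cons, Multiset.map_singleton,
    Complex.ofReal_re, Complex.zero_re, Real.sqrt_zero]
  rw [Real.sqrt_sq (by linarith), Real.sqrt_sq (by linarith)]

lemma HasCornerKernel.rootSum_eq (hρ : ρ.PosSemidef) (h : HasCornerKernel ρ) :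
    rootSum ρ = 2 * midMean ρ := by
  rw [rootSum, h.flipRoots_eq hρ]
  simp
  ring

lemma HasCornerKernel.concurrence_eq (hρ : ρ.PosSemidef) (h : HasCornerKernel ρ) :
    concurrence ρ = 2 * ‖ρ (0, 1) (1, 0)‖ := by
  have hle := norm_entry_le_midMean hρ
  have h0 := norm_nonneg (ρ (0, 1) (1, 0))
  rw [concurrence, h.rootSum_eq hρ, h.flipRoots_eq hρ]
  simp only [Multiset.insert_eq_cons, Multiset.fold_cons_left, Multiset.fold_singleton]
  rw [max_self, max_eq_left (b := (0 : ℝ)) (by linarith),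
    max_eq_left (max_le (by linarith) (by linarith))]
  ring

lemma HasCornerKernel.maxConcurrence_eq (hρ : ρ.PosSemidef) (h : HasCornerKernel ρ) :
    maxConcurrence ρ = ‖ρ (0, 1) (1, 0)‖ / midMean ρ := by
  rw [maxConcurrence, h.concurrence_eq hρ, h.rootSum_eq hρ, mul_div_mul_left _ _ two_ne_zero]

lemma HasCornerKernel.entanglementOfFormation_eq (hρ : IsDensity ρ) (h : HasCornerKernel ρ) :
    entanglementOfFormation ρ = entFn (2 * ‖ρ (0, 1) (1, 0)‖) := by
  rw [TwoQubit.entanglementOfFormation_eq hρ, h.concurrence_eq hρ.1]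
  rw [h.concurrence_eq hρ.1]
  positivity

lemma HasCornerKernel.trace_eq (hρ : IsDensity ρ) (h : HasCornerKernel ρ) :
    (ρ (0, 1) (0, 1)).re + (ρ (1, 0) (1, 0)).re + (ρ (1, 1) (1, 1)).re = 1 := by
  have := congrArg Complex.re hρ.2
  simpa [Matrix.trace, Fintype.sum_prod_type, h _, add_assoc] using this

lemma bellBlock_apply (f : ℂ) (i j : Fin 2 × Fin 2) : bellBlock f i j =
    if i = (0, 1) then (if j = (0, 1) then 1 / 2 else if j = (1, 0) then f else 0)
    else if i = (1, 0) then
      (if j = (0, 1) then starRingEnd ℂ f else if j = (1, 0) then 1 / 2 else 0) else 0 := by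
  obtain ⟨i, i'⟩ := i
  obtain ⟨j, j'⟩ := j
  fin_cases i <;> fin_cases i' <;> fin_cases j <;> fin_cases j' <;>
    simp [bellBlock]

/-- As `ρ₀₁,₀₁ + ρ₁₀,₁₀ + ρ₁₁,₁₁ = 1`, the geometric mean of the middle diagonal entries can be
`1 / 2` only if both are equal to `1 / 2` and `ρ₁₁,₁₁ = 0`. -/
lemma HasCornerKernel.eq_bellBlock (hρ : IsDensity ρ) (h : HasCornerKernel ρ)
    (h1 : rootSum ρ = 1) : ρ = bellBlock (ρ (0, 1) (1, 0)) := by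
  have htr := h.trace_eq hρ
  rw [h.rootSum_eq hρ.1] at h1
  have hm := midMean_sq hρ.1
  have ha := diag_eq_re hρ.1 (0, 1)
  have hb := diag_eq_re hρ.1 (1, 0)
  have hd := diag_eq_re hρ.1 (1, 1)
  have hji : ρ (1, 0) (0, 1) = starRingEnd ℂ (ρ (0, 1) (1, 0)) := (hρ.1.1.apply _ _).symm
  have hm' : midMean ρ = 1 / 2 := by linarith
  have hd0 : (ρ (1, 1) (1, 1)).re = 0 := by
    rw [hm'] at hm
    nlinarith [sq_nonneg ((ρ (0, 1) (0, 1)).re - (ρ (1, 0) (1, 0)).re)]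
  have hab : (ρ (0, 1) (0, 1)).re = 1 / 2 := by
    rw [hm'] at hm
    nlinarith [sq_nonneg ((ρ (0, 1) (0, 1)).re - 1 / 2)]
  have hb' : (ρ (1, 0) (1, 0)).re = 1 / 2 := by linarith
  have hr : ∀ j, ρ (1, 1) j = 0 := by
    intro j
    have := norm_sq_entry_le hρ.1 (1, 1) j
    rw [hd0, zero_mul] at this
    have := pow_eq_zero_iff (two_ne_zero) |>.1 (le_antisymm this (by positivity))
    simpa using this
  have hc : ∀ j, ρ j (1, 1) = 0 := fun j => by rw [← hρ.1.1.apply, hr, star_zero]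
  have hrow := h.row hρ.1
  rw [hab] at ha
  rw [hb'] at hb
  ext ⟨i, i'⟩ ⟨j, j'⟩
  rw [bellBlock_apply]
  fin_cases i <;> fin_cases i' <;> fin_cases j <;> fin_cases j' <;>
    simp [h _, hrow, hr, hc, ha.1, hb.1, hji]

lemma bellBlock_hasCornerKernel (f : ℂ) : HasCornerKernel (bellBlock f) := by
  intro i
  rw [bellBlock_apply]
  simp

end CornerKernel

/-! ### The optimal filtering sequence -/

lemma isClosed_isDensity : IsClosed {ρ : Op | IsDensity ρ} := by
  have h : {ρ : Op | IsDensity ρ} = {ρ : Op | ρ.conjTranspose = ρ} ∩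
      (⋂ x : Vec, {ρ : Op | 0 ≤ star x ⬝ᵥ ρ.mulVec x}) ∩ {ρ : Op | ρ.trace = 1} := by
    ext ρ
    simp only [IsDensity, Matrix.posSemidef_iff_dotProduct_mulVec, Set.mem_inter_iff,
      Set.mem_iInter, Set.mem_ofPred_eq, Matrix.IsHermitian]
  rw [h]
  refine IsClosed.inter (IsClosed.inter ?_ (isClosed_iInter fun x => ?_)) ?_
  · exact isClosed_eq (by fun_prop) continuous_id
  · exact isClosed_le continuous_const
      (continuous_const.dotProduct (continuous_id.matrix_mulVec continuous_const))
  · exact isClosed_eq (continuous_id.matrix_trace) continuous_const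

lemma filtered_diagonal (u v : Fin 2 → ℝ) (ρ : Op) (i j : Fin 2 × Fin 2) :
    filtered (Matrix.diagonal fun k => (u k : ℂ)) (Matrix.diagonal fun k => (v k : ℂ)) ρ i j =
      ((u i.1 * v i.2) * (u j.1 * v j.2) : ℝ) * ρ i j := by
  have : (Matrix.diagonal fun k => (u k : ℂ)) ⊗ₖ (Matrix.diagonal fun k => (v k : ℂ)) =
      Matrix.diagonal fun k : Fin 2 × Fin 2 => ((u k.1 * v k.2 : ℝ) : ℂ) := by
    rw [Matrix.diagonal_kronecker_diagonal]
    simp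
  rw [filtered, this, Matrix.diagonal_conjTranspose, Matrix.mul_diagonal, Matrix.diagonal_mul]
  simp
  ring

section CornerKernel

variable {ρ : Op}

lemma midMean_pos (hρ : ρ.PosSemidef) (hf : ρ (0, 1) (1, 0) ≠ 0) : 0 < midMean ρ :=
  (norm_pos_iff.2 hf).trans_le (norm_entry_le_midMean hρ)

/-- Filters that equalise the weights of `|01⟩` and `|10⟩` and suppress `|11⟩` drive a state with
`|00⟩` in its kernel to a Bell-diagonal state of rank two. -/
lemma HasCornerKernel.exists_tendsto_bellBlock (hρ : IsDensity ρ) (h : HasCornerKernel ρ)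
    (hf : ρ (0, 1) (1, 0) ≠ 0) : ∃ τ : ℕ → Op,
      (∀ n, τ n ∈ localProducts ρ ∧ HasCornerKernel (τ n)) ∧
      Filter.Tendsto τ Filter.atTop (nhds (bellBlock (ρ (0, 1) (1, 0) / (2 * midMean ρ)))) := by
  have hm := midMean_pos hρ.1 hf
  have hm2 := midMean_sq hρ.1
  obtain ⟨ha, ha0⟩ := diag_eq_re hρ.1 (0, 1)
  obtain ⟨hb, hb0⟩ := diag_eq_re hρ.1 (1, 0)
  obtain ⟨hd, hd0⟩ := diag_eq_re hρ.1 (1, 1)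
  have hji : ρ (1, 0) (0, 1) = starRingEnd ℂ (ρ (0, 1) (1, 0)) := (hρ.1.1.apply _ _).symm
  have hrow := h.row hρ.1
  set a := (ρ (0, 1) (0, 1)).re
  set b := (ρ (1, 0) (1, 0)).re
  set d := (ρ (1, 1) (1, 1)).re
  set m := midMean ρ with hmdef
  have hab : √b * √a = m := by rw [← Real.sqrt_mul hb0, mul_comm b a]; rfl
  have hsa : √a * √a = a := Real.mul_self_sqrt ha0
  have hsb : √b * √b = b := Real.mul_self_sqrt hb0
  -- `F ε` is `ρ` rescaled by the weights `w ε`; for `ε ≠ 0` the weights of `|01⟩`, `|10⟩`, `|11⟩`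
  -- are those of the filter `diag(√b, ε√a) ⊗ diag(ε⁻¹, 1)`, and that of `|00⟩` does not matter
  let w : ℝ → Fin 2 × Fin 2 → ℝ := fun ε i => !![0, √b; √a, ε * √a] i.1 i.2
  let F : ℝ → Op := fun ε => Matrix.of fun i j => ((w ε i * w ε j : ℝ) : ℂ) * ρ i j
  have hFcont : Continuous F := by
    refine continuous_matrix fun i j => ?_
    have hw : ∀ i, Continuous fun ε => w ε i := by
      rintro ⟨i, j⟩
      fin_cases i <;> fin_cases j <;> simp [w] <;> fun_prop
    have := hw i
    have := hw j
    simp only [F, Matrix.of_apply]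
    fun_prop
  have htr : ∀ ε, (F ε).trace = ((2 * m ^ 2 + ε ^ 2 * (a * d) : ℝ) : ℂ) := by
    intro ε
    simp [F, w, Matrix.trace, Fintype.sum_prod_type, Fin.sum_univ_two, ha, hb, hd]
    simp only [← Complex.ofReal_mul, ← Complex.ofReal_add, ← Complex.ofReal_pow]
    rw [hm2, mul_mul_mul_comm, hsa, hsb]
    push_cast
    ring
  have htr0 : ∀ ε, (F ε).trace ≠ 0 := by
    intro ε
    rw [htr, Complex.ofReal_ne_zero]
    have := mul_nonneg (sq_nonneg ε) (mul_nonneg ha0 hd0)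
    positivity
  have hF : ∀ ε, ε ≠ 0 → filtered (Matrix.diagonal fun k => ((![√b, ε * √a] k : ℝ) : ℂ))
      (Matrix.diagonal fun k => ((![ε⁻¹, 1] k : ℝ) : ℂ)) ρ = F ε := by
    intro ε hε
    ext i j
    rw [filtered_diagonal]
    obtain ⟨i, i'⟩ := i
    obtain ⟨j, j'⟩ := j
    have h1 : ε * √a * ε⁻¹ = √a := by field_simp
    fin_cases i <;> fin_cases i' <;> fin_cases j <;> fin_cases j' <;>
      simp only [F, w, Fin.zero_eta, Fin.mk_one, Matrix.of_apply, Matrix.cons_val_zero,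
        Matrix.cons_val_one, Matrix.cons_val', Matrix.cons_val_fin_one, h1, mul_one, h _, hrow,
        mul_zero]
  let G : ℝ → Op := fun ε => (F ε).trace⁻¹ • F ε
  have hGcont : Continuous G := (hFcont.matrix_trace.inv₀ htr0).smul hFcont
  have hG0 : G 0 = bellBlock (ρ (0, 1) (1, 0) / (2 * m)) := by
    have hm' : (m : ℂ) ≠ 0 := by exact_mod_cast hm.ne'
    have hab' : (√b : ℂ) * √a = m := by exact_mod_cast hab
    have hsa' : (√a : ℂ) * √a = a := by exact_mod_cast hsa
    have hsb' : (√b : ℂ) * √b = b := by exact_mod_cast hsb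
    have hm2' : (m : ℂ) ^ 2 = a * b := by exact_mod_cast hm2
    ext ⟨i, i'⟩ ⟨j, j'⟩
    rw [bellBlock_apply]
    simp only [G, htr, Matrix.smul_apply, smul_eq_mul, F, Matrix.of_apply]
    fin_cases i <;> fin_cases i' <;> fin_cases j <;> fin_cases j' <;>
      simp [w, ha, hb, hji, hab', hsa', hsb', mul_comm (√a : ℂ) (√b : ℂ)] <;> field_simp
    · rw [hm2']; ring
    · rw [map_ofNat]; ring
    · exact hm2'.symm
  refine ⟨fun n => G (1 / ((n : ℝ) + 1)), fun n => ?_, ?_⟩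
  · have hε : 1 / ((n : ℝ) + 1) ≠ 0 := by positivity
    constructor
    · refine ⟨?_, ?_, ?_, ?_⟩
      · exact Matrix.diagonal fun k => ((![√b, 1 / ((n : ℝ) + 1) * √a] k : ℝ) : ℂ)
      · exact Matrix.diagonal fun k => ((![(1 / ((n : ℝ) + 1))⁻¹, 1] k : ℝ) : ℂ)
      · rw [hF _ hε]; exact htr0 _
      · simp only [localOp, hF _ hε, G]
    · intro i
      simp [G, F, h i]
  · rw [← hG0]
    exact (hGcont.tendsto 0).comp tendsto_one_div_add_atTop_nhds_zero_nat

lemma HasCornerKernel.maxEntanglement_eq (hρ : IsDensity ρ) (h : HasCornerKernel ρ)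
    (hf : ρ (0, 1) (1, 0) ≠ 0) : maxEntanglement ρ = entFn (maxConcurrence ρ) := by
  have hC : 0 < concurrence ρ := by rw [h.concurrence_eq hρ.1]; positivity
  apply le_antisymm (maxEntanglement_le hρ.1 hC hρ.2)
  obtain ⟨τ, hτ, hlim⟩ := h.exists_tendsto_bellBlock hρ hf
  set f := ρ (0, 1) (1, 0) / (2 * midMean ρ) with hfdef
  have h1 : Filter.Tendsto (fun n => entanglementOfFormation (τ n)) Filter.atTop
      (nhds (entFn (2 * ‖bellBlock f (0, 1) (1, 0)‖))) := by
    have hd : ∀ n, entanglementOfFormation (τ n) = entFn (2 * ‖τ n (0, 1) (1, 0)‖) := by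
      intro n
      obtain ⟨⟨A, B, hAB, hτn⟩, hc⟩ := hτ n
      exact hc.entanglementOfFormation_eq (hτn ▸ isDensity_localOp hρ.1 hAB)
    simp only [hd]
    have hcont : Continuous fun σ : Op => entFn (2 * ‖σ (0, 1) (1, 0)‖) :=
      entFn_continuous.comp (continuous_const.mul (continuous_id.matrix_elem _ _).norm)
    exact (hcont.tendsto _).comp hlim
  have h2 : 2 * ‖bellBlock f (0, 1) (1, 0)‖ = maxConcurrence ρ := by
    have hm := midMean_pos hρ.1 hf
    rw [h.maxConcurrence_eq hρ.1, bellBlock_apply]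
    simp [hfdef, abs_of_pos hm]
    field_simp
  rw [← h2]
  exact le_of_tendsto' h1 fun n => le_maxEntanglement hρ.1 hC (hτ n).1

end CornerKernel

/-! ### Bell-diagonal states -/

lemma partialTraceB_ketbra (ψ : Vec) : partialTraceB (ketbra ψ) =
    (Matrix.of fun i j => ψ (i, j)) * (Matrix.of fun i j => ψ (i, j)).conjTranspose := by
  ext i j
  simp [partialTraceB, ketbra, Matrix.vecMulVec_apply, Matrix.mul_apply]

lemma kronecker_conjTranspose_mul_self {U V : Op₁} (hU : U ∈ Matrix.unitaryGroup (Fin 2) ℂ)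
    (hV : V ∈ Matrix.unitaryGroup (Fin 2) ℂ) : (U ⊗ₖ V).conjTranspose * (U ⊗ₖ V) = 1 := by
  rw [Matrix.conjTranspose_kronecker, ← Matrix.mul_kronecker_mul, ← Matrix.star_eq_conjTranspose,
    ← Matrix.star_eq_conjTranspose, Matrix.mem_unitaryGroup_iff'.1 hU,
    Matrix.mem_unitaryGroup_iff'.1 hV, Matrix.one_kronecker_one]

lemma IsMaximallyEntangled.mulVec {U V : Op₁} (hU : U ∈ Matrix.unitaryGroup (Fin 2) ℂ)
    (hV : V ∈ Matrix.unitaryGroup (Fin 2) ℂ) {ψ : Vec} (hψ : IsMaximallyEntangled ψ) :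
    IsMaximallyEntangled ((U ⊗ₖ V).mulVec ψ) := by
  rw [IsMaximallyEntangled, partialTraceB_ketbra] at hψ ⊢
  set Ψ : Op₁ := Matrix.of fun i j => ψ (i, j)
  have h1 : (Matrix.of fun i j => (U ⊗ₖ V).mulVec ψ (i, j)) = U * Ψ * V.transpose := by
    ext i j
    simp [Ψ, Matrix.mulVec, dotProduct, Fintype.sum_prod_type, Matrix.mul_apply,
      Matrix.kroneckerMap_apply]
    ring
  have h2 : V.transpose * V.transpose.conjTranspose = 1 := by
    have := congrArg Matrix.transpose (Matrix.mem_unitaryGroup_iff'.1 hV)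
    rwa [Matrix.transpose_mul, Matrix.transpose_one] at this
  rw [h1, Matrix.conjTranspose_mul, mul_assoc, ← mul_assoc V.transpose, h2, one_mul,
    Matrix.conjTranspose_mul, mul_assoc, ← mul_assoc Ψ, hψ, Matrix.smul_mul, one_mul,
    Matrix.mul_smul, ← Matrix.star_eq_conjTranspose, Matrix.mem_unitaryGroup_iff.1 hU]

lemma IsBellDiagonal.filtered {U V : Op₁} (hU : U ∈ Matrix.unitaryGroup (Fin 2) ℂ)
    (hV : V ∈ Matrix.unitaryGroup (Fin 2) ℂ) {σ : Op} (hσ : IsBellDiagonal σ) :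
    IsBellDiagonal (filtered U V σ) := by
  obtain ⟨ψ, p, h1, h2, h3⟩ := hσ
  refine ⟨fun i => (U ⊗ₖ V).mulVec (ψ i), p, fun i j => ?_, fun i => (h2 i).mulVec hU hV, ?_⟩
  · rw [← h1 i j, Matrix.star_mulVec, ← Matrix.dotProduct_mulVec, Matrix.mulVec_mulVec,
      kronecker_conjTranspose_mul_self hU hV, Matrix.one_mulVec]
  · rw [h3]
    simp only [ketbra_mulVec, TwoQubit.filtered, Finset.mul_sum, Finset.sum_mul, Matrix.mul_smul,
      Matrix.smul_mul]

/-- If `f = |f| u`, the Bell basis `(|01⟩ ± ū|10⟩)/√2`, `(|00⟩ ± |11⟩)/√2` consists of eigenvectors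
with the eigenvalues `1/2 ± |f|`, `0`, `0`. -/
lemma isBellDiagonal_bellBlock (f : ℂ) : IsBellDiagonal (bellBlock f) := by
  obtain ⟨u, hu, huf⟩ : ∃ u : ℂ, u * starRingEnd ℂ u = 1 ∧ f = ‖f‖ * u := by
    refine ⟨Complex.exp (Complex.arg f * Complex.I), ?_, (Complex.norm_mul_exp_arg_mul_I f).symm⟩
    rw [Complex.mul_conj, Complex.normSq_eq_norm_sq, Complex.norm_exp_ofReal_mul_I]; simp
  have huf' : starRingEnd ℂ f = ‖f‖ * starRingEnd ℂ u := by
    conv_lhs => rw [huf]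
    simp
  obtain ⟨s, hs⟩ : ∃ s : ℝ, s * s = 1 / 2 := ⟨√(1 / 2), Real.mul_self_sqrt (by norm_num)⟩
  have hs' : (s : ℂ) * s = 1 / 2 := by rw [← Complex.ofReal_mul, hs]; simp
  let ψ : Fin 4 → Vec := fun k i => s *
    (![!![0, 1; starRingEnd ℂ u, 0], !![0, 1; -starRingEnd ℂ u, 0], !![1, 0; 0, 1],
      !![1, 0; 0, -1]] : Fin 4 → Op₁) k i.1 i.2
  refine ⟨ψ, ![1 / 2 + ‖f‖, 1 / 2 - ‖f‖, 0, 0], ?_, ?_, ?_⟩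
  · intro i j
    fin_cases i <;> fin_cases j <;>
      simp [ψ, dotProduct, Fintype.sum_prod_type, Fin.sum_univ_two] <;>
      first
        | linear_combination 2 * hs' + s * s * hu
        | linear_combination -(s * s) * hu
        | linear_combination 2 * hs'
  · intro i
    rw [IsMaximallyEntangled, partialTraceB_ketbra]
    ext a b
    fin_cases i <;> fin_cases a <;> fin_cases b <;>
      simp [ψ, Matrix.mul_apply, Fin.sum_univ_two] <;>
      first
        | linear_combination hs'
        | linear_combination hs' + s * s * hu
  · ext ⟨i, i'⟩ ⟨j, j'⟩
    rw [bellBlock_apply]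
    fin_cases i <;> fin_cases i' <;> fin_cases j <;> fin_cases j' <;>
      simp [ψ, Fin.sum_univ_four, Matrix.sum_apply, ketbra, Matrix.vecMulVec_apply]
    · linear_combination -hs'
    · linear_combination huf - 2 * ‖f‖ * u * hs'
    · linear_combination huf' - 2 * ‖f‖ * starRingEnd ℂ u * hs'
    · linear_combination -hs' - s * s * hu

lemma rank_bellBlock {f : ℂ} (hf : ‖f‖ < 1 / 2) : (bellBlock f).rank = 2 := by
  let E : Matrix (Fin 2 × Fin 2) (Fin 2) ℂ := Matrix.of fun i k =>
    if i = ![(0, 1), (1, 0)] k then 1 else 0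
  let D : Op₁ := !![1 / 2, f; starRingEnd ℂ f, 1 / 2]
  have hD : IsUnit D := by
    rw [Matrix.isUnit_iff_isUnit_det, isUnit_iff_ne_zero, Matrix.det_fin_two]
    simp only [D, Matrix.of_apply, Matrix.cons_val', Matrix.cons_val_zero, Matrix.cons_val_one,
      Matrix.cons_val_fin_one, Complex.mul_conj, Complex.normSq_eq_norm_sq]
    have h0 := norm_nonneg f
    have : (1 / 2 * (1 / 2) - ((‖f‖ ^ 2 : ℝ) : ℂ)) = ((1 / 4 - ‖f‖ ^ 2 : ℝ) : ℂ) := by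
      push_cast; ring
    rw [this, Complex.ofReal_ne_zero]
    nlinarith
  have h1 : bellBlock f = E * D * E.transpose := by
    ext ⟨i, i'⟩ ⟨j, j'⟩
    rw [bellBlock_apply]
    fin_cases i <;> fin_cases i' <;> fin_cases j <;> fin_cases j' <;>
      simp [E, D, Matrix.mul_apply, Fin.sum_univ_two]
  have hE : E.transpose * E = 1 := by
    ext i j
    fin_cases i <;> fin_cases j <;>
      simp [E, Matrix.mul_apply, Fintype.sum_prod_type, Fin.sum_univ_two]
  have h2 : D = E.transpose * bellBlock f * E := by
    rw [h1, Matrix.mul_assoc, Matrix.mul_assoc, Matrix.mul_assoc, hE, Matrix.mul_one,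
      ← Matrix.mul_assoc, hE, Matrix.one_mul]
  have hr : D.rank = 2 := by rw [Matrix.rank_of_isUnit _ hD]; simp
  apply le_antisymm
  · rw [h1]
    exact (Matrix.rank_mul_le_left _ _).trans ((Matrix.rank_mul_le_right _ _).trans hr.le)
  · refine hr.symm.le.trans ?_
    conv_lhs => rw [h2]
    exact (Matrix.rank_mul_le_left _ _).trans (Matrix.rank_mul_le_right _ _)

/-! ### Product vectors in the kernel -/

lemma kronecker_mulVec_tensorVec (A B : Op₁) (u v : Fin 2 → ℂ) :
    (A ⊗ₖ B).mulVec (tensorVec u v) = tensorVec (A.mulVec u) (B.mulVec v) := by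
  ext ⟨i, j⟩
  simp only [Matrix.mulVec, dotProduct, tensorVec, Fintype.sum_prod_type, Fin.sum_univ_two,
    Matrix.kroneckerMap_apply]
  ring

lemma tensorVec_smul_smul (c d : ℂ) (u v : Fin 2 → ℂ) :
    tensorVec (c • u) (d • v) = (c * d) • tensorVec u v := by
  ext i
  simp only [tensorVec, Pi.smul_apply, smul_eq_mul]
  ring

/-- `|00⟩`. -/
noncomputable def corner : Vec := tensorVec (Pi.single 0 1) (Pi.single 0 1)

lemma corner_eq : corner = Pi.single (0, 0) 1 := by
  ext ⟨i, j⟩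
  fin_cases i <;> fin_cases j <;> simp [corner, tensorVec]

lemma hasCornerKernel_iff {ρ : Op} : HasCornerKernel ρ ↔ ρ.mulVec corner = 0 := by
  rw [corner_eq, Matrix.mulVec_single_one]
  exact ⟨fun h => funext h, fun h i => congrFun h i⟩

/-- The first column of `U†` can be prescribed up to a factor. -/
lemma exists_unitary_mulVec {φ : Fin 2 → ℂ} (hφ : φ ≠ 0) : ∃ U ∈ Matrix.unitaryGroup (Fin 2) ℂ,
    ∃ c : ℂ, c ≠ 0 ∧ U.conjTranspose.mulVec (Pi.single 0 1) = c • φ := by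
  set t : ℝ := Complex.normSq (φ 0) + Complex.normSq (φ 1) with ht
  have ht0 : 0 < t := by
    refine lt_of_le_of_ne (add_nonneg (Complex.normSq_nonneg _) (Complex.normSq_nonneg _)) ?_
    intro h
    apply hφ
    have h0 := Complex.normSq_nonneg (φ 0)
    have h1 := Complex.normSq_nonneg (φ 1)
    have e0 : φ 0 = 0 := Complex.normSq_eq_zero.1 (by linarith)
    have e1 : φ 1 = 0 := Complex.normSq_eq_zero.1 (by linarith)
    ext i
    fin_cases i
    · exact e0
    · exact e1
  obtain ⟨s, hs, hs0⟩ : ∃ s : ℝ, s * s * t = 1 ∧ s ≠ 0 := by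
    refine ⟨(√t)⁻¹, ?_, by positivity⟩
    rw [← mul_inv, Real.mul_self_sqrt ht0.le, inv_mul_cancel₀ ht0.ne']
  have hs' : (s : ℂ) * s * (starRingEnd ℂ (φ 0) * φ 0 + starRingEnd ℂ (φ 1) * φ 1) = 1 := by
    rw [← Complex.normSq_eq_conj_mul_self, ← Complex.normSq_eq_conj_mul_self]
    exact_mod_cast hs
  refine ⟨!![s * starRingEnd ℂ (φ 0), s * starRingEnd ℂ (φ 1); -s * φ 1, s * φ 0], ?_, s,
    by exact_mod_cast hs0, ?_⟩
  · rw [Matrix.mem_unitaryGroup_iff, Matrix.star_eq_conjTranspose]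
    ext i j
    fin_cases i <;> fin_cases j <;> simp [Matrix.mul_apply, Fin.sum_univ_two]
    · linear_combination hs'
    · ring
    · ring
    · linear_combination hs'
  · ext i
    fin_cases i <;> simp [Matrix.mulVec, dotProduct, Fin.sum_univ_two]

lemma conjTranspose_mem_unitaryGroup {U : Op₁} (hU : U ∈ Matrix.unitaryGroup (Fin 2) ℂ) :
    U.conjTranspose ∈ Matrix.unitaryGroup (Fin 2) ℂ := Unitary.star_mem hU

lemma filtered_conjTranspose_filtered {U V : Op₁} (hU : U ∈ Matrix.unitaryGroup (Fin 2) ℂ)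
    (hV : V ∈ Matrix.unitaryGroup (Fin 2) ℂ) (ρ : Op) :
    filtered U.conjTranspose V.conjTranspose (filtered U V ρ) = ρ := by
  rw [filtered_filtered, ← Matrix.star_eq_conjTranspose, ← Matrix.star_eq_conjTranspose,
    Matrix.mem_unitaryGroup_iff'.1 hU, Matrix.mem_unitaryGroup_iff'.1 hV, filtered_one]

lemma trace_filtered_unitary {U V : Op₁} (hU : U ∈ Matrix.unitaryGroup (Fin 2) ℂ)
    (hV : V ∈ Matrix.unitaryGroup (Fin 2) ℂ) (ρ : Op) : (filtered U V ρ).trace = ρ.trace := by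
  rw [filtered, Matrix.trace_mul_comm, ← mul_assoc, kronecker_conjTranspose_mul_self hU hV, one_mul]

lemma localOp_unitary {U V : Op₁} (hU : U ∈ Matrix.unitaryGroup (Fin 2) ℂ)
    (hV : V ∈ Matrix.unitaryGroup (Fin 2) ℂ) {ρ : Op} (hρ : ρ.trace = 1) :
    localOp U V ρ = filtered U V ρ := by
  rw [localOp, trace_filtered_unitary hU hV, hρ, inv_one, one_smul]

lemma isUnit_det_of_unitary {U : Op₁} (hU : U ∈ Matrix.unitaryGroup (Fin 2) ℂ) : IsUnit U.det :=
  Matrix.isUnit_det_of_left_inverse (Matrix.mem_unitaryGroup_iff'.1 hU)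

lemma norm_det_of_unitary {U : Op₁} (hU : U ∈ Matrix.unitaryGroup (Fin 2) ℂ) : ‖U.det‖ = 1 :=
  CStarRing.norm_of_mem_unitary (Matrix.det_of_mem_unitary hU)

lemma filterRate_unitary {U V : Op₁} (hU : U ∈ Matrix.unitaryGroup (Fin 2) ℂ)
    (hV : V ∈ Matrix.unitaryGroup (Fin 2) ℂ) {ρ : Op} (hρ : ρ.trace = 1) :
    filterRate U V ρ = 1 := by
  rw [filterRate, trace_filtered_unitary hU hV, hρ, norm_mul, norm_det_of_unitary hU,
    norm_det_of_unitary hV]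
  simp

/-- A local unitary moves a product vector in the kernel to `|00⟩`. -/
lemma exists_unitary_hasCornerKernel {ρ : Op} {φ₁ φ₂ : Fin 2 → ℂ} (h₁ : φ₁ ≠ 0) (h₂ : φ₂ ≠ 0)
    (h : ρ.mulVec (tensorVec φ₁ φ₂) = 0) :
    ∃ U ∈ Matrix.unitaryGroup (Fin 2) ℂ, ∃ V ∈ Matrix.unitaryGroup (Fin 2) ℂ,
      HasCornerKernel (filtered U V ρ) := by
  obtain ⟨U, hU, c, -, hc⟩ := exists_unitary_mulVec h₁
  obtain ⟨V, hV, d, -, hd⟩ := exists_unitary_mulVec h₂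
  refine ⟨U, hU, V, hV, hasCornerKernel_iff.2 ?_⟩
  rw [filtered, ← Matrix.mulVec_mulVec, Matrix.conjTranspose_kronecker, corner,
    kronecker_mulVec_tensorVec, hc, hd, tensorVec_smul_smul, ← Matrix.mulVec_mulVec,
    Matrix.mulVec_smul, h, smul_zero, Matrix.mulVec_zero]

/-- Every line contains the image under `A` of some nonzero vector: if `A` is singular, a vector
with image zero. -/
lemma exists_mulVec_mem_span (A : Op₁) {φ : Fin 2 → ℂ} (hφ : φ ≠ 0) :
    ∃ u : Fin 2 → ℂ, u ≠ 0 ∧ ∃ c : ℂ, A.mulVec u = c • φ := by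
  by_cases hA : A.det = 0
  · obtain ⟨u, hu, h⟩ := Matrix.exists_mulVec_eq_zero_iff.2 hA
    exact ⟨u, hu, 0, by rw [h, zero_smul]⟩
  · refine ⟨A⁻¹.mulVec φ, fun h => hφ ?_, 1, ?_⟩
    · have := congrArg A.mulVec h
      rwa [Matrix.mulVec_mulVec, Matrix.mul_nonsing_inv _ (isUnit_iff_ne_zero.2 hA),
        Matrix.one_mulVec, Matrix.mulVec_zero] at this
    · rw [Matrix.mulVec_mulVec, Matrix.mul_nonsing_inv _ (isUnit_iff_ne_zero.2 hA),
        Matrix.one_mulVec, one_smul]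

/-- The kernel of `ρ` contains a nonzero product vector. -/
def HasProductKernel (ρ : Op) : Prop :=
  ∃ φ₁ φ₂ : Fin 2 → ℂ, φ₁ ≠ 0 ∧ φ₂ ≠ 0 ∧ ρ.mulVec (tensorVec φ₁ φ₂) = 0

lemma HasProductKernel.localOp {ρ : Op} (h : HasProductKernel ρ) (A B : Op₁) :
    HasProductKernel (localOp A B ρ) := by
  obtain ⟨φ₁, φ₂, h₁, h₂, h⟩ := h
  obtain ⟨u, hu, c, hc⟩ := exists_mulVec_mem_span A.conjTranspose h₁
  obtain ⟨v, hv, d, hd⟩ := exists_mulVec_mem_span B.conjTranspose h₂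
  refine ⟨u, v, hu, hv, ?_⟩
  rw [TwoQubit.localOp, Matrix.smul_mulVec, filtered, ← Matrix.mulVec_mulVec,
    Matrix.conjTranspose_kronecker, kronecker_mulVec_tensorVec, hc, hd, tensorVec_smul_smul,
    ← Matrix.mulVec_mulVec, Matrix.mulVec_smul, h, smul_zero, Matrix.mulVec_zero, smul_zero]

/-- The set is the projection of a closed set along the compact product of two unit spheres. -/
lemma isClosed_hasProductKernel : IsClosed {ρ : Op | HasProductKernel ρ} := by
  let S := Metric.sphere (0 : Fin 2 → ℂ) 1
  have hcl : IsClosed {p : (S × S) × Op | p.2.mulVec (tensorVec p.1.1 p.1.2) = 0} := by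
    refine isClosed_eq (continuous_snd.matrix_mulVec ?_) continuous_const
    refine continuous_pi fun i => ?_
    exact ((continuous_apply _).comp (continuous_subtype_val.comp
      (continuous_fst.comp continuous_fst))).mul ((continuous_apply _).comp
        (continuous_subtype_val.comp (continuous_snd.comp continuous_fst)))
  have h : {ρ : Op | HasProductKernel ρ} =
      Prod.snd '' {p : (S × S) × Op | p.2.mulVec (tensorVec p.1.1 p.1.2) = 0} := by
    ext ρ
    constructor
    · rintro ⟨u, v, hu, hv, h⟩
      refine ⟨((⟨((‖u‖⁻¹ : ℝ) : ℂ) • u, by simp [S, norm_smul, hu]⟩,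
        ⟨((‖v‖⁻¹ : ℝ) : ℂ) • v, by simp [S, norm_smul, hv]⟩), ρ), ?_, rfl⟩
      simp only [Set.mem_ofPred_eq, tensorVec_smul_smul, Matrix.mulVec_smul, h, smul_zero]
    · rintro ⟨⟨⟨⟨u, hu⟩, ⟨v, hv⟩⟩, ρ'⟩, h, rfl⟩
      refine ⟨u, v, ?_, ?_, h⟩ <;> rintro rfl <;> simp [S] at hu hv
  rw [h]
  exact isClosedMap_snd_of_compactSpace _ hcl

/-! ### Power sums of the eigenvalues of `ρ̃ρ` -/

/-- The first two power sums of the eigenvalues, in terms of their square roots. -/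
lemma trace_flip {ρ : Op} (hρ : ρ.PosSemidef) :
    (spinFlip ρ * ρ).trace = (((flipRoots ρ).map fun r => r ^ 2).sum : ℝ) ∧
    (spinFlip ρ * ρ * (spinFlip ρ * ρ)).trace = (((flipRoots ρ).map fun r => r ^ 4).sum : ℝ) := by
  obtain ⟨x, μ, -, hx⟩ := exists_isFlipOrthogonal hρ
  obtain ⟨P, Q, h1, h2⟩ := hx.exists_mul
  have h3 : P * Q * (P * Q) = P * (Q * P) * Q := by simp only [mul_assoc]
  rw [h1, h3, Matrix.trace_mul_comm, Matrix.trace_mul_comm _ Q, ← mul_assoc, h2,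
    Matrix.diagonal_mul_diagonal, Matrix.trace_diagonal, Matrix.trace_diagonal, hx.flipRoots_eq,
    Multiset.map_map, Multiset.map_map]
  constructor
  · rw [← Complex.ofReal_sum]; rfl
  · simp only [← Complex.ofReal_mul, ← Complex.ofReal_sum]
    congr 1
    change _ = ∑ i, ‖(μ i : ℂ)‖ ^ 4
    exact Finset.sum_congr rfl fun i _ => by ring

/-- The identity `(∑ νᵢ²)(∑ λᵢ)² = (∑ λᵢ²)(∑ νᵢ)²` between the eigenvalues `λᵢ` of `ρ̃ρ` and `νᵢ` of
`σ̃σ`, written with traces. It holds if the eigenvalues are proportional, and it passes to limits.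
Conversely, it determines the ratio of two eigenvalues when the other two vanish. -/
def FlipProportional (ρ σ : Op) : Prop :=
  (spinFlip σ * σ * (spinFlip σ * σ)).trace * (spinFlip ρ * ρ).trace ^ 2 =
    (spinFlip ρ * ρ * (spinFlip ρ * ρ)).trace * (spinFlip σ * σ).trace ^ 2

lemma flipProportional_iff {ρ σ : Op} (hρ : ρ.PosSemidef) (hσ : σ.PosSemidef) :
    FlipProportional ρ σ ↔
      ((flipRoots σ).map fun r => r ^ 4).sum * ((flipRoots ρ).map fun r => r ^ 2).sum ^ 2 =
        ((flipRoots ρ).map fun r => r ^ 4).sum * ((flipRoots σ).map fun r => r ^ 2).sum ^ 2 := by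
  rw [FlipProportional, (trace_flip hρ).1, (trace_flip hρ).2, (trace_flip hσ).1, (trace_flip hσ).2]
  norm_cast

lemma flipProportional_localOp {ρ : Op} (hρ : IsDensity ρ) {A B : Op₁}
    (h : (filtered A B ρ).trace ≠ 0) : FlipProportional ρ (localOp A B ρ) := by
  rw [flipProportional_iff hρ.1 (isDensity_localOp hρ.1 h).1, flipRoots_localOp hρ.1,
    Multiset.map_map, Multiset.map_map]
  simp only [Function.comp_def, mul_pow, Multiset.sum_map_mul_left]
  ring

lemma isClosed_flipProportional (ρ : Op) : IsClosed {σ : Op | FlipProportional ρ σ} := by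
  have hs : Continuous fun σ : Op => spinFlip σ * σ := by
    have h1 : Continuous fun σ : Op => σ.map (starRingEnd ℂ) :=
      continuous_id.matrix_map Complex.continuous_conj
    exact ((continuous_const.matrix_mul h1).matrix_mul continuous_const).matrix_mul continuous_id
  exact isClosed_eq ((hs.matrix_mul hs).matrix_trace.mul continuous_const)
    (continuous_const.mul (hs.matrix_trace.pow 2))

/-- If `ρ` and `σ` have `|00⟩` in their kernels, `ρ̃ρ` and `σ̃σ` have proportional eigenvalues, and
`σ` attains the bound `maxConcurrence ρ` on the concurrence, then the square roots of the
eigenvalues of `σ̃σ` add up to their largest possible value. -/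
lemma HasCornerKernel.rootSum_eq_one {ρ σ : Op} (hρ : IsDensity ρ) (h : HasCornerKernel ρ)
    (hf : ρ (0, 1) (1, 0) ≠ 0) (hlt : maxConcurrence ρ < 1) (hσ : IsDensity σ)
    (h' : HasCornerKernel σ) (hprop : FlipProportional ρ σ)
    (hmax : concurrence σ = maxConcurrence ρ) : rootSum σ = 1 := by
  have hm := midMean_pos hρ.1 hf
  have hf0 := norm_pos_iff.2 hf
  rw [h.maxConcurrence_eq hρ.1] at hmax hlt
  rw [h'.concurrence_eq hσ.1, eq_div_iff hm.ne'] at hmax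
  rw [div_lt_one hm] at hlt
  rw [flipProportional_iff hρ.1 hσ.1, h.flipRoots_eq hρ.1, h'.flipRoots_eq hσ.1] at hprop
  rw [h'.rootSum_eq hσ.1]
  have hle := norm_entry_le_midMean hσ.1
  generalize ‖ρ (0, 1) (1, 0)‖ = f at *
  generalize ‖σ (0, 1) (1, 0)‖ = g at *
  generalize midMean ρ = m at *
  generalize midMean σ = n at *
  have hg0 : 0 < g := by
    by_contra hg
    nlinarith
  have hn0 : 0 < n := hg0.trans_le hle
  simp only [Multiset.insert_eq_cons, Multiset.map_cons, Multiset.map_singleton,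
    Multiset.sum_cons, Multiset.sum_singleton] at hprop
  have h1 : (n * g * (m ^ 2 + f ^ 2)) ^ 2 = (m * f * (n ^ 2 + g ^ 2)) ^ 2 := by
    linear_combination hprop / 32
  have h2 : n * g * (m ^ 2 + f ^ 2) = m * f * (n ^ 2 + g ^ 2) :=
    (pow_left_inj₀ (by positivity) (by positivity) two_ne_zero).1 h1
  -- the first factor is positive, so the ratios `f / m` and `g / n` agree
  have h3 : (m * n - f * g) * (m * g - n * f) = 0 := by linear_combination h2
  have h4 : 0 < m * n - f * g := by nlinarith
  have h5 : m * g - n * f = 0 := by simpa [h4.ne'] using h3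
  have h6 : f * (2 * n) = f * 1 := by linear_combination hmax - 2 * h5
  exact mul_left_cancel₀ hf0.ne' h6

/-! ### Best distillation products of states with a product vector in the kernel -/

lemma flipEigenvalues_unitary {U V : Op₁} (hU : U ∈ Matrix.unitaryGroup (Fin 2) ℂ)
    (hV : V ∈ Matrix.unitaryGroup (Fin 2) ℂ) {ρ : Op} (hρ : IsDensity ρ) :
    flipEigenvalues (filtered U V ρ) = flipEigenvalues ρ := by
  rw [← localOp_unitary hU hV hρ.2, flipEigenvalues_localOp hρ.1, filterRate_unitary hU hV hρ.2]
  simp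

lemma isDensity_filtered_unitary {U V : Op₁} (hU : U ∈ Matrix.unitaryGroup (Fin 2) ℂ)
    (hV : V ∈ Matrix.unitaryGroup (Fin 2) ℂ) {ρ : Op} (hρ : IsDensity ρ) :
    IsDensity (filtered U V ρ) :=
  ⟨posSemidef_filtered hρ.1 _ _, by rw [trace_filtered_unitary hU hV, hρ.2]⟩

lemma localProducts_unitary {U V : Op₁} (hU : U ∈ Matrix.unitaryGroup (Fin 2) ℂ)
    (hV : V ∈ Matrix.unitaryGroup (Fin 2) ℂ) {ρ : Op} (hρ : IsDensity ρ) :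
    localProducts (filtered U V ρ) = localProducts ρ := by
  rw [← localOp_unitary hU hV hρ.2,
    localProducts_localOp hρ (isUnit_det_of_unitary hU) (isUnit_det_of_unitary hV)]

lemma flipRoots_congr {ρ σ : Op} (h : flipEigenvalues ρ = flipEigenvalues σ) :
    flipRoots ρ = flipRoots σ := by rw [flipRoots, h, flipRoots]

lemma concurrence_congr {ρ σ : Op} (h : flipEigenvalues ρ = flipEigenvalues σ) :
    concurrence ρ = concurrence σ := by
  rw [concurrence, rootSum, flipRoots_congr h, concurrence, rootSum]

lemma maxConcurrence_congr {ρ σ : Op} (h : flipEigenvalues ρ = flipEigenvalues σ) :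
    maxConcurrence ρ = maxConcurrence σ := by
  rw [maxConcurrence, concurrence_congr h, rootSum, flipRoots_congr h, maxConcurrence, rootSum]

lemma maxEntanglement_congr {ρ σ : Op} (h : localProducts ρ = localProducts σ) :
    maxEntanglement ρ = maxEntanglement σ := by rw [maxEntanglement, h, maxEntanglement]

/-- The normal form of a state with a product vector in its kernel. -/
lemma HasProductKernel.exists_normalForm {ρ : Op} (hρ : IsDensity ρ) (h : HasProductKernel ρ) :
    ∃ U ∈ Matrix.unitaryGroup (Fin 2) ℂ, ∃ V ∈ Matrix.unitaryGroup (Fin 2) ℂ, ∃ ρ₁ : Op,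
      ρ₁ = filtered U V ρ ∧ IsDensity ρ₁ ∧ HasCornerKernel ρ₁ ∧
      flipEigenvalues ρ₁ = flipEigenvalues ρ ∧ localProducts ρ₁ = localProducts ρ := by
  obtain ⟨φ₁, φ₂, h₁, h₂, h⟩ := h
  obtain ⟨U, hU, V, hV, hc⟩ := exists_unitary_hasCornerKernel h₁ h₂ h
  exact ⟨U, hU, V, hV, _, rfl, isDensity_filtered_unitary hU hV hρ, hc,
    flipEigenvalues_unitary hU hV hρ, localProducts_unitary hU hV hρ⟩

lemma HasCornerKernel.entry_ne_zero {ρ : Op} (hρ : IsDensity ρ) (h : HasCornerKernel ρ)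
    (hC : 0 < concurrence ρ) : ρ (0, 1) (1, 0) ≠ 0 := by
  rw [h.concurrence_eq hρ.1] at hC
  exact norm_pos_iff.1 (by linarith)

lemma isDensity_of_mem_localProducts {ρ τ : Op} (hρ : ρ.PosSemidef) (h : τ ∈ localProducts ρ) :
    IsDensity τ := by
  obtain ⟨A, B, h, rfl⟩ := h
  exact isDensity_localOp hρ h

lemma HasProductKernel.maxEntanglement_eq {ρ : Op} (hρ : IsDensity ρ) (h : HasProductKernel ρ)
    (hC : 0 < concurrence ρ) : maxEntanglement ρ = entFn (maxConcurrence ρ) := by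
  obtain ⟨U, hU, V, hV, ρ₁, -, hρ₁, hc, he, hl⟩ := h.exists_normalForm hρ
  rw [← concurrence_congr he] at hC
  rw [← maxEntanglement_congr hl, ← maxConcurrence_congr he]
  exact hc.maxEntanglement_eq hρ₁ (hc.entry_ne_zero hρ₁ hC)

lemma HasProductKernel.exists_bellDiagonal {ρ : Op} (hρ : IsDensity ρ) (h : HasProductKernel ρ)
    (hC : 0 < concurrence ρ) : ∃ σ, IsBestDistillationProduct ρ σ ∧ IsBellDiagonal σ := by
  have hM := h.maxEntanglement_eq hρ hC
  obtain ⟨U, hU, V, hV, ρ₁, -, hρ₁, hc, he, hl⟩ := h.exists_normalForm hρ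
  rw [← concurrence_congr he] at hC
  have hf := hc.entry_ne_zero hρ₁ hC
  obtain ⟨τ, hτ, hlim⟩ := hc.exists_tendsto_bellBlock hρ₁ hf
  have hm := midMean_pos hρ₁.1 hf
  refine ⟨_, ⟨⟨τ, fun n => hl ▸ (hτ n).1, hlim⟩, ?_⟩, isBellDiagonal_bellBlock _⟩
  have hd : IsDensity (bellBlock (ρ₁ (0, 1) (1, 0) / (2 * midMean ρ₁))) :=
    isClosed_isDensity.mem_of_tendsto hlim
      (.of_forall fun n => isDensity_of_mem_localProducts hρ₁.1 (hτ n).1)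
  rw [(bellBlock_hasCornerKernel _).entanglementOfFormation_eq hd, hM, ← maxConcurrence_congr he,
    hc.maxConcurrence_eq hρ₁.1, bellBlock_apply]
  congr 1
  simp [abs_of_pos hm]
  field_simp

/-- The structure of the best distillation products. A limit `σ` of local products of `ρ` inherits
a product vector in the kernel and the proportions of the eigenvalues of `ρ̃ρ`; optimality then
fixes the remaining parameters. -/
lemma HasProductKernel.exists_eq_bellBlock {ρ : Op} (hρ : IsDensity ρ) (h : HasProductKernel ρ)
    (hC : 0 < concurrence ρ) (hlt : maxConcurrence ρ < 1) {σ : Op}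
    (hσ : IsBestDistillationProduct ρ σ) :
    ∃ U ∈ Matrix.unitaryGroup (Fin 2) ℂ, ∃ V ∈ Matrix.unitaryGroup (Fin 2) ℂ, ∃ f : ℂ,
      σ = filtered U V (bellBlock f) ∧ 2 * ‖f‖ = maxConcurrence ρ := by
  obtain ⟨⟨τ, hτ, hlim⟩, hEF⟩ := hσ
  have hσd : IsDensity σ := isClosed_isDensity.mem_of_tendsto hlim
    (.of_forall fun n => isDensity_of_mem_localProducts hρ.1 (hτ n))
  have hσk : HasProductKernel σ := isClosed_hasProductKernel.mem_of_tendsto hlim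
    (.of_forall fun n => by obtain ⟨A, B, -, e⟩ := hτ n; exact e ▸ h.localOp A B)
  have hprop : FlipProportional ρ σ := (isClosed_flipProportional ρ).mem_of_tendsto hlim
    (.of_forall fun n => by
      obtain ⟨A, B, hAB, e⟩ := hτ n
      exact e ▸ flipProportional_localOp hρ hAB)
  rw [h.maxEntanglement_eq hρ hC] at hEF
  have hM := maxConcurrence_mem hρ.1 hC
  obtain ⟨U, hU, V, hV, ρ₁, -, hρ₁, hc, he, hl⟩ := h.exists_normalForm hρ
  obtain ⟨U', hU', V', hV', σ₁, hσ₁', hσ₁, hc', he', -⟩ := hσk.exists_normalForm hσd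
  have hσ0 : 0 ≤ concurrence σ := by
    rw [← concurrence_congr he', hc'.concurrence_eq hσ₁.1]; positivity
  have hσ1 : concurrence σ ≤ 1 := (concurrence_le_rootSum hσd.1).trans (rootSum_le_one hσd)
  rw [entanglementOfFormation_eq hσd hσ0] at hEF
  have hCσ : concurrence σ = maxConcurrence ρ := entFn_strictMonoOn.injOn ⟨hσ0, hσ1⟩ hM hEF
  have hprop₁ : FlipProportional ρ₁ σ₁ := by
    rw [flipProportional_iff hρ₁.1 hσ₁.1, flipRoots_congr he, flipRoots_congr he',
      ← flipProportional_iff hρ.1 hσd.1]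
    exact hprop
  rw [← concurrence_congr he] at hC
  have h1 := hc.rootSum_eq_one hρ₁ (hc.entry_ne_zero hρ₁ hC)
    (by rwa [maxConcurrence_congr he]) hσ₁ hc' hprop₁
    (by rw [concurrence_congr he', maxConcurrence_congr he, hCσ])
  refine ⟨_, conjTranspose_mem_unitaryGroup hU', _, conjTranspose_mem_unitaryGroup hV',
    σ₁ (0, 1) (1, 0), ?_, ?_⟩
  · rw [← hc'.eq_bellBlock hσ₁ h1, hσ₁', filtered_conjTranspose_filtered hU' hV']
  · rw [← hCσ, ← concurrence_congr he', hc'.concurrence_eq hσ₁.1]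

/-! ### When the supremum is attained -/

section Attained

variable {ρ : Op}

/-- A local product at which `rootSum` takes its largest possible value is optimal. -/
lemma exists_attained_of_rootSum_eq_one (hρ : IsDensity ρ) (hC : 0 < concurrence ρ) {τ : Op}
    (hτ : τ ∈ localProducts ρ) (h1 : rootSum τ = 1) :
    ∃ τ ∈ localProducts ρ, entanglementOfFormation τ = maxEntanglement ρ := by
  refine ⟨τ, hτ, le_antisymm (le_maxEntanglement hρ.1 hC hτ) ?_⟩
  obtain ⟨A, B, hAB, rfl⟩ := hτ
  rw [entanglementOfFormation_localOp hρ.1 hC.le hAB, filterRate_mul_concurrence hρ.1 hC, h1,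
    one_mul]
  exact maxEntanglement_le hρ.1 hC hρ.2

lemma exists_attained_of_isMax_filterRate (hρ : IsDensity ρ) (hC : 0 < concurrence ρ) {A₀ B₀ : Op₁}
    (h₀ : (filtered A₀ B₀ ρ).trace ≠ 0) (hmax : ∀ A B, (filtered A B ρ).trace ≠ 0 →
      filterRate A B ρ ≤ filterRate A₀ B₀ ρ) :
    ∃ τ ∈ localProducts ρ, entanglementOfFormation τ = maxEntanglement ρ := by
  refine ⟨localOp A₀ B₀ ρ, ⟨A₀, B₀, h₀, rfl⟩,
    le_antisymm (le_maxEntanglement hρ.1 hC ⟨A₀, B₀, h₀, rfl⟩)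
      (csSup_le ⟨_, _, self_mem_localProducts hρ.2, rfl⟩ ?_)⟩
  have hmem : ∀ A B, (filtered A B ρ).trace ≠ 0 →
      filterRate A B ρ * concurrence ρ ∈ Set.Icc (0 : ℝ) 1 := by
    intro A B h
    refine ⟨mul_nonneg (filterRate_nonneg hρ.1 A B) hC.le, ?_⟩
    rw [← concurrence_localOp hρ.1]
    have := isDensity_localOp hρ.1 h
    exact (concurrence_le_rootSum this.1).trans (rootSum_le_one this)
  rintro _ ⟨_, ⟨A, B, h, rfl⟩, rfl⟩
  rw [entanglementOfFormation_localOp hρ.1 hC.le h, entanglementOfFormation_localOp hρ.1 hC.le h₀]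
  exact entFn_strictMonoOn.monotoneOn (hmem A B h) (hmem A₀ B₀ h₀)
    (mul_le_mul_of_nonneg_right (hmax A B h) hC.le)

lemma filtered_smul_smul (s t : ℝ) (A B : Op₁) : filtered ((s : ℂ) • A) ((t : ℂ) • B) ρ =
    ((s ^ 2 * t ^ 2 : ℝ) : ℂ) • filtered A B ρ := by
  simp only [filtered, Matrix.smul_kronecker, Matrix.kronecker_smul, Matrix.conjTranspose_smul,
    Matrix.smul_mul, Matrix.mul_smul, smul_smul, Complex.star_def]
  congr 1
  simp only [map_mul, Complex.conj_ofReal]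
  push_cast
  ring

lemma filterRate_smul_smul {s t : ℝ} (hs : s ≠ 0) (ht : t ≠ 0) (A B : Op₁) :
    filterRate ((s : ℂ) • A) ((t : ℂ) • B) ρ = filterRate A B ρ := by
  rw [filterRate, filtered_smul_smul, Matrix.trace_smul, smul_eq_mul, Complex.re_ofReal_mul,
    Matrix.det_smul, Matrix.det_smul, filterRate]
  simp only [Fintype.card_fin, norm_mul, norm_pow, Complex.norm_real, Real.norm_eq_abs, sq_abs]
  rw [← mul_div_mul_left (‖A.det‖ * ‖B.det‖) _ (show s ^ 2 * t ^ 2 ≠ 0 by positivity)]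
  ring

/-- A filter that annihilates `ρ` satisfies `ρ (A ⊗ B)† = 0`, and the range of `(A ⊗ B)†` contains
nonzero product vectors. -/
lemma trace_filtered_ne_zero_of_not_hasProductKernel (hρ : ρ.PosSemidef) (h : ¬ HasProductKernel ρ)
    {A B : Op₁} (hA : A ≠ 0) (hB : B ≠ 0) : (filtered A B ρ).trace ≠ 0 := by
  intro h0
  apply h
  rw [(posSemidef_filtered hρ A B).trace_eq_zero_iff] at h0
  obtain ⟨M, hM⟩ := exists_eq_mul_conjTranspose hρ
  have h1 : ((A ⊗ₖ B) * M) * ((A ⊗ₖ B) * M).conjTranspose = 0 := by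
    rw [← h0, filtered, hM, Matrix.conjTranspose_mul]
    simp only [mul_assoc]
  have h2 := Matrix.self_mul_conjTranspose_eq_zero.1 h1
  have h3 : ρ * (A ⊗ₖ B).conjTranspose = 0 := by
    rw [hM, mul_assoc, ← Matrix.conjTranspose_mul, h2, Matrix.conjTranspose_zero, mul_zero]
  have hne : ∀ {A : Op₁}, A ≠ 0 → ∃ u, A.conjTranspose.mulVec u ≠ 0 := by
    intro A hA
    by_contra! hu
    apply hA
    rw [← Matrix.conjTranspose_eq_zero]
    exact Matrix.ext_of_mulVec_single fun i => by rw [hu, Matrix.zero_mulVec]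
  obtain ⟨u, hu⟩ := hne hA
  obtain ⟨v, hv⟩ := hne hB
  refine ⟨_, _, hu, hv, ?_⟩
  rw [← kronecker_mulVec_tensorVec, ← Matrix.conjTranspose_kronecker, Matrix.mulVec_mulVec, h3,
    Matrix.zero_mulVec]

attribute [local instance] Matrix.normedAddCommGroup Matrix.normedSpace in
/-- By homogeneity the filters may be taken from a compact set, on which the rate is continuous as
long as no filter annihilates the state. -/
lemma exists_attained_of_not_hasProductKernel (hρ : IsDensity ρ) (hC : 0 < concurrence ρ)
    (h : ¬ HasProductKernel ρ) :
    ∃ τ ∈ localProducts ρ, entanglementOfFormation τ = maxEntanglement ρ := by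
  have hN : ∀ {A B : Op₁}, A ≠ 0 → B ≠ 0 → (filtered A B ρ).trace ≠ 0 :=
    fun hA hB => trace_filtered_ne_zero_of_not_hasProductKernel hρ.1 h hA hB
  let S : Set Op₁ := Metric.sphere 0 1
  have : ProperSpace Op₁ := FiniteDimensional.proper ℂ Op₁
  have hS : IsCompact (S ×ˢ S) := (isCompact_sphere 0 1).prod (isCompact_sphere 0 1)
  have hS0 : ∀ {A : Op₁}, A ∈ S → A ≠ 0 := by
    rintro A hA rfl
    simp [S] at hA
  have hnorm : ∀ {A : Op₁}, A ≠ 0 → ((‖A‖⁻¹ : ℝ) : ℂ) • A ∈ S := by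
    intro A hA
    simp [S, norm_smul, hA]
  have hne : (S ×ˢ S).Nonempty :=
    ⟨(_, _), hnorm (one_ne_zero (α := Op₁)), hnorm (one_ne_zero (α := Op₁))⟩
  have hcont : ContinuousOn (fun p : Op₁ × Op₁ => filterRate p.1 p.2 ρ) (S ×ˢ S) := by
    have hk : Continuous fun p : Op₁ × Op₁ => p.1 ⊗ₖ p.2 := continuous_matrix fun i j =>
      (continuous_fst.matrix_elem _ _).mul (continuous_snd.matrix_elem _ _)
    have hf : Continuous fun p : Op₁ × Op₁ => (filtered p.1 p.2 ρ).trace.re :=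
      Complex.continuous_re.comp
        ((hk.matrix_mul continuous_const).matrix_mul hk.matrix_conjTranspose).matrix_trace
    have hd : Continuous fun p : Op₁ × Op₁ => ‖p.1.det * p.2.det‖ :=
      (continuous_fst.matrix_det.mul continuous_snd.matrix_det).norm
    exact hd.continuousOn.div hf.continuousOn fun p hp =>
      (trace_filtered_pos hρ.1 (hN (hS0 hp.1) (hS0 hp.2))).ne'
  obtain ⟨⟨A₀, B₀⟩, h₀, hmax⟩ := hS.exists_isMaxOn hne hcont
  refine exists_attained_of_isMax_filterRate hρ hC (hN (hS0 h₀.1) (hS0 h₀.2)) fun A B hAB => ?_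
  have hA : A ≠ 0 := by rintro rfl; simp [filtered] at hAB
  have hB : B ≠ 0 := by rintro rfl; simp [filtered] at hAB
  have := hmax (show (((‖A‖⁻¹ : ℝ) : ℂ) • A, ((‖B‖⁻¹ : ℝ) : ℂ) • B) ∈ S ×ˢ S from
    ⟨hnorm hA, hnorm hB⟩)
  simp only [Set.mem_ofPred_eq] at this
  rwa [filterRate_smul_smul (by simpa using hA) (by simpa using hB)] at this

/-- If the kernel of `ρ` contains `|00⟩` and `|11⟩`, a diagonal filter makes `ρ` optimal. -/
lemma HasCornerKernel.exists_attained_of_column_zero (hρ : IsDensity ρ) (h : HasCornerKernel ρ)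
    (hC : 0 < concurrence ρ) (h11 : ∀ i, ρ i (1, 1) = 0) :
    ∃ τ ∈ localProducts ρ, entanglementOfFormation τ = maxEntanglement ρ := by
  have hf := h.entry_ne_zero hρ hC
  have hm := midMean_pos hρ.1 hf
  have hm2 := midMean_sq hρ.1
  obtain ⟨ha, ha0⟩ := diag_eq_re hρ.1 (0, 1)
  obtain ⟨hb, hb0⟩ := diag_eq_re hρ.1 (1, 0)
  set a := (ρ (0, 1) (0, 1)).re
  set b := (ρ (1, 0) (1, 0)).re
  have hab : 0 < a * b := by rw [← hm2]; positivity
  have hsa : √a * √a = a := Real.mul_self_sqrt ha0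
  have hsb : √b * √b = b := Real.mul_self_sqrt hb0
  set A : Op₁ := Matrix.diagonal fun k => ((![√b, √a] k : ℝ) : ℂ)
  set B : Op₁ := Matrix.diagonal fun k => ((![1, 1] k : ℝ) : ℂ)
  have hent := filtered_diagonal ![√b, √a] ![1, 1] ρ
  have e1 : filtered A B ρ (0, 1) (0, 1) = ((a * b : ℝ) : ℂ) := by
    rw [hent, ha, ← Complex.ofReal_mul]
    simp [hsb, mul_comm]
  have e2 : filtered A B ρ (1, 0) (1, 0) = ((a * b : ℝ) : ℂ) := by
    rw [hent, hb, ← Complex.ofReal_mul]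
    simp [hsa]
  have htr : (filtered A B ρ).trace = ((2 * (a * b) : ℝ) : ℂ) := by
    simp only [Matrix.trace, Fintype.sum_prod_type, Fin.sum_univ_two, Matrix.diag_apply, e1, e2]
    rw [hent (0, 0), hent (1, 1), h, h11]
    push_cast
    ring
  have htr0 : (filtered A B ρ).trace ≠ 0 := by
    rw [htr, Complex.ofReal_ne_zero]; positivity
  have hd := isDensity_localOp hρ.1 htr0
  have hc : HasCornerKernel (localOp A B ρ) := fun i => by
    rw [localOp, Matrix.smul_apply, hent, h, mul_zero, smul_zero]
  have half : ∀ i, filtered A B ρ i i = ((a * b : ℝ) : ℂ) → (localOp A B ρ i i).re = 1 / 2 := by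
    intro i hi
    rw [localOp, Matrix.smul_apply, hi, htr, smul_eq_mul, ← Complex.ofReal_inv,
      ← Complex.ofReal_mul, Complex.ofReal_re, mul_inv, inv_mul_cancel_right₀ hab.ne']
    norm_num
  refine exists_attained_of_rootSum_eq_one hρ hC ⟨A, B, htr0, rfl⟩ ?_
  rw [hc.rootSum_eq hd.1, midMean, half _ e1, half _ e2,
    Real.sqrt_mul_self (by norm_num)]
  norm_num

end Attained

/-! ### The kernel of an incompletely quasi-distillable state -/

/-- If the kernel of `ρ` contains, besides `|00⟩`, a vector with nonzero `|11⟩` component, it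
contains a product vector `(p|0⟩ + |1⟩) ⊗ (q|0⟩ + |1⟩)`, which a triangular filter moves to
`|11⟩`. -/
lemma HasCornerKernel.exists_attained_of_mulVec_eq_zero {ρ : Op} (hρ : IsDensity ρ)
    (h : HasCornerKernel ρ) (hC : 0 < concurrence ρ) {w : Vec} (hw : ρ.mulVec w = 0)
    (hw1 : w (1, 1) = 1) :
    ∃ τ ∈ localProducts ρ, entanglementOfFormation τ = maxEntanglement ρ := by
  set p := w (0, 1)
  set q := w (1, 0)
  set A : Op₁ := !![1, 0; starRingEnd ℂ p, 1]
  set B : Op₁ := !![1, 0; starRingEnd ℂ q, 1]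
  have hA' : A.conjTranspose = !![1, p; 0, 1] := by
    ext i j; fin_cases i <;> fin_cases j <;> simp [A]
  have hB' : B.conjTranspose = !![1, q; 0, 1] := by
    ext i j; fin_cases i <;> fin_cases j <;> simp [B]
  have hA : IsUnit A.det := by simp [A, Matrix.det_fin_two]
  have hB : IsUnit B.det := by simp [B, Matrix.det_fin_two]
  have hN := trace_filtered_ne_zero_of_isUnit hρ hA hB
  set ρ₁ := localOp A B ρ with hρ₁
  have hd : IsDensity ρ₁ := isDensity_localOp hρ.1 hN
  have hl : localProducts ρ₁ = localProducts ρ := localProducts_localOp hρ hA hB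
  have hker : ∀ u v : Fin 2 → ℂ, ρ.mulVec (tensorVec (A.conjTranspose.mulVec u)
      (B.conjTranspose.mulVec v)) = 0 → ρ₁.mulVec (tensorVec u v) = 0 := by
    intro u v huv
    rw [hρ₁, localOp, Matrix.smul_mulVec, filtered, ← Matrix.mulVec_mulVec,
      Matrix.conjTranspose_kronecker, kronecker_mulVec_tensorVec, ← Matrix.mulVec_mulVec, huv,
      Matrix.mulVec_zero, smul_zero]
  have hc : HasCornerKernel ρ₁ := by
    rw [hasCornerKernel_iff]
    apply hker
    have e1 : A.conjTranspose.mulVec (Pi.single 0 1) = Pi.single 0 1 := by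
      rw [hA']; ext i; fin_cases i <;> simp
    have e2 : B.conjTranspose.mulVec (Pi.single 0 1) = Pi.single 0 1 := by
      rw [hB']; ext i; fin_cases i <;> simp
    rw [e1, e2]
    exact hasCornerKernel_iff.1 h
  have h11 : ∀ i, ρ₁ i (1, 1) = 0 := by
    have e0 : tensorVec (Pi.single 1 1) (Pi.single 1 1) = Pi.single (1, 1) 1 := by
      ext ⟨i, j⟩
      fin_cases i <;> fin_cases j <;> simp [tensorVec]
    have e1 : tensorVec (A.conjTranspose.mulVec (Pi.single 1 1))
        (B.conjTranspose.mulVec (Pi.single 1 1)) = w + (p * q - w (0, 0)) • corner := by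
      rw [hA', hB', corner_eq]
      ext ⟨i, j⟩
      fin_cases i <;> fin_cases j <;> simp [tensorVec, hw1, p, q]
    have := hker _ _ (by rw [e1, Matrix.mulVec_add, hw, Matrix.mulVec_smul,
      hasCornerKernel_iff.1 h, smul_zero, add_zero])
    rw [e0, Matrix.mulVec_single_one] at this
    exact congrFun this
  have hC₁ : 0 < concurrence ρ₁ := by
    rw [hρ₁, concurrence_localOp hρ.1]
    refine mul_pos (div_pos ?_ (trace_filtered_pos hρ.1 hN)) hC
    exact norm_pos_iff.2 (mul_ne_zero hA.ne_zero hB.ne_zero)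
  rw [← hl, ← maxEntanglement_congr hl]
  exact hc.exists_attained_of_column_zero hd hC₁ h11

/-- The kernel has no vector with nonzero `|11⟩` component, and on the span of `|01⟩` and `|10⟩` the
state has the determinant `ρ₀₁,₀₁ ρ₁₀,₁₀ - |ρ₀₁,₁₀|² ≠ 0`. -/
lemma HasCornerKernel.ker_eq_of_not_attained {ρ : Op} (hρ : IsDensity ρ)
    (h : HasCornerKernel ρ) (hC : 0 < concurrence ρ) (hlt : maxConcurrence ρ < 1)
    (hna : ¬ ∃ τ ∈ localProducts ρ, entanglementOfFormation τ = maxEntanglement ρ)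
    {w : Vec} (hw : ρ.mulVec w = 0) : w = w (0, 0) • corner := by
  have hw11 : w (1, 1) = 0 := by
    by_contra h1
    apply hna
    refine h.exists_attained_of_mulVec_eq_zero hρ hC (w := (w (1, 1))⁻¹ • w) ?_ ?_
    · rw [Matrix.mulVec_smul, hw, smul_zero]
    · simp [h1]
  have hf := h.entry_ne_zero hρ hC
  have hm := midMean_pos hρ.1 hf
  rw [h.maxConcurrence_eq hρ.1, div_lt_one hm] at hlt
  have hm2 := midMean_sq hρ.1
  have hji : ρ (1, 0) (0, 1) = starRingEnd ℂ (ρ (0, 1) (1, 0)) := (hρ.1.1.apply _ _).symm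
  have ha := (diag_eq_re hρ.1 (0, 1)).1
  have hb := (diag_eq_re hρ.1 (1, 0)).1
  have r1 := congrFun hw (0, 1)
  have r2 := congrFun hw (1, 0)
  simp only [Matrix.mulVec, dotProduct, Fintype.sum_prod_type, Fin.sum_univ_two, h _, hw11,
    Pi.zero_apply, hji] at r1 r2
  rw [ha] at r1
  rw [hb] at r2
  have hdet : ((midMean ρ ^ 2 - ‖ρ (0, 1) (1, 0)‖ ^ 2 : ℝ) : ℂ) ≠ 0 := by
    rw [Complex.ofReal_ne_zero]
    have := norm_nonneg (ρ (0, 1) (1, 0))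
    nlinarith
  have hdet' : ((midMean ρ ^ 2 - ‖ρ (0, 1) (1, 0)‖ ^ 2 : ℝ) : ℂ) =
      (ρ (0, 1) (0, 1)).re * (ρ (1, 0) (1, 0)).re -
        starRingEnd ℂ (ρ (0, 1) (1, 0)) * ρ (0, 1) (1, 0) := by
    rw [hm2, ← Complex.normSq_eq_norm_sq, ← Complex.normSq_eq_conj_mul_self]
    push_cast
    ring
  rw [hdet'] at hdet
  have h01 : w (0, 1) = 0 := by
    refine (mul_eq_zero.1 (?_ : _ * w (0, 1) = 0)).resolve_left hdet
    linear_combination ((ρ (1, 0) (1, 0)).re : ℂ) * r1 - ρ (0, 1) (1, 0) * r2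
  have h10 : w (1, 0) = 0 := by
    refine (mul_eq_zero.1 (?_ : _ * w (1, 0) = 0)).resolve_left hdet
    linear_combination ((ρ (0, 1) (0, 1)).re : ℂ) * r2 - starRingEnd ℂ (ρ (0, 1) (1, 0)) * r1
  rw [corner_eq]
  ext ⟨i, j⟩
  fin_cases i <;> fin_cases j <;> simp [h01, h10, hw11]

lemma kronecker_mul_conjTranspose_self {U V : Op₁} (hU : U ∈ Matrix.unitaryGroup (Fin 2) ℂ)
    (hV : V ∈ Matrix.unitaryGroup (Fin 2) ℂ) : (U ⊗ₖ V) * (U ⊗ₖ V).conjTranspose = 1 :=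
  mul_eq_one_comm.1 (kronecker_conjTranspose_mul_self hU hV)

lemma filtered_mulVec_kronecker {U V : Op₁} (hU : U ∈ Matrix.unitaryGroup (Fin 2) ℂ)
    (hV : V ∈ Matrix.unitaryGroup (Fin 2) ℂ) (ρ : Op) (w : Vec) :
    (filtered U V ρ).mulVec ((U ⊗ₖ V).mulVec w) = (U ⊗ₖ V).mulVec (ρ.mulVec w) := by
  rw [filtered, Matrix.mulVec_mulVec, mul_assoc, kronecker_conjTranspose_mul_self hU hV, mul_one,
    Matrix.mulVec_mulVec]

theorem kernelSpannedByProductVector_of_isIncompletelyQuasiDistillable {ρ : Op}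
    (hρ : IsDensity ρ) (hC : 0 < concurrence ρ) (h : IsIncompletelyQuasiDistillable ρ) :
    KernelSpannedByProductVector ρ := by
  obtain ⟨hM, hna, -⟩ := h
  have hk : HasProductKernel ρ := by
    by_contra hk
    exact hna (exists_attained_of_not_hasProductKernel hρ hC hk)
  have hmax := maxConcurrence_mem hρ.1 hC
  have hlt : maxConcurrence ρ < 1 := by
    refine lt_of_le_of_ne hmax.2 fun h1 => hM.ne ?_
    rw [hk.maxEntanglement_eq hρ hC, h1, entFn_one]
  obtain ⟨U, hU, V, hV, ρ₁, hρ₁, hd, hc, he, hl⟩ := hk.exists_normalForm hρ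
  rw [← hl, ← maxEntanglement_congr hl] at hna
  rw [← concurrence_congr he] at hC
  rw [← maxConcurrence_congr he] at hlt
  have hcor : (U ⊗ₖ V).conjTranspose.mulVec corner =
      tensorVec (U.conjTranspose.mulVec (Pi.single 0 1))
        (V.conjTranspose.mulVec (Pi.single 0 1)) := by
    rw [Matrix.conjTranspose_kronecker, corner, kronecker_mulVec_tensorVec]
  have hne : ∀ {U : Op₁}, U ∈ Matrix.unitaryGroup (Fin 2) ℂ →
      U.conjTranspose.mulVec (Pi.single 0 1) ≠ 0 := by
    intro U hU h0
    have h1 := congrArg U.mulVec h0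
    rw [Matrix.mulVec_mulVec, ← Matrix.star_eq_conjTranspose, Matrix.mem_unitaryGroup_iff.1 hU,
      Matrix.one_mulVec, Matrix.mulVec_zero] at h1
    simpa using congrFun h1 0
  refine ⟨_, _, hne hU, hne hV, le_antisymm ?_ ?_⟩
  · intro w hw
    rw [LinearMap.mem_ker, Matrix.toLin'_apply] at hw
    have h1 := hc.ker_eq_of_not_attained hd hC hlt hna (w := (U ⊗ₖ V).mulVec w)
      (by rw [hρ₁, filtered_mulVec_kronecker hU hV, hw, Matrix.mulVec_zero])
    have h2 := congrArg (U ⊗ₖ V).conjTranspose.mulVec h1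
    rw [Matrix.mulVec_mulVec, kronecker_conjTranspose_mul_self hU hV, Matrix.one_mulVec,
      Matrix.mulVec_smul, hcor] at h2
    rw [h2]
    exact Submodule.smul_mem _ _ (Submodule.mem_span_singleton_self _)
  · rw [Submodule.span_singleton_le_iff_mem, LinearMap.mem_ker, Matrix.toLin'_apply, ← hcor]
    have h1 := filtered_mulVec_kronecker hU hV ρ ((U ⊗ₖ V).conjTranspose.mulVec corner)
    rw [Matrix.mulVec_mulVec _ (U ⊗ₖ V), kronecker_mul_conjTranspose_self hU hV,
      Matrix.one_mulVec, ← hρ₁, hasCornerKernel_iff.1 hc] at h1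
    have h2 := congrArg (U ⊗ₖ V).conjTranspose.mulVec h1.symm
    rwa [Matrix.mulVec_mulVec, kronecker_conjTranspose_mul_self hU hV, Matrix.one_mulVec,
      Matrix.mulVec_zero] at h2

/-! ### States whose kernel is spanned by a product vector -/

lemma KernelSpannedByProductVector.hasProductKernel {ρ : Op}
    (h : KernelSpannedByProductVector ρ) : HasProductKernel ρ := by
  obtain ⟨φ₁, φ₂, h₁, h₂, hk⟩ := h
  refine ⟨φ₁, φ₂, h₁, h₂, ?_⟩
  rw [← Matrix.toLin'_apply, ← LinearMap.mem_ker, hk]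
  exact Submodule.mem_span_singleton_self _

lemma tensorVec_ne_zero {u v : Fin 2 → ℂ} (hu : u ≠ 0) (hv : v ≠ 0) : tensorVec u v ≠ 0 := by
  obtain ⟨i, hi⟩ := Function.ne_iff.1 hu
  obtain ⟨j, hj⟩ := Function.ne_iff.1 hv
  exact fun h => mul_ne_zero hi hj (congrFun h (i, j))

lemma KernelSpannedByProductVector.rank_eq {ρ : Op} (h : KernelSpannedByProductVector ρ) :
    ρ.rank = 3 := by
  obtain ⟨φ₁, φ₂, h₁, h₂, hk⟩ := h
  have h1 := LinearMap.finrank_range_add_finrank_ker (Matrix.toLin' ρ)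
  rw [hk, finrank_span_singleton (tensorVec_ne_zero h₁ h₂)] at h1
  have h2 : ρ.rank = Module.finrank ℂ (LinearMap.range (Matrix.toLin' ρ)) := rfl
  simp at h1
  omega

lemma rank_filtered {ρ : Op} {A B : Op₁} (hA : IsUnit A.det) (hB : IsUnit B.det) :
    (filtered A B ρ).rank = ρ.rank := by
  have h : IsUnit (A ⊗ₖ B).det := by
    rw [Matrix.det_kronecker]
    exact (hA.pow _).mul (hB.pow _)
  have h' : IsUnit (A ⊗ₖ B).conjTranspose.det := by
    rw [Matrix.det_conjTranspose]
    exact h.star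
  rw [filtered, Matrix.rank_mul_eq_left_of_isUnit_det _ _ h',
    Matrix.rank_mul_eq_right_of_isUnit_det _ _ h]

lemma rank_localOp {ρ : Op} (hρ : IsDensity ρ) {A B : Op₁} (hA : IsUnit A.det)
    (hB : IsUnit B.det) : (localOp A B ρ).rank = ρ.rank := by
  have h := inv_ne_zero (trace_filtered_ne_zero_of_isUnit hρ hA hB)
  rw [localOp, Matrix.rank_smul_of_mem_nonZeroDivisors _ (mem_nonZeroDivisors_of_ne_zero h),
    rank_filtered hA hB]

/-- If `maxConcurrence ρ = 1`, the block of `ρ` on the span of `|01⟩` and `|10⟩` is singular, and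
the kernel contains a vector besides `|00⟩`. -/
lemma HasCornerKernel.maxConcurrence_lt_one {ρ : Op} (hρ : IsDensity ρ) (h : HasCornerKernel ρ)
    (hC : 0 < concurrence ρ) (hr : ρ.rank = 3) : maxConcurrence ρ < 1 := by
  have hf := h.entry_ne_zero hρ hC
  have hm := midMean_pos hρ.1 hf
  have hm2 := midMean_sq hρ.1
  refine lt_of_le_of_ne (maxConcurrence_mem hρ.1 hC).2 fun h1 => ?_
  rw [h.maxConcurrence_eq hρ.1, div_eq_one_iff_eq hm.ne'] at h1
  have hji : ρ (1, 0) (0, 1) = starRingEnd ℂ (ρ (0, 1) (1, 0)) := (hρ.1.1.apply _ _).symm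
  have ha := (diag_eq_re hρ.1 (0, 1)).1
  have hb := (diag_eq_re hρ.1 (1, 0)).1
  have hab : starRingEnd ℂ (ρ (0, 1) (1, 0)) * ρ (0, 1) (1, 0) =
      (ρ (0, 1) (0, 1)).re * (ρ (1, 0) (1, 0)).re := by
    rw [← Complex.normSq_eq_conj_mul_self, Complex.normSq_eq_norm_sq, h1, hm2, Complex.ofReal_mul]
  let w : Vec := fun i => !![0, -ρ (0, 1) (1, 0); ρ (0, 1) (0, 1), 0] i.1 i.2
  have hw : ρ.mulVec w = 0 := by
    rw [← hρ.1.dotProduct_mulVec_zero_iff]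
    simp only [Matrix.mulVec, dotProduct, Fintype.sum_prod_type, Fin.sum_univ_two, hji]
    rw [← ha, ← hb] at hab
    have ha' : starRingEnd ℂ (ρ (0, 1) (0, 1)) = ρ (0, 1) (0, 1) := hρ.1.1.apply _ _
    simp [w, ha']
    linear_combination (-ρ (0, 1) (0, 1)) * hab
  have ha0 : (ρ (0, 1) (0, 1)).re ≠ 0 := by
    intro h0
    rw [h0, zero_mul] at hm2
    exact hm.ne' (by simpa using hm2)
  have hli : LinearIndependent ℂ ![corner, w] := by
    rw [LinearIndependent.pair_iff]
    intro s t hst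
    have e1 := congrFun hst (1, 0)
    have e2 := congrFun hst (0, 0)
    rw [corner_eq] at e1 e2
    simp [w] at e1 e2
    refine ⟨e2, e1.resolve_right fun h0 => ha0 (by rw [h0]; simp)⟩
  have hk : Submodule.span ℂ (Set.range ![corner, w]) ≤ LinearMap.ker (Matrix.toLin' ρ) := by
    rw [Submodule.span_le]
    rintro _ ⟨i, rfl⟩
    fin_cases i
    · simpa using hasCornerKernel_iff.1 h
    · simpa using hw
  have h2 := Submodule.finrank_mono hk
  rw [finrank_span_eq_card hli, Fintype.card_fin] at h2
  have h3 := LinearMap.finrank_range_add_finrank_ker (Matrix.toLin' ρ)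
  have h4 : ρ.rank = Module.finrank ℂ (LinearMap.range (Matrix.toLin' ρ)) := rfl
  rw [← h4, hr, Module.finrank_fintype_fun_eq_card, Fintype.card_prod, Fintype.card_fin] at h3
  exact absurd (h2.trans_eq (Nat.add_left_cancel (k := 1) h3)) (by decide)

lemma KernelSpannedByProductVector.maxConcurrence_lt_one {ρ : Op} (hρ : IsDensity ρ)
    (hC : 0 < concurrence ρ) (h : KernelSpannedByProductVector ρ) : maxConcurrence ρ < 1 := by
  obtain ⟨U, hU, V, hV, ρ₁, hρ₁, hd, hc, he, -⟩ := h.hasProductKernel.exists_normalForm hρ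
  rw [← concurrence_congr he] at hC
  rw [← maxConcurrence_congr he]
  refine hc.maxConcurrence_lt_one hd hC ?_
  rw [hρ₁, rank_filtered (isUnit_det_of_unitary hU) (isUnit_det_of_unitary hV), h.rank_eq]

lemma KernelSpannedByProductVector.rank_bestProduct {ρ : Op} (hρ : IsDensity ρ)
    (hC : 0 < concurrence ρ) (h : KernelSpannedByProductVector ρ) {σ : Op}
    (hσ : IsBestDistillationProduct ρ σ) : σ.rank = 2 := by
  have hlt := h.maxConcurrence_lt_one hρ hC
  obtain ⟨U, hU, V, hV, f, rfl, hf⟩ := h.hasProductKernel.exists_eq_bellBlock hρ hC hlt hσ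
  rw [rank_filtered (isUnit_det_of_unitary hU) (isUnit_det_of_unitary hV),
    rank_bellBlock (by linarith)]

/-- The supremum is not attained: a local product of `ρ` has rank three if the filters are
invertible, and concurrence zero otherwise, whereas best distillation products have rank two and
positive concurrence. -/
theorem KernelSpannedByProductVector.isIncompletelyQuasiDistillable {ρ : Op}
    (hρ : IsDensity ρ) (hC : 0 < concurrence ρ) (h : KernelSpannedByProductVector ρ) :
    IsIncompletelyQuasiDistillable ρ := by
  have hlt := h.maxConcurrence_lt_one hρ hC
  have hM := h.hasProductKernel.maxEntanglement_eq hρ hC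
  have hmem := maxConcurrence_mem hρ.1 hC
  refine ⟨?_, ?_, h.hasProductKernel.exists_bellDiagonal hρ hC⟩
  · rw [hM, ← entFn_one]
    exact entFn_strictMonoOn hmem (by simp) hlt
  · rintro ⟨τ, hτ, hE⟩
    have h2 : τ.rank = 2 := h.rank_bestProduct hρ hC
      ⟨⟨fun _ => τ, fun _ => hτ, tendsto_const_nhds⟩, hE⟩
    obtain ⟨A, B, hAB, rfl⟩ := hτ
    rw [entanglementOfFormation_localOp hρ.1 hC.le hAB, hM] at hE
    have hdet : A.det * B.det ≠ 0 := by
      intro h0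
      rw [filterRate, h0, norm_zero, zero_div, zero_mul] at hE
      exact (entFn_strictMonoOn (by simp) hmem (div_pos hC (rootSum_pos hρ.1 hC))).ne hE
    rw [mul_ne_zero_iff] at hdet
    rw [rank_localOp hρ (isUnit_iff_ne_zero.2 hdet.1) (isUnit_iff_ne_zero.2 hdet.2),
      h.rank_eq] at h2
    omega

end TwoQubit

open TwoQubit

theorem mainTheorem3 (ρ : TwoQubit.Op) (hρ : TwoQubit.IsEntangled ρ) :
    (TwoQubit.IsIncompletelyQuasiDistillable ρ ↔ TwoQubit.KernelSpannedByProductVector ρ) ∧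
    (TwoQubit.IsIncompletelyQuasiDistillable ρ →
      (∀ A B : TwoQubit.Op₁, IsUnit A.det → IsUnit B.det →
        ∃ c : ℝ, 0 < c ∧ TwoQubit.flipEigenvalues (TwoQubit.localOp A B ρ) =
          (TwoQubit.flipEigenvalues ρ).map fun z => (c : ℂ) * z) ∧
      ∃ l₁ l₂ : ℝ, 0 < l₂ ∧ l₂ < l₁ ∧
        TwoQubit.flipEigenvalues ρ = {(l₁ : ℂ), (l₂ : ℂ), 0, 0} ∧
        ∀ σ : TwoQubit.Op, TwoQubit.IsBestDistillationProduct ρ σ →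
          TwoQubit.IsBellDiagonal σ ∧ σ.rank = 2 ∧
          ∃ U ∈ Matrix.unitaryGroup (Fin 2) ℂ, ∃ V ∈ Matrix.unitaryGroup (Fin 2) ℂ, ∃ f : ℂ,
            σ = TwoQubit.filtered U V (TwoQubit.bellBlock f) ∧
            ‖f‖ < 1 / 2 ∧
            Real.sqrt l₁ / Real.sqrt l₂ = (1 / 2 + ‖f‖) / (1 / 2 - ‖f‖) ∧
            ‖f‖ = (Real.sqrt l₁ - Real.sqrt l₂) / (2 * (Real.sqrt l₁ + Real.sqrt l₂))) := by
  have hC := hρ.concurrence_pos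
  have hd := hρ.1
  refine ⟨⟨kernelSpannedByProductVector_of_isIncompletelyQuasiDistillable hd hC,
    KernelSpannedByProductVector.isIncompletelyQuasiDistillable hd hC⟩, fun hI => ⟨?_, ?_⟩⟩
  · intro A B hA hB
    refine ⟨filterRate A B ρ ^ 2, pow_pos (div_pos ?_ (trace_filtered_pos hd.1
      (trace_filtered_ne_zero_of_isUnit hd hA hB))) 2, flipEigenvalues_localOp hd.1 A B⟩
    exact norm_pos_iff.2 (mul_ne_zero hA.ne_zero hB.ne_zero)
  have hk := kernelSpannedByProductVector_of_isIncompletelyQuasiDistillable hd hC hI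
  have hlt := hk.maxConcurrence_lt_one hd hC
  obtain ⟨-, -, -, -, ρ₁, -, hd₁, hc, he, -⟩ := hk.hasProductKernel.exists_normalForm hd
  have hf := norm_pos_iff.2 (hc.entry_ne_zero hd₁ (by rwa [concurrence_congr he]))
  have hm := midMean_pos hd₁.1 (norm_pos_iff.1 hf)
  have hmax : maxConcurrence ρ = ‖ρ₁ (0, 1) (1, 0)‖ / midMean ρ₁ := by
    rw [← maxConcurrence_congr he, hc.maxConcurrence_eq hd₁.1]
  have hfm : ‖ρ₁ (0, 1) (1, 0)‖ < midMean ρ₁ := by rwa [hmax, div_lt_one hm] at hlt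
  refine ⟨(midMean ρ₁ + ‖ρ₁ (0, 1) (1, 0)‖) ^ 2, (midMean ρ₁ - ‖ρ₁ (0, 1) (1, 0)‖) ^ 2,
    pow_pos (by linarith) 2, by nlinarith, he ▸ hc.flipEigenvalues_eq hd₁.1, fun σ hσ => ?_⟩
  have hr := hk.rank_bestProduct hd hC hσ
  obtain ⟨U, hU, V, hV, f, rfl, hfσ⟩ := hk.hasProductKernel.exists_eq_bellBlock hd hC hlt hσ
  refine ⟨(isBellDiagonal_bellBlock f).filtered hU hV, hr, U, hU, V, hV, f, rfl, by linarith, ?_⟩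
  rw [Real.sqrt_sq (by linarith), Real.sqrt_sq (by linarith)]
  rw [hmax] at hfσ
  have hfσ' : ‖f‖ = ‖ρ₁ (0, 1) (1, 0)‖ / (2 * midMean ρ₁) := by
    rw [mul_comm 2, ← div_div, ← hfσ]; ring
  have hne : midMean ρ₁ - ‖ρ₁ (0, 1) (1, 0)‖ ≠ 0 := by linarith
  rw [hfσ']
  generalize ‖ρ₁ (0, 1) (1, 0)‖ = g at *
  generalize midMean ρ₁ = m at *
  constructor
  · have e1 : 1 / 2 + g / (2 * m) = (m + g) / (2 * m) := by field_simp
    have e2 : 1 / 2 - g / (2 * m) = (m - g) / (2 * m) := by field_simp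
    rw [e1, e2, div_div_div_cancel_right₀ (by positivity)]
  · have e1 : m + g - (m - g) = 2 * g := by ring
    have e2 : 2 * (m + g + (m - g)) = 2 * (2 * m) := by ring
    rw [e1, e2, mul_div_mul_left _ _ two_ne_zero]
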